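/- Let $F$ be a field of characteristic $0$ (for instance $\mathbb C$, or $\mathbb C(q)$ with $q$ an indeterminate), $q\in F^\times$, and $m,n,d\ge 0$ integers. Put $N=m+n$, $\bar i=0$ for $1\le i\le m$ and $\bar i=1$ for $m<i\le N$, and let $\varepsilon(a)\in\{1,0,-1\}$ be the sign of the integer $a$. Tensor products and opposites of superalgebras follow the sign rule: $(a\otimes b)(a'\otimes b')=(-1)^{\bar b\bar a'}aa'\otimes bb'$ and $a\circ b=(-1)^{\bar a\bar b}ba$. *The algebras.* Let $S^q$ be the superalgebra with generators $x_1,\dots,x_N$, $x_i$ of parity $\bar i$, and relations $x_i^2=0$ for $\bar i=1$ and $x_jx_i=q^{\varepsilon(j-i)}(-1)^{\bar i\bar j}x_ix_j$. Let $\Lambda^q$ be the superalgebra with generators $\psi_1,\dots,\psi_N$, $\psi_i$ of parity $1-\bar i$, and relations $\psi_i^2=0$ for $\bar i=0$ and $\psi_k\psi_l=q^{\varepsilon(l-k)}(-1)^{(\bar k+1)(\bar l+1)}\psi_l\psi_k$. The right quantum relations with parameter $q$ for a matrix $M=(M_{ij})_{1\le i,j\le N}$, $M_{ij}$ of parity $\bar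 i+\bar j$, are $$M_{ij}^2=0\quad(\bar i=1,\ \bar j=0),$$ $$M_{ik}M_{il}=q^{\varepsilon(l-k)}(-1)^{(\bar k+1)(\bar l+1)}M_{il}M_{ik}\quad(\bar i=1),\qquad M_{ik}M_{jk}=q^{\varepsilon(i-j)}(-1)^{\bar i\bar j}M_{jk}M_{ik}\quad(\bar k=0),$$ $$M_{ij}M_{kl}-q^{\varepsilon(i-k)+\varepsilon(l-j)}(-1)^{(\bar i+\bar j)(\bar k+\bar l)}M_{kl}M_{ij}=q^{\varepsilon(i-k)}(-1)^{\bar i\bar k+\bar j\bar k+\bar i\bar j}M_{kj}M_{il}-q^{\varepsilon(l-j)}(-1)^{\bar j\bar k+\bar j\bar l+\bar k\bar l}M_{il}M_{kj}$$ for all $i,j,k,l$. Let $(A^{st})_{ij}=(-1)^{\bar i(\bar i+\bar j)}A_{ji}$. The Hopf superalgebra $\widetilde{\mathcal M}_{m|n}$ is generated by the entries of $N\times N$ matrices $\bar M_0,\bar M_1,\bar M_2,\dots$ subject to $\bar M_k^{st^k}\bar M_{k+1}^{st^k}=I=\bar M_{k+1}^{st^k}\bar M_k^{st^k}$, the right quantum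 relations for $\bar M_k$ with parameter $q$ ($k$ even) or $q^{-1}$ ($k$ odd), and $\bar M_{k+2d}=\bar M_k$, for all $k\ge0$ (the last relations are void if $d=0$). Write $M=\bar M_0$ and $M^{-1}=\bar M_1$. *The quantum Berezinian.* Let $\mathcal K=\Lambda^q\otimes S^q$, $c=\sum_{i=1}^N\psi_i\otimes x_i$, $\mathrm d(k)=kc$ and $H=\ker\mathrm d/\operatorname{Im}\mathrm d$. Let $\delta:\mathcal K\to\mathcal K\otimes\widetilde{\mathcal M}_{m|n}$ be the linear map $\delta(\omega s)=\delta(\omega)\delta(s)$ ($\omega\in\Lambda^q$, $s\in S^q$), the product being formed as $(\omega'\otimes a)(s'\otimes b)=(-1)^{\bar a\bar s'}\omega's'\otimes ab$, where on $\Lambda^q$ it is the algebra homomorphism with $\delta(\psi_i)=\sum_j\psi_j\otimes M_{ji}$, and on $S^q$ it is given by $\delta(x_i)=\sum_k(-1)^{\bar k(\bar k+\bar i)}x_k\otimes (M^{-1})_{ik}$, extended as a homomorphism $(S^q)^{op}\to(S^q)^{op}\otimes\widetilde{\mathcal M}_{m|n}$ for the opposite algebra structure of $S^q$. The quantum Berezinian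 $\mathrm{Ber}_q(M)\in\widetilde{\mathcal M}_{m|n}$ is the element with $$\delta\big[\psi_1\cdots\psi_m\,x_{m+n}\cdots x_{m+1}\big]=\big[\psi_1\cdots\psi_m\,x_{m+n}\cdots x_{m+1}\big]\otimes \mathrm{Ber}_q(M)\quad\text{in } H\otimes\widetilde{\mathcal M}_{m|n}.$$ *Quasideterminants.* For a square matrix $A$ over a ring, let $A^{ij}$ be $A$ without row $i$ and column $j$, and $A^{(k)}=(A_{ij})_{1\le i,j\le k}$. If $A^{ij}$ is invertible, put $|A|_{ij}=a_{ij}-r_i^j(A^{ij})^{-1}c_j^i$, where $r_i^j$ is the $i$-th row and $c_j^i$ the $j$-th column of $A$, both without $a_{ij}$. **Theorem.** The quantum Berezinian $\mathrm{Ber}_q(M)$ exists and is unique. Let $f:\widetilde{\mathcal M}_{m|n}\to A$ be any homomorphism of $F$-algebras such that the images under $f$ of $M^{(1)},\dots,M^{(m+n-1)}$ are invertible matrices, so that the quasideterminants below are defined over $A$ (for example the universal localization of $\widetilde{\mathcal M}_{m|n}$ that inverts these matrices). Then the elements $|M^{(m+1)}|_{m+1,m+1},\dots,|M^{(m+n)}|_{m+n,m+n}$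 of $A$ are invertible, and $$\mathrm{Ber}_q(M)=\big|M^{(1)}\big|_{11}\cdots\big|M^{(m)}\big|_{mm}\,\big|M^{(m+1)}\big|^{-1}_{m+1,m+1}\cdots\big|M^{(m+n)}\big|^{-1}_{m+n,m+n}\quad\text{in } A,$$ where $M$ and $\mathrm{Ber}_q(M)$ are read through $f$. -/

import Mathlib

open scoped TensorProduct

namespace QBer

universe u v

/-! ## Superalgebras

Over a field of characteristic zero a `ℤ/2`-grading of an algebra is the same as an involutive
automorphism (the parity automorphism, `a ↦ (-1)^{|a|} a`): the homogeneous parts are its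
eigenspaces. -/

/-- A superalgebra, given by its parity automorphism `a ↦ (-1)^{|a|} a`. -/
class SuperAlgebra (F : Type u) (A : Type v) [Field F] [Ring A] [Algebra F A] where
  parity : A →ₐ[F] A
  parity_parity : ∀ a, parity (parity a) = a

/-- `sgn z = (-1)^z` in the ground field. -/
def sgn (F : Type u) [Field F] (z : ZMod 2) : F := if z = 0 then 1 else -1

section Super

variable (F : Type u) {A : Type v} [Field F] [Ring A] [Algebra F A] [SuperAlgebra F A]

/-- The parity automorphism. -/
abbrev par : A →ₐ[F] A := SuperAlgebra.parity

/-- The even component of an element. -/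
def evenPart : A →ₗ[F] A := (2⁻¹ : F) • (LinearMap.id + (par F : A →ₐ[F] A).toLinearMap)

/-- The odd component of an element. -/
def oddPart : A →ₗ[F] A := (2⁻¹ : F) • (LinearMap.id - (par F : A →ₐ[F] A).toLinearMap)

variable (A) in
/-- The homogeneous components `A_z = {a : parity a = (-1)^z a}`, `z ∈ ℤ/2`. -/
def grading (z : ZMod 2) : Submodule F A where
  carrier := {a | par F a = sgn F z • a}
  add_mem' {a b} ha hb := by
    simp only [Set.mem_ofPred_eq] at *
    rw [map_add, ha, hb, smul_add]
  zero_mem' := by simp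
  smul_mem' c a ha := by
    simp only [Set.mem_ofPred_eq] at *
    rw [map_smul, ha, smul_comm]

variable {F}

theorem mem_grading {z : ZMod 2} {a : A} : a ∈ grading F A z ↔ par F a = sgn F z • a := Iff.rfl

theorem par_par (a : A) : par F (par F a) = a := SuperAlgebra.parity_parity a

theorem evenPart_apply (a : A) : evenPart F a = (2⁻¹ : F) • (a + par F a) := rfl

theorem oddPart_apply (a : A) : oddPart F a = (2⁻¹ : F) • (a - par F a) := rfl

theorem sgn_zero : sgn F 0 = 1 := rfl
theorem sgn_one : sgn F 1 = -1 := rfl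

theorem zmod2_cases (z : ZMod 2) : z = 0 ∨ z = 1 := by revert z; decide

theorem sgn_add (y z : ZMod 2) : sgn F (y + z) = sgn F y * sgn F z := by
  have h : (1 : ZMod 2) + 1 = 0 := by decide
  rcases zmod2_cases y with rfl | rfl <;> rcases zmod2_cases z with rfl | rfl <;>
    simp [sgn_zero, sgn_one, h]

theorem sgn_sq (z : ZMod 2) : sgn F z * sgn F z = 1 := by
  rcases zmod2_cases z with rfl | rfl <;> simp [sgn_zero, sgn_one]

theorem mul_mem_grading {y z : ZMod 2} {a b : A} (ha : a ∈ grading F A y)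
    (hb : b ∈ grading F A z) : a * b ∈ grading F A (y + z) := by
  rw [mem_grading] at *
  rw [map_mul, ha, hb, sgn_add, smul_mul_smul_comm]

theorem par_even (a : A) : par F (evenPart F a) = evenPart F a := by
  rw [evenPart_apply, map_smul, map_add, par_par, add_comm]

theorem par_odd (a : A) : par F (oddPart F a) = -oddPart F a := by
  rw [oddPart_apply, map_smul, map_sub, par_par, ← smul_neg, neg_sub]

theorem even_mem (a : A) : evenPart F a ∈ grading F A 0 := by
  rw [mem_grading, par_even, sgn_zero, one_smul]

theorem odd_mem (a : A) : oddPart F a ∈ grading F A 1 := by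
  rw [mem_grading, par_odd, sgn_one, neg_one_smul]

theorem odd_of_mem_zero {a : A} (h : a ∈ grading F A 0) : oddPart F a = 0 := by
  rw [mem_grading, sgn_zero, one_smul] at h
  rw [oddPart_apply, h, sub_self, smul_zero]

theorem even_of_mem_one {a : A} (h : a ∈ grading F A 1) : evenPart F a = 0 := by
  rw [mem_grading, sgn_one, neg_one_smul] at h
  rw [evenPart_apply, h, add_neg_cancel, smul_zero]

variable [CharZero F]

theorem even_add_odd (a : A) : evenPart F a + oddPart F a = a := by
  rw [evenPart_apply, oddPart_apply, ← smul_add]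
  have : a + par F a + (a - par F a) = (2 : F) • a := by rw [two_smul]; abel
  rw [this, smul_smul]; simp

theorem even_of_mem_zero {a : A} (h : a ∈ grading F A 0) : evenPart F a = a := by
  rw [mem_grading, sgn_zero, one_smul] at h
  rw [evenPart_apply, h, ← two_smul F a, smul_smul]; simp

theorem odd_of_mem_one {a : A} (h : a ∈ grading F A 1) : oddPart F a = a := by
  rw [mem_grading, sgn_one, neg_one_smul] at h
  rw [oddPart_apply, h, sub_neg_eq_add, ← two_smul F a, smul_smul]; simp

theorem even_mul (a b : A) : evenPart F (a * b) =
    evenPart F a * evenPart F b + oddPart F a * oddPart F b := by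
  conv_lhs => rw [← even_add_odd (F := F) a, ← even_add_odd (F := F) b]
  simp only [add_mul, mul_add, map_add]
  rw [even_of_mem_zero (mul_mem_grading (even_mem a) (even_mem b)),
    even_of_mem_zero (a := oddPart F a * oddPart F b)
      (mul_mem_grading (odd_mem a) (odd_mem b)),
    even_of_mem_one (a := evenPart F a * oddPart F b)
      (mul_mem_grading (even_mem a) (odd_mem b)),
    even_of_mem_one (a := oddPart F a * evenPart F b)
      (mul_mem_grading (odd_mem a) (even_mem b))]
  abel

theorem odd_mul (a b : A) : oddPart F (a * b) =
    evenPart F a * oddPart F b + oddPart F a * evenPart F b := by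
  conv_lhs => rw [← even_add_odd (F := F) a, ← even_add_odd (F := F) b]
  simp only [add_mul, mul_add, map_add]
  rw [odd_of_mem_zero (mul_mem_grading (even_mem a) (even_mem b)),
    odd_of_mem_zero (a := oddPart F a * oddPart F b)
      (mul_mem_grading (odd_mem a) (odd_mem b)),
    odd_of_mem_one (a := evenPart F a * oddPart F b)
      (mul_mem_grading (even_mem a) (odd_mem b)),
    odd_of_mem_one (a := oddPart F a * evenPart F b)
      (mul_mem_grading (odd_mem a) (even_mem b))]
  abel

/-- The homogeneous components of a superalgebra make it a `ℤ/2`-graded algebra. -/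
noncomputable instance : GradedAlgebra (grading F A) :=
  letI dec : DirectSum.Decomposition (grading F A) :=
    DirectSum.Decomposition.ofLinearMap (grading F A)
      (DirectSum.lof F (ZMod 2) (fun z => grading F A z) 0 ∘ₗ
          (evenPart F).codRestrict (grading F A 0) even_mem +
        DirectSum.lof F (ZMod 2) (fun z => grading F A z) 1 ∘ₗ
          (oddPart F).codRestrict (grading F A 1) odd_mem)
      (by ext a; simp [DirectSum.coeLinearMap_lof, even_add_odd])
      (by
        refine DirectSum.linearMap_ext F fun z => LinearMap.ext fun x => ?_
        obtain ⟨x, hx⟩ := x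
        simp only [LinearMap.comp_apply, DirectSum.coeLinearMap_lof, LinearMap.add_apply,
          LinearMap.id_apply]
        rcases zmod2_cases z with rfl | rfl
        · have h0 : (evenPart F).codRestrict (grading F A 0) even_mem x = ⟨x, hx⟩ :=
            Subtype.ext (even_of_mem_zero hx)
          have h1 : (oddPart F).codRestrict (grading F A 1) odd_mem x = 0 :=
            Subtype.ext (odd_of_mem_zero hx)
          rw [h0, h1, map_zero, add_zero]
        · have h0 : (evenPart F).codRestrict (grading F A 0) even_mem x = 0 :=
            Subtype.ext (even_of_mem_one hx)
          have h1 : (oddPart F).codRestrict (grading F A 1) odd_mem x = ⟨x, hx⟩ :=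
            Subtype.ext (odd_of_mem_one hx)
          rw [h0, h1, map_zero, zero_add])
  { dec with
    one_mem := by rw [mem_grading, map_one, sgn_zero, one_smul]
    mul_mem := fun _ _ _ _ ha hb => mul_mem_grading ha hb }

end Super

/-- The super tensor product `A ⊗ B` of two superalgebras, that is, the tensor product with
`(a ⊗ b)(a' ⊗ b') = (-1)^{|b||a'|} aa' ⊗ bb'`. -/
abbrev STensor (F : Type u) (A B : Type v) [Field F] [CharZero F] [Ring A] [Algebra F A]
    [SuperAlgebra F A] [Ring B] [Algebra F B] [SuperAlgebra F B] : Type v :=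
  GradedTensorProduct F (grading F A) (grading F B)

theorem tmul_mul_tmul {F : Type u} {A B : Type v} [Field F] [CharZero F] [Ring A] [Algebra F A]
    [SuperAlgebra F A] [Ring B] [Algebra F B] [SuperAlgebra F B] {y z : ZMod 2}
    (a : A) {b : B} (hb : b ∈ grading F B y) {a' : A} (ha' : a' ∈ grading F A z) (b' : B) :
    (a ᵍ⊗ₜ[F] b * a' ᵍ⊗ₜ[F] b' : STensor F A B) =
      sgn F (y * z) • ((a * a') ᵍ⊗ₜ[F] (b * b')) := by
  have := GradedTensorProduct.tmul_coe_mul_coe_tmul (R := F) (grading F A) (grading F B)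
    a ⟨b, hb⟩ ⟨a', ha'⟩ b'
  refine this.trans ?_
  rcases zmod2_cases (y * z) with h | h <;> rw [h]
  · simp [sgn_zero]
  · simp [sgn_one]

/-! ## The opposite superalgebra -/

/-- The opposite of a superalgebra: the same space with the product
`a ∘ b = (-1)^{|a||b|} b a`. -/
def SuperOp (_F : Type u) (A : Type v) : Type v := A

section SuperOp

variable (F : Type u) (A : Type v) [Field F] [Ring A] [Algebra F A]

instance : AddCommGroup (SuperOp F A) := inferInstanceAs (AddCommGroup A)
instance : Module F (SuperOp F A) := inferInstanceAs (Module F A)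

/-- The identity map from a superalgebra to its opposite. -/
def toOp : A ≃ₗ[F] SuperOp F A := LinearEquiv.refl F A

instance : One (SuperOp F A) := ⟨toOp F A 1⟩

variable {F A} in
theorem op_ind {P : SuperOp F A → Prop} (h : ∀ a : A, P (toOp F A a)) (x : SuperOp F A) : P x :=
  h ((toOp F A).symm x)

theorem toOp_one : toOp F A 1 = 1 := rfl

variable [SuperAlgebra F A]

/-- For `a = a₀ + a₁` with `a₀` even and `a₁` odd, `(-1)^{|a||b|} b a` is
`b a₀ + (-1)^{|b|} b a₁`. -/
instance : Mul (SuperOp F A) where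
  mul a b := toOp F A ((toOp F A).symm b * evenPart F ((toOp F A).symm a) +
    par F ((toOp F A).symm b) * oddPart F ((toOp F A).symm a))

theorem toOp_mul_def (a b : A) : toOp F A a * toOp F A b =
    toOp F A (b * evenPart F a + par F b * oddPart F a) := rfl

variable [CharZero F]

theorem par_eq (a : A) : par F a = evenPart F a - oddPart F a := by
  conv_lhs => rw [← even_add_odd (F := F) a]
  rw [map_add, par_even, par_odd, sub_eq_add_neg]

theorem toOp_mul_def' (a b : A) : toOp F A a * toOp F A b =
    toOp F A (evenPart F b * evenPart F a + oddPart F b * evenPart F a +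
      evenPart F b * oddPart F a - oddPart F b * oddPart F a) := by
  rw [toOp_mul_def, par_eq]
  conv_lhs => enter [2, 1, 1]; rw [← even_add_odd (F := F) b]
  congr 1
  noncomm_ring

noncomputable instance : Ring (SuperOp F A) :=
  { (inferInstance : AddCommGroup (SuperOp F A)) with
    mul := (· * ·)
    one := 1
    left_distrib := fun a b c => by
      induction a using op_ind with | _ a
      induction b using op_ind with | _ b
      induction c using op_ind with | _ c
      simp only [toOp_mul_def', ← map_add (toOp F A)]
      simp only [map_add]
      simp only [← map_add (toOp F A)]
      congr 1
      noncomm_ring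
    right_distrib := fun a b c => by
      induction a using op_ind with | _ a
      induction b using op_ind with | _ b
      induction c using op_ind with | _ c
      simp only [toOp_mul_def', ← map_add (toOp F A)]
      simp only [map_add]
      simp only [← map_add (toOp F A)]
      congr 1
      noncomm_ring
    zero_mul := fun a => by
      induction a using op_ind with | _ a
      rw [← map_zero (toOp F A), toOp_mul_def]
      simp
    mul_zero := fun a => by
      induction a using op_ind with | _ a
      rw [← map_zero (toOp F A), toOp_mul_def]
      simp
    mul_assoc := fun a b c => by
      induction a using op_ind with | _ a
      induction b using op_ind with | _ b
      induction c using op_ind with | _ c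
      have e0 : ∀ x : A, evenPart F (evenPart F x) = evenPart F x :=
        fun x => even_of_mem_zero (even_mem x)
      have e1 : ∀ x : A, evenPart F (oddPart F x) = 0 := fun x => even_of_mem_one (odd_mem x)
      have o0 : ∀ x : A, oddPart F (evenPart F x) = 0 := fun x => odd_of_mem_zero (even_mem x)
      have o1 : ∀ x : A, oddPart F (oddPart F x) = oddPart F x :=
        fun x => odd_of_mem_one (odd_mem x)
      simp only [toOp_mul_def']
      congr 1
      simp only [map_add, map_sub, even_mul, odd_mul, e0, e1, o0, o1,
        mul_zero, zero_mul, add_zero, zero_add, sub_zero]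
      noncomm_ring
    one_mul := fun a => by
      induction a using op_ind with | _ a
      have h : (1 : A) ∈ grading F A 0 := by rw [mem_grading, map_one, sgn_zero, one_smul]
      rw [← toOp_one, toOp_mul_def, even_of_mem_zero h, odd_of_mem_zero h, mul_one, mul_zero,
        add_zero]
    mul_one := fun a => by
      induction a using op_ind with | _ a
      rw [← toOp_one, toOp_mul_def, map_one, one_mul, one_mul, even_add_odd] }

noncomputable instance : Algebra F (SuperOp F A) :=
  Algebra.ofModule
    (fun r a b => by
      induction a using op_ind with | _ a
      induction b using op_ind with | _ b
      rw [← map_smul, toOp_mul_def, toOp_mul_def, ← map_smul]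
      simp only [map_smul, mul_smul_comm, smul_add])
    (fun r a b => by
      induction a using op_ind with | _ a
      induction b using op_ind with | _ b
      rw [← map_smul, toOp_mul_def, toOp_mul_def, ← map_smul]
      simp only [map_smul, smul_mul_assoc, smul_add])

/-- The parity map of the opposite superalgebra is that of the superalgebra. -/
noncomputable def opParity : SuperOp F A →ₐ[F] SuperOp F A :=
  AlgHom.ofLinearMap
    ((toOp F A).toLinearMap ∘ₗ (par F : A →ₐ[F] A).toLinearMap ∘ₗ (toOp F A).symm.toLinearMap)
    (by
      rw [← toOp_one]
      simp)
    (fun a b => by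
      induction a using op_ind with | _ a
      induction b using op_ind with | _ b
      have h0 : evenPart F (par F a) = evenPart F a := by
        rw [evenPart_apply, evenPart_apply, par_par, add_comm]
      have h1 : oddPart F (par F a) = -oddPart F a := by
        rw [oddPart_apply, oddPart_apply, par_par, ← smul_neg, neg_sub]
      rw [toOp_mul_def]
      simp only [LinearMap.comp_apply, LinearEquiv.coe_coe, LinearEquiv.symm_apply_apply,
        AlgHom.toLinearMap_apply]
      rw [toOp_mul_def, map_add, map_mul, map_mul, par_even, par_odd, h0, h1])

theorem opParity_toOp (a : A) : opParity F A (toOp F A a) = toOp F A (par F a) := rfl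

noncomputable instance : SuperAlgebra F (SuperOp F A) where
  parity := opParity F A
  parity_parity a := by
    induction a using op_ind with | _ a
    rw [opParity_toOp, opParity_toOp, par_par]

variable {F A}

theorem toOp_mem {z : ZMod 2} {a : A} (h : a ∈ grading F A z) :
    toOp F A a ∈ grading F (SuperOp F A) z := by
  rw [mem_grading] at *
  exact (opParity_toOp F A a).trans (by rw [h, map_smul])

theorem toOp_mul {y z : ZMod 2} {a b : A} (ha : a ∈ grading F A y) (hb : b ∈ grading F A z) :
    toOp F A a * toOp F A b = sgn F (y * z) • toOp F A (b * a) := by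
  rw [toOp_mul_def]
  rcases zmod2_cases y with rfl | rfl
  · rw [even_of_mem_zero ha, odd_of_mem_zero ha, mul_zero, add_zero, zero_mul, sgn_zero, one_smul]
  · rw [even_of_mem_one ha, odd_of_mem_one ha, mul_zero, zero_add, one_mul,
      mem_grading.1 hb, smul_mul_assoc, map_smul]

end SuperOp

/-! ## Superalgebras given by homogeneous generators and relations -/

section Presented

variable (F : Type u) [Field F] {X : Type} (deg : X → ZMod 2)

/-- The parity automorphism of the free algebra on generators `x` of parity `deg x`. -/
noncomputable def freeParity : FreeAlgebra F X →ₐ[F] FreeAlgebra F X :=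
  FreeAlgebra.lift F fun x => sgn F (deg x) • FreeAlgebra.ι F x

theorem freeParity_ι (x : X) :
    freeParity F deg (FreeAlgebra.ι F x) = sgn F (deg x) • FreeAlgebra.ι F x := by
  simp [freeParity]

/-- Both sides of every relation are homogeneous, of the same parity. -/
def Homogeneous (r : FreeAlgebra F X → FreeAlgebra F X → Prop) : Prop :=
  ∀ a b, r a b → ∃ z, freeParity F deg a = sgn F z • a ∧ freeParity F deg b = sgn F z • b

variable {F deg}

/-- The superalgebra structure on the algebra with homogeneous generators and relations. -/
@[reducible]
noncomputable def quotSuper {r : FreeAlgebra F X → FreeAlgebra F X → Prop}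
    (hr : Homogeneous F deg r) : SuperAlgebra F (RingQuot r) where
  parity := RingQuot.liftAlgHom F ⟨(RingQuot.mkAlgHom F r).comp (freeParity F deg), by
    intro a b hab
    obtain ⟨z, ha, hb⟩ := hr a b hab
    rw [AlgHom.comp_apply, AlgHom.comp_apply, ha, hb, map_smul, map_smul,
      RingQuot.mkAlgHom_rel F hab]⟩
  parity_parity a := by
    refine AlgHom.congr_fun (φ₁ := AlgHom.comp _ _) (φ₂ := AlgHom.id F _) ?_ a
    refine RingQuot.ringQuot_ext' (S := F) _ _ (FreeAlgebra.hom_ext (funext fun x => ?_))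
    simp [freeParity_ι, smul_smul, sgn_sq]

theorem quotSuper_mk {r : FreeAlgebra F X → FreeAlgebra F X → Prop}
    (hr : Homogeneous F deg r) (x : X) :
    (quotSuper hr).parity (RingQuot.mkAlgHom F r (FreeAlgebra.ι F x)) =
      sgn F (deg x) • RingQuot.mkAlgHom F r (FreeAlgebra.ι F x) := by
  refine (RingQuot.liftAlgHom_mkAlgHom_apply F _ _ _).trans ?_
  rw [AlgHom.comp_apply, freeParity_ι, map_smul]

end Presented

/-! ## Indices, parities and twisting coefficients -/

/-- The parity of the index `i`: the first `m` indices are even, the last `n` are odd. -/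
def pty (m n : ℕ) (i : Fin (m + n)) : ZMod 2 := if i.val < m then 0 else 1

/-- `qe q i j = q ^ ε(i - j)` where `ε` is the sign function. -/
def qe {F : Type u} [Field F] (q : Fˣ) {N : ℕ} (i j : Fin N) : F :=
  ((q ^ Int.sign ((i.val : ℤ) - (j.val : ℤ)) : Fˣ) : F)

theorem qe_mul_swap {F : Type u} [Field F] (q : Fˣ) {N : ℕ} (i j : Fin N) :
    qe q i j * qe q j i = 1 := by
  have h : Int.sign ((j.val : ℤ) - (i.val : ℤ)) = -Int.sign ((i.val : ℤ) - (j.val : ℤ)) := by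
    rw [← Int.sign_neg, neg_sub]
  rw [qe, qe, h, ← Units.val_mul, ← zpow_add, add_neg_cancel, zpow_zero, Units.val_one]

theorem qe_inv_unit {F : Type u} [Field F] (q : Fˣ) {N : ℕ} (i j : Fin N) :
    qe q⁻¹ i j = qe q j i := by
  have h : Int.sign ((j.val : ℤ) - (i.val : ℤ)) = -Int.sign ((i.val : ℤ) - (j.val : ℤ)) := by
    rw [← Int.sign_neg, neg_sub]
  rw [qe, qe, h, inv_zpow, zpow_neg]

theorem qe_self {F : Type u} [Field F] (q : Fˣ) {N : ℕ} (i : Fin N) : qe q i i = 1 := by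
  simp [qe]

section Algebras

variable {F : Type u} [Field F] (q : Fˣ) (m n : ℕ)

/-! ## The quantum symmetric superalgebra -/

/-- The relations of the quantum symmetric superalgebra. -/
inductive SymRel :
    FreeAlgebra F (Fin (m + n)) → FreeAlgebra F (Fin (m + n)) → Prop
  | sq (i : Fin (m + n)) (hi : pty m n i = 1) :
      SymRel (FreeAlgebra.ι F i * FreeAlgebra.ι F i) 0
  | comm (i j : Fin (m + n)) :
      SymRel (FreeAlgebra.ι F j * FreeAlgebra.ι F i)
        ((qe q j i * sgn F (pty m n i * pty m n j)) • (FreeAlgebra.ι F i * FreeAlgebra.ι F j))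

theorem symRel_homogeneous : Homogeneous F (pty m n) (SymRel q m n) := by
  rintro _ _ (⟨i, hi⟩ | ⟨i, j⟩)
  · exact ⟨pty m n i + pty m n i, by
      rw [map_mul, freeParity_ι, smul_mul_smul_comm, sgn_add], by simp⟩
  · exact ⟨pty m n j + pty m n i, by
      rw [map_mul, freeParity_ι, freeParity_ι, smul_mul_smul_comm, sgn_add], by
      rw [map_smul, map_mul, freeParity_ι, freeParity_ι, smul_mul_smul_comm, sgn_add,
        smul_comm, mul_comm (sgn F (pty m n i))]⟩

/-- The quantum symmetric superalgebra `S^q(V)`, generated by `x_1, …, x_{m+n}`. -/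
def QSym : Type u := RingQuot (SymRel q m n)

noncomputable instance : Ring (QSym q m n) := inferInstanceAs (Ring (RingQuot (SymRel q m n)))
noncomputable instance : Algebra F (QSym q m n) :=
  inferInstanceAs (Algebra F (RingQuot (SymRel q m n)))
/-- `x_i` has parity `ī`. -/
noncomputable instance : SuperAlgebra F (QSym q m n) := quotSuper (symRel_homogeneous q m n)

/-- The generator `x_i`. -/
noncomputable def x (i : Fin (m + n)) : QSym q m n :=
  RingQuot.mkAlgHom F (SymRel q m n) (FreeAlgebra.ι F i)

theorem x_mem (i : Fin (m + n)) : x q m n i ∈ grading F (QSym q m n) (pty m n i) :=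
  quotSuper_mk (symRel_homogeneous q m n) i

theorem x_sq {i : Fin (m + n)} (hi : pty m n i = 1) : x q m n i * x q m n i = 0 := by
  have h := RingQuot.mkAlgHom_rel F (SymRel.sq (q := q) i hi)
  rw [map_mul, map_zero] at h
  exact h

theorem x_comm (i j : Fin (m + n)) : x q m n j * x q m n i =
    (qe q j i * sgn F (pty m n i * pty m n j)) • (x q m n i * x q m n j) := by
  have h := RingQuot.mkAlgHom_rel F (SymRel.comm (q := q) i j)
  rw [map_mul, map_smul, map_mul] at h
  exact h

/-! ## The quantum exterior superalgebra -/

/-- The relations of the quantum exterior superalgebra. -/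
inductive ExtRel :
    FreeAlgebra F (Fin (m + n)) → FreeAlgebra F (Fin (m + n)) → Prop
  | sq (i : Fin (m + n)) (hi : pty m n i = 0) :
      ExtRel (FreeAlgebra.ι F i * FreeAlgebra.ι F i) 0
  | comm (k l : Fin (m + n)) :
      ExtRel (FreeAlgebra.ι F k * FreeAlgebra.ι F l)
        ((qe q l k * sgn F ((pty m n k + 1) * (pty m n l + 1))) •
          (FreeAlgebra.ι F l * FreeAlgebra.ι F k))

theorem extRel_homogeneous : Homogeneous F (fun i => 1 + pty m n i) (ExtRel q m n) := by
  rintro _ _ (⟨i, hi⟩ | ⟨i, j⟩)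
  · exact ⟨(1 + pty m n i) + (1 + pty m n i), by
      rw [map_mul, freeParity_ι, smul_mul_smul_comm, sgn_add (1 + pty m n i)], by simp⟩
  · exact ⟨(1 + pty m n i) + (1 + pty m n j), by
      rw [map_mul, freeParity_ι, freeParity_ι, smul_mul_smul_comm, sgn_add (1 + pty m n i)], by
      rw [map_smul, map_mul, freeParity_ι, freeParity_ι, smul_mul_smul_comm,
        sgn_add (1 + pty m n i), smul_comm, mul_comm (sgn F (1 + pty m n i))]⟩

/-- The quantum exterior superalgebra `Λ^q(V*)`, generated by `ψ_1, …, ψ_{m+n}`. -/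
def QExt : Type u := RingQuot (ExtRel q m n)

noncomputable instance : Ring (QExt q m n) := inferInstanceAs (Ring (RingQuot (ExtRel q m n)))
noncomputable instance : Algebra F (QExt q m n) :=
  inferInstanceAs (Algebra F (RingQuot (ExtRel q m n)))
/-- `ψ_i` has parity `1 - ī`. -/
noncomputable instance : SuperAlgebra F (QExt q m n) := quotSuper (extRel_homogeneous q m n)

/-- The generator `ψ_i`. -/
noncomputable def ψ (i : Fin (m + n)) : QExt q m n :=
  RingQuot.mkAlgHom F (ExtRel q m n) (FreeAlgebra.ι F i)

theorem ψ_mem (i : Fin (m + n)) : ψ q m n i ∈ grading F (QExt q m n) (1 + pty m n i) :=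
  quotSuper_mk (extRel_homogeneous q m n) i

theorem ψ_sq {i : Fin (m + n)} (hi : pty m n i = 0) : ψ q m n i * ψ q m n i = 0 := by
  have h := RingQuot.mkAlgHom_rel F (ExtRel.sq (q := q) i hi)
  rw [map_mul, map_zero] at h
  exact h

theorem ψ_comm (k l : Fin (m + n)) : ψ q m n k * ψ q m n l =
    (qe q l k * sgn F ((pty m n k + 1) * (pty m n l + 1))) • (ψ q m n l * ψ q m n k) := by
  have h := RingQuot.mkAlgHom_rel F (ExtRel.comm (q := q) k l)
  rw [map_mul, map_smul, map_mul] at h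
  exact h

/-! ## The Hopf envelope of the right quantum superalgebra -/

variable {m n} in
/-- The quadratic relations of the right quantum superalgebra with parameter `q`, for the entries
of a matrix `X` over an algebra: `ManinRel q X a b` says that `a = b` is one of them. -/
inductive ManinRel {A : Type u} [Ring A] [Algebra F A]
    (X : Matrix (Fin (m + n)) (Fin (m + n)) A) : A → A → Prop
  | sq (i j : Fin (m + n)) (hi : pty m n i = 1) (hj : pty m n j = 0) :
      ManinRel X (X i j * X i j) 0
  | row (i k l : Fin (m + n)) (hi : pty m n i = 1) :
      ManinRel X
        (X i k * X i l - (qe q l k * sgn F ((pty m n k + 1) * (pty m n l + 1))) • (X i l * X i k))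
        0
  | col (i j k : Fin (m + n)) (hk : pty m n k = 0) :
      ManinRel X
        (X i k * X j k - (qe q i j * sgn F (pty m n i * pty m n j)) • (X j k * X i k))
        0
  | cross (i j k l : Fin (m + n)) :
      ManinRel X
        (X i j * X k l -
          (qe q i k * qe q l j * sgn F ((pty m n i + pty m n j) * (pty m n k + pty m n l))) •
            (X k l * X i j))
        ((qe q i k * sgn F (pty m n i * pty m n k + pty m n j * pty m n k +
            pty m n i * pty m n j)) • (X k j * X i l) -
          (qe q l j * sgn F (pty m n j * pty m n k + pty m n j * pty m n l +
            pty m n k * pty m n l)) • (X i l * X k j))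

variable {m n} in
/-- The supertranspose `(A^{st})_{ij} = (-1)^{ī(ī+j̄)} A_{ji}`. -/
def supertranspose (F : Type u) [Field F] {A : Type u} [Ring A] [Algebra F A]
    (X : Matrix (Fin (m + n)) (Fin (m + n)) A) : Matrix (Fin (m + n)) (Fin (m + n)) A :=
  Matrix.of fun i j => sgn F (pty m n i * (pty m n i + pty m n j)) • X j i

/-- The matrix of generators `M̄_k` of the free algebra. -/
def freeM (F : Type u) [Field F] (k : ℕ) :
    Matrix (Fin (m + n)) (Fin (m + n)) (FreeAlgebra F (ℕ × Fin (m + n) × Fin (m + n))) :=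
  Matrix.of fun i j => FreeAlgebra.ι F (k, i, j)

/-- The relations of the Hopf envelope, for the matrices of generators `M̄_0, M̄_1, …`:
`M̄_k^{st^k}` and `M̄_{k+1}^{st^k}` are inverse to each other, `M̄_k` satisfies the quadratic
relations (with parameter `q` for even `k`, and `q⁻¹` for odd `k`), and `M̄_{k+2d} = M̄_k`. -/
inductive HopfRel (d : ℕ) :
    FreeAlgebra F (ℕ × Fin (m + n) × Fin (m + n)) →
      FreeAlgebra F (ℕ × Fin (m + n) × Fin (m + n)) → Prop
  | mul_inv (k : ℕ) (i j : Fin (m + n)) :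
      HopfRel d
        (((supertranspose F)^[k] (freeM m n F k) * (supertranspose F)^[k] (freeM m n F (k + 1))) i j)
        ((1 : Matrix (Fin (m + n)) (Fin (m + n)) _) i j)
  | inv_mul (k : ℕ) (i j : Fin (m + n)) :
      HopfRel d
        (((supertranspose F)^[k] (freeM m n F (k + 1)) * (supertranspose F)^[k] (freeM m n F k)) i j)
        ((1 : Matrix (Fin (m + n)) (Fin (m + n)) _) i j)
  | manin (k : ℕ) (a b : FreeAlgebra F (ℕ × Fin (m + n) × Fin (m + n)))
      (h : ManinRel (q ^ ((-1 : ℤ) ^ k)) (freeM m n F k) a b) : HopfRel d a b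
  | period (k : ℕ) (i j : Fin (m + n)) :
      HopfRel d (freeM m n F (k + 2 * d) i j) (freeM m n F k i j)

/-- The generator `(M̄_k)_{ij}` has parity `ī + j̄`. -/
def degM (g : ℕ × Fin (m + n) × Fin (m + n)) : ZMod 2 := pty m n g.2.1 + pty m n g.2.2

theorem freeM_parity (k : ℕ) (i j : Fin (m + n)) :
    freeParity F (degM m n) (freeM m n F k i j) =
      sgn F (pty m n i + pty m n j) • freeM m n F k i j :=
  freeParity_ι F (degM m n) (k, i, j)

theorem st_parity (t : ℕ)
    (X : Matrix (Fin (m + n)) (Fin (m + n)) (FreeAlgebra F (ℕ × Fin (m + n) × Fin (m + n))))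
    (hX : ∀ i j, freeParity F (degM m n) (X i j) = sgn F (pty m n i + pty m n j) • X i j) :
    ∀ i j, freeParity F (degM m n) ((supertranspose F)^[t] X i j) =
      sgn F (pty m n i + pty m n j) • (supertranspose F)^[t] X i j := by
  induction t generalizing X with
  | zero => exact hX
  | succ t ih =>
    rw [Function.iterate_succ_apply]
    refine ih _ fun i j => ?_
    simp only [supertranspose, Matrix.of_apply]
    rw [map_smul, hX, smul_comm, add_comm (pty m n j)]

theorem mul_parity
    (X Y : Matrix (Fin (m + n)) (Fin (m + n)) (FreeAlgebra F (ℕ × Fin (m + n) × Fin (m + n))))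
    (hX : ∀ i j, freeParity F (degM m n) (X i j) = sgn F (pty m n i + pty m n j) • X i j)
    (hY : ∀ i j, freeParity F (degM m n) (Y i j) = sgn F (pty m n i + pty m n j) • Y i j)
    (i j : Fin (m + n)) :
    freeParity F (degM m n) ((X * Y) i j) = sgn F (pty m n i + pty m n j) • (X * Y) i j := by
  rw [Matrix.mul_apply, map_sum, Finset.smul_sum]
  refine Finset.sum_congr rfl fun k _ => ?_
  rw [map_mul, hX, hY, smul_mul_smul_comm, ← sgn_add]
  congr 2
  generalize pty m n i = a
  generalize pty m n j = b
  generalize pty m n k = c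
  revert a b c
  decide

theorem one_parity (i j : Fin (m + n)) :
    freeParity F (degM m n) ((1 : Matrix (Fin (m + n)) (Fin (m + n))
      (FreeAlgebra F (ℕ × Fin (m + n) × Fin (m + n)))) i j) =
      sgn F (pty m n i + pty m n j) • (1 : Matrix (Fin (m + n)) (Fin (m + n)) _) i j := by
  rw [Matrix.one_apply]
  split_ifs with h
  · subst h
    rw [map_one, sgn_add, sgn_sq, one_smul]
  · simp

theorem hopfRel_homogeneous (d : ℕ) : Homogeneous F (degM m n) (HopfRel q m n d) := by
  rintro _ _ (⟨k, i, j⟩ | ⟨k, i, j⟩ | ⟨k, a, b, h⟩ | ⟨k, i, j⟩)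
  · exact ⟨_, mul_parity m n _ _ (st_parity m n k _ (freeM_parity m n k))
      (st_parity m n k _ (freeM_parity m n (k + 1))) i j, one_parity m n i j⟩
  · exact ⟨_, mul_parity m n _ _ (st_parity m n k _ (freeM_parity m n (k + 1)))
      (st_parity m n k _ (freeM_parity m n k)) i j, one_parity m n i j⟩
  · have key : ∀ i j k' l, freeParity F (degM m n) (freeM m n F k i j * freeM m n F k k' l) =
        (sgn F (pty m n i + pty m n j + (pty m n k' + pty m n l))) •
          (freeM m n F k i j * freeM m n F k k' l) := by
      intro i j k' l
      rw [map_mul, freeM_parity, freeM_parity, smul_mul_smul_comm,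
        sgn_add (pty m n i + pty m n j)]
    rcases h with ⟨i, j, hi, hj⟩ | ⟨i, k', l, hi⟩ | ⟨i, j, k', hk⟩ | ⟨i, j, k', l⟩
    · exact ⟨_, key i j i j, by simp⟩
    · refine ⟨pty m n i + pty m n k' + (pty m n i + pty m n l), ?_, by simp⟩
      rw [map_sub, map_smul, key, key, smul_sub, smul_comm,
        add_comm (pty m n i + pty m n l)]
    · refine ⟨pty m n i + pty m n k' + (pty m n j + pty m n k'), ?_, by simp⟩
      rw [map_sub, map_smul, key, key, smul_sub, smul_comm,
        add_comm (pty m n j + pty m n k')]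
    · refine ⟨pty m n i + pty m n j + (pty m n k' + pty m n l), ?_, ?_⟩
      · rw [map_sub, map_smul, key, key, smul_sub, smul_comm,
          add_comm (pty m n k' + pty m n l)]
      · have e1 : pty m n k' + pty m n j + (pty m n i + pty m n l) =
          pty m n i + pty m n j + (pty m n k' + pty m n l) := by ring
        have e2 : pty m n i + pty m n l + (pty m n k' + pty m n j) =
          pty m n i + pty m n j + (pty m n k' + pty m n l) := by ring
        rw [map_sub, map_smul, map_smul, key, key, e1, e2, smul_sub]
        congr 1 <;> rw [smul_comm]
  · exact ⟨_, freeM_parity m n (k + 2 * d) i j, freeM_parity m n k i j⟩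

/-- The Hopf superalgebra `M̃_{m|n}` (as a superalgebra). For `d = 0` the relations
`M̄_{k+2d} = M̄_k` are void and this is the full Hopf envelope; for `d = 1` one has
`M̄_k = M` for even `k` and `M̄_k = M⁻¹` for odd `k`. -/
def Mtilde (d : ℕ) : Type u := RingQuot (HopfRel q m n d)

variable (d : ℕ)

noncomputable instance : Ring (Mtilde q m n d) :=
  inferInstanceAs (Ring (RingQuot (HopfRel q m n d)))
noncomputable instance : Algebra F (Mtilde q m n d) :=
  inferInstanceAs (Algebra F (RingQuot (HopfRel q m n d)))
noncomputable instance : SuperAlgebra F (Mtilde q m n d) :=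
  quotSuper (hopfRel_homogeneous q m n d)

/-- The image of the matrix of generators `M̄_k`. -/
noncomputable def Mbar (k : ℕ) : Matrix (Fin (m + n)) (Fin (m + n)) (Mtilde q m n d) :=
  Matrix.of fun i j => RingQuot.mkAlgHom F (HopfRel q m n d) (freeM m n F k i j)

/-- The generator matrix `M = M̄_0`. -/
noncomputable abbrev genM : Matrix (Fin (m + n)) (Fin (m + n)) (Mtilde q m n d) :=
  Mbar q m n d 0

/-- The inverse `M⁻¹ = M̄_1` of the generator matrix, the image of `M` under the antipode. -/
noncomputable abbrev genMInv : Matrix (Fin (m + n)) (Fin (m + n)) (Mtilde q m n d) :=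
  Mbar q m n d 1

theorem Mbar_mem (k : ℕ) (i j : Fin (m + n)) :
    Mbar q m n d k i j ∈ grading F (Mtilde q m n d) (pty m n i + pty m n j) :=
  quotSuper_mk (hopfRel_homogeneous q m n d) (k, i, j)

theorem Mbar_manin (k : ℕ) {a b : Mtilde q m n d}
    (h : ManinRel (q ^ ((-1 : ℤ) ^ k)) (Mbar q m n d k) a b) : a = b := by
  have key : ∀ {a b}, ManinRel (q ^ ((-1 : ℤ) ^ k)) (freeM m n F k) a b →
      (RingQuot.mkAlgHom F (HopfRel q m n d) a : Mtilde q m n d) =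
        RingQuot.mkAlgHom F (HopfRel q m n d) b :=
    fun h => RingQuot.mkAlgHom_rel F (HopfRel.manin k _ _ h)
  rcases h with ⟨i, j, hi, hj⟩ | ⟨i, k', l, hi⟩ | ⟨i, j, k', hk⟩ | ⟨i, j, k', l⟩
  · have := key (ManinRel.sq i j hi hj)
    simp only [map_mul, map_zero] at this
    exact this
  · have := key (ManinRel.row i k' l hi)
    simp only [map_mul, map_zero, map_sub, map_smul] at this
    exact this
  · have := key (ManinRel.col i j k' hk)
    simp only [map_mul, map_zero, map_sub, map_smul] at this
    exact this
  · have := key (ManinRel.cross i j k' l)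
    simp only [map_mul, map_sub, map_smul] at this
    exact this

end Algebras
/-! ## The coaction -/

section Coaction

variable {F : Type u} [Field F] [CharZero F] (q : Fˣ) (m n d : ℕ)

theorem sum_sum_eq_zero {N : ℕ} {A : Type u} [AddCommGroup A] [Module F A]
    (t : Fin N → Fin N → A) (h : ∀ a b, t a b + t b a = 0) : ∑ a, ∑ b, t a b = 0 := by
  have h2 : (2 : F) • ∑ a, ∑ b, t a b = 0 := by
    have h3 : ∑ a, ∑ b, t a b + ∑ a, ∑ b, t b a = 0 := by
      simp only [← Finset.sum_add_distrib, h, Finset.sum_const_zero]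
    rw [Finset.sum_comm (f := fun a b => t b a)] at h3
    rw [two_smul]
    exact h3
  exact (smul_eq_zero.1 h2).resolve_left two_ne_zero

/-- The map `b ↦ a ⊗ b` into the super tensor product. -/
noncomputable def tmulRight {A B : Type u} [Ring A] [Algebra F A] [SuperAlgebra F A] [Ring B]
    [Algebra F B] [SuperAlgebra F B] (a : A) : B →ₗ[F] STensor F A B :=
  (GradedTensorProduct.of F (grading F A) (grading F B)).toLinearMap ∘ₗ TensorProduct.mk F A B a

theorem tmulRight_smul {A B : Type u} [Ring A] [Algebra F A] [SuperAlgebra F A] [Ring B]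
    [Algebra F B] [SuperAlgebra F B] (c : F) (a : A) (b : B) :
    tmulRight (F := F) (c • a) b = c • tmulRight (F := F) a b := by
  simp only [tmulRight, LinearMap.comp_apply, map_smul, LinearMap.smul_apply]

/-- `φ_i = ∑_j ψ_j ⊗ M_{ji}`. -/
noncomputable def phi (i : Fin (m + n)) : STensor F (QExt q m n) (Mtilde q m n d) :=
  ∑ j, ψ q m n j ᵍ⊗ₜ[F] genM q m n d j i

theorem phi_mul (k l : Fin (m + n)) : phi q m n d k * phi q m n d l =
    ∑ a, ∑ b, sgn F ((pty m n a + pty m n k) * (1 + pty m n b)) •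
      tmulRight (F := F) (ψ q m n a * ψ q m n b) (genM q m n d a k * genM q m n d b l) := by
  rw [phi, phi, Finset.sum_mul]
  refine Finset.sum_congr rfl fun a _ => ?_
  rw [Finset.mul_sum]
  refine Finset.sum_congr rfl fun b _ => ?_
  exact tmul_mul_tmul _ (Mbar_mem q m n d 0 a k) (ψ_mem q m n b) _

theorem phi_comm (k l : Fin (m + n)) : phi q m n d k * phi q m n d l =
    (qe q l k * sgn F ((pty m n k + 1) * (pty m n l + 1))) •
      (phi q m n d l * phi q m n d k) := by
  rw [← sub_eq_zero, phi_mul, phi_mul]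
  simp only [Finset.smul_sum, ← Finset.sum_sub_distrib]
  refine sum_sum_eq_zero (F := F) _ fun a b => ?_
  have h := Mbar_manin q m n d 0 (ManinRel.cross a k b l)
  rw [sub_eq_iff_eq_add] at h
  have h2 : (1 : ZMod 2) + 1 = 0 := by decide
  rw [ψ_comm q m n b a, h]
  simp only [tmulRight_smul, map_add, map_sub, map_smul, pow_zero, zpow_one]
  generalize tmulRight (F := F) (B := Mtilde q m n d) (ψ q m n a * ψ q m n b) = f
  rcases zmod2_cases (pty m n a) with ha | ha <;> rcases zmod2_cases (pty m n b) with hb | hb <;>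
  rcases zmod2_cases (pty m n k) with hk | hk <;> rcases zmod2_cases (pty m n l) with hl | hl <;>
  simp only [ha, hb, hk, hl, h2, mul_zero, mul_one, add_zero, zero_add, sgn_zero,
    sgn_one] <;> module

/-- `∑_k x_k ⊗ ι((M^{st})_{ki}) = ∑_k (-1)^{k̄(k̄+ī)} x_k ⊗ (M⁻¹)_{ik}`. -/
noncomputable def upsilon (i : Fin (m + n)) : STensor F (QSym q m n) (SuperOp F (Mtilde q m n d)) :=
  ∑ k, x q m n k ᵍ⊗ₜ[F] toOp F _ (supertranspose F (genMInv q m n d) k i)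

theorem st_mem (k i : Fin (m + n)) : supertranspose F (genMInv q m n d) k i ∈
    grading F (Mtilde q m n d) (pty m n i + pty m n k) :=
  Submodule.smul_mem _ _ (Mbar_mem q m n d 1 i k)

theorem upsilon_mul (j i : Fin (m + n)) : upsilon q m n d j * upsilon q m n d i =
    ∑ a, ∑ b, (sgn F ((pty m n j + pty m n a) * pty m n b) *
        sgn F ((pty m n j + pty m n a) * (pty m n i + pty m n b)) *
        sgn F (pty m n a * (pty m n a + pty m n j)) *
        sgn F (pty m n b * (pty m n b + pty m n i))) •
      tmulRight (F := F) (x q m n a * x q m n b)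
        (toOp F _ (genMInv q m n d i b * genMInv q m n d j a)) := by
  rw [upsilon, upsilon, Finset.sum_mul]
  refine Finset.sum_congr rfl fun a _ => ?_
  rw [Finset.mul_sum]
  refine Finset.sum_congr rfl fun b _ => ?_
  refine (tmul_mul_tmul _ (toOp_mem (st_mem q m n d a j)) (x_mem q m n b) _).trans ?_
  rw [toOp_mul (st_mem q m n d a j) (st_mem q m n d b i)]
  change _ • tmulRight (F := F) (x q m n a * x q m n b) _ = _
  simp only [supertranspose, Matrix.of_apply, smul_mul_smul_comm, map_smul, smul_smul]
  congr 1
  ring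

theorem upsilon_comm (i j : Fin (m + n)) : upsilon q m n d j * upsilon q m n d i =
    (qe q j i * sgn F (pty m n i * pty m n j)) •
      (upsilon q m n d i * upsilon q m n d j) := by
  rw [← sub_eq_zero, upsilon_mul, upsilon_mul]
  simp only [Finset.smul_sum, ← Finset.sum_sub_distrib]
  refine sum_sum_eq_zero (F := F) _ fun a b => ?_
  have h := Mbar_manin q m n d 1 (ManinRel.cross i b j a)
  rw [sub_eq_iff_eq_add] at h
  have h2 : (1 : ZMod 2) + 1 = 0 := by decide
  rw [x_comm q m n a b, h]
  simp only [tmulRight_smul, map_add, map_sub, map_smul, pow_one, zpow_neg, zpow_one, qe_inv_unit]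
  generalize tmulRight (F := F) (B := SuperOp F (Mtilde q m n d)) (x q m n a * x q m n b) = f
  rcases zmod2_cases (pty m n a) with ha | ha <;> rcases zmod2_cases (pty m n b) with hb | hb <;>
  rcases zmod2_cases (pty m n i) with hk | hk <;> rcases zmod2_cases (pty m n j) with hl | hl <;>
  simp only [ha, hb, hk, hl, h2, mul_zero, mul_one, add_zero, zero_add, sgn_zero,
    sgn_one] <;> module

theorem phi_sq {i : Fin (m + n)} (hi : pty m n i = 0) : phi q m n d i * phi q m n d i = 0 := by
  have h := phi_comm q m n d i i
  rw [hi, zero_add, one_mul, sgn_one, qe_self, one_mul, neg_one_smul] at h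
  have h2 : (2 : F) • (phi q m n d i * phi q m n d i) = 0 := by
    rw [two_smul]
    nth_rewrite 1 [h]
    exact neg_add_cancel _
  exact (smul_eq_zero.1 h2).resolve_left two_ne_zero

theorem upsilon_sq {i : Fin (m + n)} (hi : pty m n i = 1) :
    upsilon q m n d i * upsilon q m n d i = 0 := by
  have h := upsilon_comm q m n d i i
  rw [hi, one_mul, sgn_one, qe_self, one_mul, neg_one_smul] at h
  have h2 : (2 : F) • (upsilon q m n d i * upsilon q m n d i) = 0 := by
    rw [two_smul]
    nth_rewrite 1 [h]
    exact neg_add_cancel _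
  exact (smul_eq_zero.1 h2).resolve_left two_ne_zero

/-- The coaction on the quantum exterior superalgebra: the homomorphism of superalgebras
`Λ^q(V*) → Λ^q(V*) ⊗ M̃` with `ψ_i ↦ ∑_j ψ_j ⊗ M_{ji}`. -/
noncomputable def deltaExt : QExt q m n →ₐ[F] STensor F (QExt q m n) (Mtilde q m n d) :=
  RingQuot.liftAlgHom F ⟨FreeAlgebra.lift F (phi q m n d), by
    rintro _ _ (⟨i, hi⟩ | ⟨k, l⟩)
    · rw [map_mul, FreeAlgebra.lift_ι_apply, map_zero, phi_sq q m n d hi]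
    · rw [map_smul, map_mul, map_mul, FreeAlgebra.lift_ι_apply, FreeAlgebra.lift_ι_apply,
        phi_comm]⟩

/-- The coaction on the quantum symmetric superalgebra, `x_i ↦ ∑_k x_k ⊗ ι((M^{st})_{ki})`,
extended by the opposite algebra structure of `S^q(V)`, that is, as a homomorphism
`S^q(V)ᵒᵖ → S^q(V)ᵒᵖ ⊗ M̃`. On the underlying spaces this is the same as a homomorphism
`S^q(V) → S^q(V) ⊗ M̃ᵒᵖ`, where `ᵒᵖ` denotes the opposite superalgebra. -/
noncomputable def deltaSym :
    QSym q m n →ₐ[F] STensor F (QSym q m n) (SuperOp F (Mtilde q m n d)) :=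
  RingQuot.liftAlgHom F ⟨FreeAlgebra.lift F (upsilon q m n d), by
    rintro _ _ (⟨i, hi⟩ | ⟨i, j⟩)
    · rw [map_mul, FreeAlgebra.lift_ι_apply, map_zero, upsilon_sq q m n d hi]
    · rw [map_smul, map_mul, map_mul, FreeAlgebra.lift_ι_apply, FreeAlgebra.lift_ι_apply,
        upsilon_comm]⟩

theorem deltaExt_ψ (i : Fin (m + n)) : deltaExt q m n d (ψ q m n i) = phi q m n d i := by
  refine (RingQuot.liftAlgHom_mkAlgHom_apply F _ _ _).trans ?_
  rw [FreeAlgebra.lift_ι_apply]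

theorem deltaSym_x (i : Fin (m + n)) : deltaSym q m n d (x q m n i) = upsilon q m n d i := by
  refine (RingQuot.liftAlgHom_mkAlgHom_apply F _ _ _).trans ?_
  rw [FreeAlgebra.lift_ι_apply]

section Merge

variable (F) (A B C : Type u) [Ring A] [Algebra F A] [Ring B] [Algebra F B] [SuperAlgebra F B]
  [Ring C] [Algebra F C] [SuperAlgebra F C]

/-- The super flip `c ⊗ b ↦ (-1)^{|b||c|} b ⊗ c`. -/
noncomputable def superFlip : C ⊗[F] B →ₗ[F] B ⊗[F] C :=
  (TensorProduct.map LinearMap.id (evenPart F) +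
    TensorProduct.map (par F : B →ₐ[F] B).toLinearMap (oddPart F)) ∘ₗ
      (TensorProduct.comm F C B).toLinearMap

/-- The map `(a ⊗ c) ⊗ (b ⊗ c') ↦ (-1)^{|c||b|} (a ⊗ b) ⊗ c c'`. -/
noncomputable def merge : (A ⊗[F] C) ⊗[F] (B ⊗[F] C) →ₗ[F] (A ⊗[F] B) ⊗[F] C :=
  (TensorProduct.assoc F A B C).symm.toLinearMap ∘ₗ
    LinearMap.lTensor A
      (LinearMap.lTensor B (LinearMap.mul' F C) ∘ₗ
        (TensorProduct.assoc F B C C).toLinearMap ∘ₗ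
        LinearMap.rTensor C (superFlip F B C) ∘ₗ
        (TensorProduct.assoc F C B C).symm.toLinearMap) ∘ₗ
    (TensorProduct.assoc F A C (B ⊗[F] C)).toLinearMap

variable {F A B C}

theorem merge_tmul {y z : ZMod 2} (a : A) {c : C} (hc : c ∈ grading F C y) {b : B}
    (hb : b ∈ grading F B z) (c' : C) :
    merge F A B C ((a ⊗ₜ c) ⊗ₜ (b ⊗ₜ c')) = sgn F (y * z) • ((a ⊗ₜ b) ⊗ₜ (c * c')) := by
  have h : superFlip F B C (c ⊗ₜ b) = sgn F (y * z) • (b ⊗ₜ c) := by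
    simp only [superFlip, LinearMap.comp_apply, LinearEquiv.coe_coe, TensorProduct.comm_tmul,
      LinearMap.add_apply, TensorProduct.map_tmul, LinearMap.id_apply, AlgHom.toLinearMap_apply]
    rcases zmod2_cases y with rfl | rfl
    · rw [even_of_mem_zero hc, odd_of_mem_zero hc, TensorProduct.tmul_zero, add_zero, zero_mul,
        sgn_zero, one_smul]
    · rw [even_of_mem_one hc, odd_of_mem_one hc, TensorProduct.tmul_zero, zero_add, one_mul,
        mem_grading.1 hb, TensorProduct.smul_tmul']
  simp only [merge, LinearMap.comp_apply, LinearEquiv.coe_coe, TensorProduct.assoc_tmul,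
    LinearMap.lTensor_tmul, TensorProduct.assoc_symm_tmul, LinearMap.rTensor_tmul, h,
    TensorProduct.smul_tmul', TensorProduct.tmul_smul, LinearMap.mul'_apply]

end Merge

/-! ## The quantum Berezinian -/

/-- The superalgebra `K_{m|n} = Λ^q(V*) ⊗ S^q(V)`. -/
abbrev KAlg : Type u := STensor F (QExt q m n) (QSym q m n)

/-- The element `c = ∑_i ψ_i ⊗ x_i`. -/
noncomputable def cElt : KAlg q m n := ∑ i, ψ q m n i ᵍ⊗ₜ[F] x q m n i

/-- The differential `k ↦ k c` on `K_{m|n}`. -/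
noncomputable def diff : KAlg q m n →ₗ[F] KAlg q m n := LinearMap.mulRight F (cElt q m n)

/-- The coaction `K → K ⊗ M̃`, `ω s ↦ δ(ω) δ(s)` for `ω ∈ Λ^q(V*)`, `s ∈ S^q(V)`; the product
of `ω' ⊗ a` and `s' ⊗ b` is `(-1)^{|a||s'|} ω' s' ⊗ a b`. -/
noncomputable def deltaK : KAlg q m n →ₗ[F] KAlg q m n ⊗[F] Mtilde q m n d :=
  LinearMap.rTensor (Mtilde q m n d)
      (GradedTensorProduct.of F (grading F (QExt q m n)) (grading F (QSym q m n))).toLinearMap ∘ₗ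
    merge F (QExt q m n) (QSym q m n) (Mtilde q m n d) ∘ₗ
    TensorProduct.map
      ((GradedTensorProduct.of F (grading F (QExt q m n))
          (grading F (Mtilde q m n d))).symm.toLinearMap ∘ₗ
        (deltaExt q m n d).toLinearMap)
      (LinearMap.lTensor (QSym q m n) (toOp F (Mtilde q m n d)).symm.toLinearMap ∘ₗ
        (GradedTensorProduct.of F (grading F (QSym q m n))
          (grading F (SuperOp F (Mtilde q m n d)))).symm.toLinearMap ∘ₗ
        (deltaSym q m n d).toLinearMap) ∘ₗ
    (GradedTensorProduct.of F (grading F (QExt q m n)) (grading F (QSym q m n))).symm.toLinearMap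

/-- The cocycle `ψ_1 ⋯ ψ_m x_{m+n} ⋯ x_{m+1}`, whose class spans the cohomology of `K_{m|n}`. -/
noncomputable def top : KAlg q m n :=
  (List.ofFn fun i : Fin m => ψ q m n (Fin.castAdd n i)).prod ᵍ⊗ₜ[F]
    (List.ofFn fun j : Fin n => x q m n (Fin.natAdd m j)).reverse.prod

/-- `b` is the quantum Berezinian of the generator matrix `M`: the element
`ψ_1 ⋯ ψ_m x_{m+n} ⋯ x_{m+1}` is a cocycle, and the coaction on the cohomology
`H = Ker d / Im d` multiplies its class by `b`, that is, `δ[top] = [top] ⊗ b`. The equation is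
written in `(K / Im d) ⊗ M̃`, of which `H ⊗ M̃` is a subspace. -/
def IsQuantumBerezinian (b : Mtilde q m n d) : Prop :=
  diff q m n (top q m n) = 0 ∧
  LinearMap.rTensor (Mtilde q m n d) (LinearMap.range (diff q m n)).mkQ
      (deltaK q m n d (top q m n)) =
    (LinearMap.range (diff q m n)).mkQ (top q m n) ⊗ₜ[F] b

end Coaction

/-! ## Quasideterminants -/

section Quasi

variable {A : Type v} [Ring A]

/-- The quasideterminant `|X|_{ij} = x_{ij} - r_i^j (X^{ij})⁻¹ c_j^i` of a square matrix over a
(noncommutative) ring. It is meaningful when `X^{ij}`, the matrix `X` without row `i` and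
column `j`, is invertible. -/
noncomputable def quasidet {N : ℕ} (X : Matrix (Fin (N + 1)) (Fin (N + 1)) A)
    (i j : Fin (N + 1)) : A :=
  X i j - ∑ k, ∑ l, X i (j.succAbove k) *
    (Ring.inverse (X.submatrix i.succAbove j.succAbove)) k l * X (i.succAbove l) j

/-- The leading principal `k × k` submatrix `X^{(k)}`. -/
def leading {N : ℕ} (X : Matrix (Fin N) (Fin N) A) (k : ℕ) (hk : k ≤ N) :
    Matrix (Fin k) (Fin k) A :=
  X.submatrix (Fin.castLE hk) (Fin.castLE hk)

/-- `|X^{(k)}|_{kk}`, where `k` is one more than the zero-based index `i`. -/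
noncomputable def leadingQuasidet {N : ℕ} (X : Matrix (Fin N) (Fin N) A) (i : Fin N) : A :=
  quasidet (leading X (i.val + 1) i.isLt) (Fin.last i.val) (Fin.last i.val)

end Quasi

end QBer

/-! The element c is a sum of elements ψ_i ⊗ x_i that anticommute. On ordered monomials the i-th one
raises the exponents of ψ_i and of x_i together, up to a nonzero scalar. For an even index ψ_i² = 0,
so the exponent pairs (0, b) and (1, b + 1) cancel and only (1, 0) is left; for an odd index x_i² =
0 and only (0, 1) is left. Hence K contracts onto the line of the top monomial
(`exists_monomial_basis`, `exists_shift_homotopy`, `exists_contraction`), and the projection to this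
line is given by a functional T ⊗ T' that vanishes on Im d.

The opposite algebra in the definition of δ makes the entries of M and M⁻¹ meet: in δ(ωs·c) the
coefficient contains M_{ji} (M⁻¹)_{ik} with the two entries adjacent, and the sum over i leaves only
j = k. So δ intertwines d with d ⊗ parity (`sum_mergeK_mul`), the image of the top monomial is a
cocycle, and the contraction shows that its class is [top] ⊗ b for exactly one b, the value of T ⊗
T' ⊗ 1 on it (`isQuantumBerezinian_iff`).

This b is a product of a coefficient of δ(ψ_1 ⋯ ψ_m) and a coefficient of δ(x_{m+n} ⋯ x_{m+1}). As T
ignores odd ψ's and T' ignores even x's, only the even-even block of M and the odd-odd block of M⁻¹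
enter. Their entries are even, so the signs disappear and one computes in ordinary tensor products.
There a product of square-zero vectors that commute up to scalars does not change under
unitriangular operations, and for a triangular matrix it is the product of the diagonal
(`prod_columns_eq`, `prod_rows_eq`).

Column elimination in the even block of M gives the first m quasideterminants. For the odd block,
let L have as rows the last rows of the inverses of the leading submatrices. Then LM is upper
unitriangular, and L = (LM)M⁻¹ is lower triangular with the inverse quasideterminants on its
diagonal; this identity restricts to the odd blocks. -/

namespace QBer

universe u

/-! ## Koszul homotopies -/

section Homotopy

variable {E ι : Type*} [Ring E]

/-- Anticommuting square-zero elements `d i` with contractions `h i`: the sum of the `d i` is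
contracted up to the product of the harmonic projections `1 - d i * h i - h i * d i`. -/
theorem exists_homotopy (d h : ι → E) (hd2 : ∀ i, d i * d i = 0)
    (hdd : ∀ i j, i ≠ j → d i * d j = -(d j * d i))
    (hdh : ∀ i j, i ≠ j → d i * h j = -(h j * d i))
    (hdhd : ∀ i, d i * h i * d i = d i) (l : List ι) (hl : l.Nodup) :
    ∃ H, (l.map d).sum * H + H * (l.map d).sum =
        1 - (l.map fun i => 1 - d i * h i - h i * d i).prod ∧
      ∀ j ∉ l, d j * H = -(H * d j) := by
  -- Both factors of `d i * h i` anticommute with `d j`, so the two signs cancel.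
  have hP : ∀ i j, i ≠ j → d j * (1 - d i * h i - h i * d i) =
      (1 - d i * h i - h i * d i) * d j := by
    intro i j hij
    have e1 : d j * (d i * h i) = d i * h i * d j := by
      rw [← mul_assoc, hdd j i hij.symm, neg_mul, mul_assoc, hdh j i hij.symm, mul_neg, neg_neg,
        mul_assoc]
    have e2 : d j * (h i * d i) = h i * d i * d j := by
      rw [← mul_assoc, hdh j i hij.symm, neg_mul, mul_assoc, hdd j i hij.symm, mul_neg, neg_neg,
        mul_assoc]
    rw [mul_sub, mul_sub, e1, e2, sub_mul, sub_mul, mul_one, one_mul]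
  induction l with
  | nil => exact ⟨0, by simp, by simp⟩
  | cons i l ih =>
    obtain ⟨hi, hl⟩ := List.nodup_cons.1 hl
    obtain ⟨H, hH, hH'⟩ := ih hl
    set P := 1 - d i * h i - h i * d i with hPdef
    set D := (l.map d).sum with hD
    have hDP : D * P = P * D := by
      have : Commute D P := by
        refine Commute.list_sum_left _ _ fun b hb => ?_
        obtain ⟨j, hj, rfl⟩ := List.mem_map.1 hb
        exact hP i j (by rintro rfl; exact hi hj)
      exact this
    have hDh : D * h i = -(h i * D) := by
      have key : ∀ l' : List ι, i ∉ l' → (l'.map d).sum * h i = -(h i * (l'.map d).sum) := by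
        intro l' hl'
        induction l' with
        | nil => simp
        | cons j l' ih =>
          rw [List.mem_cons, not_or] at hl'
          rw [List.map_cons, List.sum_cons, add_mul, ih hl'.2, hdh j i (Ne.symm hl'.1), mul_add,
            neg_add]
      exact key l hi
    have hPd : P * d i = 0 := by
      rw [hPdef, sub_mul, sub_mul, one_mul, hdhd, mul_assoc (h i), hd2, mul_zero, sub_self,
        sub_zero]
    have hdP : d i * P = 0 := by
      rw [hPdef, mul_sub, mul_sub, mul_one, ← mul_assoc, hd2, zero_mul, ← mul_assoc, hdhd,
        sub_zero, sub_self]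
    -- `h i` contracts `d i` up to `P`, and `P * H` contracts the remaining sum on the image of `P`.
    -- The cross terms vanish because `P` commutes with `D` and is annihilated by `d i` on both
    -- sides; the second clause of the induction hypothesis moves `d i` past `H` to reach `P`.
    refine ⟨h i + P * H, ?_, fun j hj => ?_⟩
    · rw [List.map_cons, List.sum_cons, List.map_cons, List.prod_cons, ← hD, ← hPdef]
      have e1 : D * (P * H) = P * (D * H) := by rw [← mul_assoc, hDP, mul_assoc]
      have e2 : d i * (P * H) = 0 := by rw [← mul_assoc, hdP, zero_mul]
      have e3 : P * H * d i = 0 := by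
        rw [mul_assoc, ← neg_eq_iff_eq_neg.2 (hH' i hi), mul_neg, ← mul_assoc, hPd, zero_mul,
          neg_zero]
      have e4 : P * (D * H) + P * (H * D) =
          P - P * (l.map fun i => 1 - d i * h i - h i * d i).prod := by
        rw [← mul_add, hH, mul_sub, mul_one]
      have e5 : d i * h i + h i * d i = 1 - P := by rw [hPdef]; abel
      calc (d i + D) * (h i + P * H) + (h i + P * H) * (d i + D)
          = (d i * h i + h i * d i) + (D * h i + h i * D) + d i * (P * H) + P * H * d i +
            (D * (P * H) + P * (H * D)) := by noncomm_ring
        _ = _ := by rw [e5, hDh, e2, e3, e1, e4]; abel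
    · rw [List.mem_cons, not_or] at hj
      rw [mul_add, hdh j i hj.1, ← mul_assoc, hP i j (Ne.symm hj.1), mul_assoc, hH' j hj.2,
        add_mul, neg_add, mul_neg, mul_assoc]

end Homotopy

/-! ### Contraction of a complex spanned by partial shifts -/

section Shift

variable {F : Type*} [Field F] {K S ι : Type*} [AddCommGroup K] [Module F K]

/-- Anticommuting operators that act on a basis by injective partial shifts `r i`, up to nonzero
scalars, are contracted, up to the projection to the basis vectors to which none of the shifts
leads and which none of them moves. -/
theorem exists_shift_homotopy [Fintype ι] [DecidableEq ι] (B : Module.Basis S F K)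
    (d : ι → Module.End F K)
    (r : ι → S → S → Prop) (w : ι → S → F) (hw : ∀ i s, w i s ≠ 0)
    (hr : ∀ i s t, r i s t → d i (B s) = w i s • B t)
    (hr' : ∀ i s, (¬ ∃ t, r i s t) → d i (B s) = 0)
    (hinj : ∀ i s s' t, r i s t → r i s' t → s = s')
    (hdd : ∀ i j, d i * d j = -(d j * d i))
    (hd2 : ∀ i s t t', r i s t → ¬ r i t t')
    (hsrc : ∀ i j s s', i ≠ j → r j s s' → ((∃ t, r i s t) ↔ ∃ t, r i s' t))
    (htgt : ∀ i j s s', i ≠ j → r j s s' → ((∃ t, r i t s) ↔ ∃ t, r i t s')) :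
    ∃ H Q : Module.End F K, (∑ i, d i) * H + H * (∑ i, d i) = 1 - Q ∧
      ∀ s, ((∀ i, (¬ ∃ t, r i s t) ∧ ¬ ∃ t, r i t s) → Q (B s) = B s) ∧
        ((∃ i, (∃ t, r i s t) ∨ ∃ t, r i t s) → Q (B s) = 0) := by
  classical
  -- The partial inverse of the i-th shift, with the inverse weight, and zero off the image of the
  -- shift.
  let h : ι → Module.End F K := fun i => B.constr F fun t =>
    if ht : ∃ s, r i s t then (w i ht.choose)⁻¹ • B ht.choose else 0
  have hh : ∀ i s t, r i s t → h i (B t) = (w i s)⁻¹ • B s := by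
    intro i s t hst
    have ht : ∃ s, r i s t := ⟨s, hst⟩
    have : ht.choose = s := hinj i _ _ t ht.choose_spec hst
    simp only [h, Module.Basis.constr_basis, dif_pos ht]
    rw [this]
  have hh' : ∀ i t, (¬ ∃ s, r i s t) → h i (B t) = 0 := by
    intro i t ht
    simp only [h, Module.Basis.constr_basis, dif_neg ht]
  have hhd : ∀ i s t, r i s t → h i (d i (B s)) = B s := by
    intro i s t hst
    rw [hr i s t hst, map_smul, hh i s t hst, smul_smul, mul_inv_cancel₀ (hw i s), one_smul]
  have hdh' : ∀ i s t, r i s t → d i (h i (B t)) = B t := by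
    intro i s t hst
    rw [hh i s t hst, map_smul, hr i s t hst, smul_smul, inv_mul_cancel₀ (hw i s), one_smul]
  have d2 : ∀ i, d i * d i = 0 := by
    intro i
    refine B.ext fun s => ?_
    by_cases hs : ∃ t, r i s t
    · obtain ⟨t, ht⟩ := hs
      rw [Module.End.mul_apply, hr i s t ht, map_smul,
        hr' i t (fun ⟨t', ht'⟩ => hd2 i s t t' ht ht'), smul_zero, LinearMap.zero_apply]
    · rw [Module.End.mul_apply, hr' i s hs, map_zero, LinearMap.zero_apply]
  have dh : ∀ j i, j ≠ i → d j * h i = -(h i * d j) := by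
    intro j i hji
    refine B.ext fun t => ?_
    rw [LinearMap.neg_apply, Module.End.mul_apply, Module.End.mul_apply]
    by_cases ht : ∃ s, r i s t
    · obtain ⟨s, hst⟩ := ht
      -- On the image of `d i` the claim becomes `h i (d i v) = v` for `v = d j (B s)`; by `hsrc`
      -- the j-th shift does not leave the source of the i-th one.
      have e1 : B t = (w i s)⁻¹ • d i (B s) := by
        rw [hr i s t hst, smul_smul, inv_mul_cancel₀ (hw i s), one_smul]
      rw [hh i s t hst, e1, map_smul, map_smul, map_smul, ← smul_neg]
      congr 1
      have e2 : d j (d i (B s)) = - d i (d j (B s)) := LinearMap.congr_fun (hdd j i) (B s)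
      rw [e2, map_neg, neg_neg]
      by_cases hs : ∃ s', r j s s'
      · obtain ⟨s', hs'⟩ := hs
        obtain ⟨t', ht'⟩ := (hsrc i j s s' hji.symm hs').1 ⟨t, hst⟩
        rw [hr j s s' hs', map_smul, map_smul, hhd i s' t' ht']
      · rw [hr' j s hs, map_zero, map_zero]
    · rw [hh' i t ht, map_zero]
      -- Off the image of the i-th shift both sides vanish: by `htgt` the j-th shift cannot lead
      -- into that image.
      by_cases hs : ∃ s', r j t s'
      · obtain ⟨s', hs'⟩ := hs
        rw [hr j t s' hs', map_smul, hh' i s' (fun hc => ht ((htgt i j t s' hji.symm hs').2 hc)),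
          smul_zero, neg_zero]
      · rw [hr' j t hs, map_zero, neg_zero]
  have dhd : ∀ i, d i * h i * d i = d i := by
    intro i
    refine B.ext fun s => ?_
    rw [Module.End.mul_apply, Module.End.mul_apply]
    by_cases hs : ∃ t, r i s t
    · obtain ⟨t, ht⟩ := hs
      rw [hhd i s t ht]
    · rw [hr' i s hs, map_zero, map_zero]
  obtain ⟨H, hH, -⟩ := exists_homotopy d h d2 (fun i j _ => hdd i j) dh dhd
    (Finset.univ.toList) (Finset.nodup_toList _)
  rw [Finset.sum_map_toList] at hH
  refine ⟨H, _, hH, fun s => ⟨fun hs => ?_, ?_⟩⟩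
  · have key : ∀ l : List ι, (l.map fun i => 1 - d i * h i - h i * d i).prod (B s) = B s := by
      intro l
      induction l with
      | nil => simp
      | cons i l ih =>
        rw [List.map_cons, List.prod_cons, Module.End.mul_apply, ih, LinearMap.sub_apply,
          LinearMap.sub_apply, Module.End.mul_apply, Module.End.mul_apply, hr' i s (hs i).1,
          hh' i s (hs i).2]
        simp
    exact key _
  · rintro ⟨i, hi⟩
    -- Every factor multiplies `B s` by 0 or 1, and the factor of `i` multiplies it by 0.
    have key : ∀ l : List ι, ∃ c : F,
        (l.map fun i => 1 - d i * h i - h i * d i).prod (B s) = c • B s ∧ (i ∈ l → c = 0) := by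
      intro l
      induction l with
      | nil => exact ⟨1, by simp⟩
      | cons j l ih =>
        obtain ⟨c, hc, hc'⟩ := ih
        have hj : ∃ c' : F, (1 - d j * h j - h j * d j) (B s) = c' • B s ∧ (i = j → c' = 0) := by
          rw [LinearMap.sub_apply, LinearMap.sub_apply, Module.End.mul_apply, Module.End.mul_apply]
          by_cases h1 : ∃ t, r j s t
          · obtain ⟨t, ht⟩ := h1
            refine ⟨0, ?_, fun _ => rfl⟩
            rw [hhd j s t ht, hh' j s (fun ⟨t', ht'⟩ => hd2 j t' s t ht' ht)]
            simp
          · by_cases h2 : ∃ t, r j t s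
            · obtain ⟨t, ht⟩ := h2
              refine ⟨0, ?_, fun _ => rfl⟩
              rw [hdh' j t s ht, hr' j s h1]
              simp
            · refine ⟨1, ?_, ?_⟩
              · rw [hr' j s h1, hh' j s h2]
                simp
              · rintro rfl
                exact absurd hi (not_or.2 ⟨h1, h2⟩)
        obtain ⟨c', e1, e2⟩ := hj
        refine ⟨c * c', ?_, ?_⟩
        · rw [List.map_cons, List.prod_cons, Module.End.mul_apply, hc, map_smul, e1, smul_smul]
        · intro hm
          rcases List.mem_cons.1 hm with hm | hm
          · rw [e2 hm, mul_zero]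
          · rw [hc' hm, zero_mul]
    obtain ⟨c, hc, hc'⟩ := key Finset.univ.toList
    rw [hc, hc' (Finset.mem_toList.2 (Finset.mem_univ i)), zero_smul]

end Shift

/-! ## Monomial bases of algebras with generators that commute up to scalars -/

section Color

variable {F : Type u} [Field F] {N : ℕ}

/-- The exponents of the nonzero monomials in `N` generators, those in `P` of square zero. -/
def Exponent (P : Fin N → Prop) : Type := {e : Fin N → ℕ // ∀ i, P i → e i ≤ 1}

/-- The scalar arising when a generator is moved into its place in a monomial. -/
def swapCoeff (β : Fin N → Fin N → F) (e : Fin N → ℕ) (i : Fin N) : F :=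
  ∏ j, if i < j then β j i ^ e j else 1

theorem swapCoeff_add (β : Fin N → Fin N → F) (e : Fin N → ℕ) (i j : Fin N) :
    swapCoeff β (e + Pi.single j 1) i = swapCoeff β e i * if i < j then β j i else 1 := by
  classical
  have : (if i < j then β j i else 1) = ∏ k, if k = j then (if i < j then β j i else 1) else 1 := by
    rw [Finset.prod_ite_eq' Finset.univ j (fun _ => if i < j then β j i else 1)]
    simp
  rw [this, swapCoeff, swapCoeff, ← Finset.prod_mul_distrib]
  refine Finset.prod_congr rfl fun k _ => ?_
  by_cases hk : k = j
  · subst hk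
    by_cases hi : i < k
    · simp [hi, pow_succ]
    · simp [hi]
  · simp [hk]

theorem swapCoeff_ne_zero {β : Fin N → Fin N → F} (hβ : ∀ i j, β i j * β j i = 1)
    (e : Fin N → ℕ) (i : Fin N) : swapCoeff β e i ≠ 0 := by
  refine Finset.prod_ne_zero_iff.2 fun j _ => ?_
  split_ifs
  · exact pow_ne_zero _ (left_ne_zero_of_mul_eq_one (hβ j i))
  · exact one_ne_zero

/-- The ordered monomial with given exponents. -/
def monomial {W : Type*} [Monoid W] (y : Fin N → W) (e : Fin N → ℕ) : W :=
  ((List.finRange N).map fun j => y j ^ e j).prod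

/-- On the way to its place `y i` passes precisely the powers of the `y j` with `i < j`; `swapCoeff`
collects the scalars. -/
theorem monomial_mul {W : Type*} [Ring W] [Algebra F W] (β : Fin N → Fin N → F) (y : Fin N → W)
    (hcomm : ∀ i j, y j * y i = β j i • (y i * y j)) (e : Fin N → ℕ) (i : Fin N) :
    monomial y e * y i = swapCoeff β e i • monomial y (e + Pi.single i 1) := by
  classical
  have hpow : ∀ j (k : ℕ), y j ^ k * y i = β j i ^ k • (y i * y j ^ k) := by
    intro j k
    induction k with
    | zero => simp
    | succ k ih =>
      rw [pow_succ, mul_assoc, hcomm, mul_smul_comm, ← mul_assoc, ih, smul_mul_assoc, smul_smul,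
        mul_assoc, ← pow_succ']
  have hlist : ∀ l : List (Fin N), (l.map fun j => y j ^ e j).prod * y i =
      (l.map fun j => β j i ^ e j).prod • (y i * (l.map fun j => y j ^ e j).prod) := by
    intro l
    induction l with
    | nil => simp
    | cons j l ih =>
      simp only [List.map_cons, List.prod_cons]
      rw [mul_assoc, ih, mul_smul_comm, ← mul_assoc, hpow, smul_mul_assoc, smul_smul, mul_assoc,
        mul_comm]
  obtain ⟨l₀, l₁, hl⟩ := List.append_of_mem (List.mem_finRange i)
  have hs : (l₀ ++ i :: l₁).Pairwise (· < ·) := hl ▸ List.pairwise_lt_finRange N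
  rw [List.pairwise_append, List.pairwise_cons] at hs
  obtain ⟨-, ⟨h1, -⟩, h0⟩ := hs
  set e' : Fin N → ℕ := e + Pi.single i 1 with he'
  have ei : e' i = e i + 1 := by simp [he']
  have e0 : ∀ j ∈ l₀, e' j = e j := fun j hj => by
    simp [he', (h0 j hj i (List.mem_cons_self ..)).ne]
  have e1 : ∀ j ∈ l₁, e' j = e j := fun j hj => by
    simp [he', (h1 j hj).ne']
  have hc : swapCoeff β e i = (l₁.map fun j => β j i ^ e j).prod := by
    rw [swapCoeff, Fin.prod_univ_def, hl, List.map_append, List.prod_append, List.map_cons, List.prod_cons]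
    rw [List.prod_eq_one (l := l₀.map _), List.map_congr_left (g := fun j => β j i ^ e j)]
    · simp
    · intro j hj
      simp [h1 j hj]
    · intro a ha
      obtain ⟨j, hj, rfl⟩ := List.mem_map.1 ha
      simp [(h0 j hj i (List.mem_cons_self ..)).le]
  rw [hc, monomial, monomial, hl, List.map_append, List.map_append, List.prod_append,
    List.prod_append, List.map_cons, List.map_cons, List.prod_cons, List.prod_cons,
    ei, List.map_congr_left (fun j hj => by rw [e0 j hj] : ∀ j ∈ l₀, y j ^ e' j = y j ^ e j),
    List.map_congr_left (fun j hj => by rw [e1 j hj] : ∀ j ∈ l₁, y j ^ e' j = y j ^ e j),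
    mul_assoc, mul_assoc, hlist, mul_smul_comm, mul_smul_comm]
  congr 2
  rw [← mul_assoc, ← pow_succ]

/-- Up to an invertible scalar the monomial already ends in `y i`, so one more factor produces the
square of `y i`. -/
theorem monomial_single {W : Type*} [Ring W] [Algebra F W] {β : Fin N → Fin N → F}
    (hβ : ∀ i j, β i j * β j i = 1) {y : Fin N → W}
    (hcomm : ∀ i j, y j * y i = β j i • (y i * y j)) {e : Fin N → ℕ} {i : Fin N}
    (hsq : y i * y i = 0) (he : e i ≠ 0) : monomial y e * y i = 0 := by
  have h : e = (e - Pi.single i 1) + Pi.single i 1 := by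
    funext j
    by_cases hj : j = i
    · subst hj
      simp
      omega
    · simp [hj]
  have h1 := monomial_mul β y hcomm (e - Pi.single i 1) i
  rw [← h] at h1
  have h2 : monomial y e = (swapCoeff β (e - Pi.single i 1) i)⁻¹ •
      (monomial y (e - Pi.single i 1) * y i) := by
    rw [h1, smul_smul, inv_mul_cancel₀ (swapCoeff_ne_zero hβ _ _), one_smul]
  rw [h2, smul_mul_assoc, mul_assoc, hsq, mul_zero, smul_zero]

variable {P : Fin N → Prop}

/-- The exponent with one more factor `i`. -/
def Exponent.inc (e : Exponent P) (i : Fin N) (h : P i → e.1 i = 0) : Exponent P :=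
  ⟨e.1 + Pi.single i 1, fun j hj => by
    by_cases hij : j = i
    · subst hij
      simp [h hj]
    · simpa [hij] using e.2 j hj⟩

open Classical in
/-- Right multiplication by a generator, on the space with the monomials as a basis. -/
noncomputable def fockOp (β : Fin N → Fin N → F) (P : Fin N → Prop) (i : Fin N) :
    Module.End F (Exponent P →₀ F) :=
  Finsupp.linearCombination F fun e : Exponent P =>
    if h : P i → e.1 i = 0 then Finsupp.single (e.inc i h) (swapCoeff β e.1 i) else 0

theorem fockOp_single (β : Fin N → Fin N → F) (i : Fin N) (e : Exponent P)
    (h : P i → e.1 i = 0) :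
    fockOp β P i (Finsupp.single e 1) = Finsupp.single (e.inc i h) (swapCoeff β e.1 i) := by
  simp [fockOp, dif_pos h]

theorem fockOp_single_zero (β : Fin N → Fin N → F) (i : Fin N) (e : Exponent P)
    (h : ¬ (P i → e.1 i = 0)) : fockOp β P i (Finsupp.single e 1) = 0 := by
  simp only [fockOp, Finsupp.linearCombination_single, dif_neg h, smul_zero]

theorem single_eq_smul {α : Type*} (a : α) (c : F) :
    (Finsupp.single a c : α →₀ F) = c • Finsupp.single a 1 := by
  simp

theorem fockOp_sq (β : Fin N → Fin N → F) (i : Fin N) (hi : P i) :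
    fockOp β P i * fockOp β P i = 0 := by
  refine Finsupp.lhom_ext' fun e => LinearMap.ext_ring ?_
  simp only [LinearMap.comp_apply, Finsupp.lsingle_apply, Module.End.mul_apply,
    LinearMap.zero_apply]
  by_cases h : P i → e.1 i = 0
  · rw [fockOp_single β i e h, single_eq_smul, map_smul, fockOp_single_zero, smul_zero]
    intro hc
    have := hc hi
    simp [Exponent.inc] at this
  · rw [fockOp_single_zero β i e h, map_zero]

/-- For `i ≠ j` both orders lead to the same exponent, and the swap coefficients differ by one
factor: `β j i` on the left if `i < j`, and `β i j` on the right, cancelled by `β j i`, if `j < i`.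
On the diagonal either the square is zero or the coefficient must be 1. -/
theorem fockOp_comm {β : Fin N → Fin N → F} (hβ : ∀ i j, β i j * β j i = 1)
    (hβP : ∀ i, ¬ P i → β i i = 1) (i j : Fin N) :
    fockOp β P i * fockOp β P j = β j i • (fockOp β P j * fockOp β P i) := by
  by_cases hij : i = j
  · subst hij
    by_cases hi : P i
    · rw [fockOp_sq β i hi, smul_zero]
    · rw [hβP i hi, one_smul]
  refine Finsupp.lhom_ext' fun e => LinearMap.ext_ring ?_
  simp only [LinearMap.comp_apply, Finsupp.lsingle_apply, Module.End.mul_apply,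
    LinearMap.smul_apply]
  have hinc : ∀ {a b : Fin N} (_ : a ≠ b) (h : P b → e.1 b = 0),
      (P a → (e.inc b h).1 a = 0) ↔ (P a → e.1 a = 0) := by
    intro a b hab h
    simp [Exponent.inc, hab]
  by_cases hi : P i → e.1 i = 0
  · by_cases hj : P j → e.1 j = 0
    · rw [fockOp_single β i e hi, fockOp_single β j e hj, single_eq_smul, map_smul,
        fockOp_single β i _ ((hinc hij hj).2 hi), single_eq_smul (e.inc i hi), map_smul,
        fockOp_single β j _ ((hinc (Ne.symm hij) hi).2 hj), smul_smul]
      have hx : (e.inc j hj).inc i ((hinc hij hj).2 hi) =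
          (e.inc i hi).inc j ((hinc (Ne.symm hij) hi).2 hj) := by
        apply Subtype.ext
        simp only [Exponent.inc]
        abel
      rw [hx, Finsupp.smul_single, Finsupp.smul_single]
      congr 1
      simp only [Exponent.inc, swapCoeff_add, smul_eq_mul]
      rcases lt_or_gt_of_ne hij with h | h
      · simp only [h, if_true, h.not_gt, if_false]
        ring
      · simp only [h, if_true, h.not_gt, if_false]
        have := hβ j i
        linear_combination (- swapCoeff β e.1 i * swapCoeff β e.1 j) * this
    · rw [fockOp_single_zero β j e hj, fockOp_single β i e hi, single_eq_smul, map_smul,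
        fockOp_single_zero β j _ (fun h => hj ((hinc (Ne.symm hij) hi).1 h)), map_zero, smul_zero,
        smul_zero]
  · rw [fockOp_single_zero β i e hi, map_zero, smul_zero]
    by_cases hj : P j → e.1 j = 0
    · rw [fockOp_single β j e hj, single_eq_smul, map_smul,
        fockOp_single_zero β i _ (fun h => hi ((hinc hij hj).1 h)), smul_zero]
    · rw [fockOp_single_zero β j e hj, map_zero]

/-- The ordered monomials form a basis of an algebra presented by generators that commute up to
scalars, some of them with square zero. -/
theorem exists_monomial_basis {W : Type u} [Ring W] [Algebra F W] {β : Fin N → Fin N → F}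
    (hβ : ∀ i j, β i j * β j i = 1) (hβP : ∀ i, ¬ P i → β i i = 1) (y : Fin N → W)
    (hsq : ∀ i, P i → y i * y i = 0) (hcomm : ∀ i j, y j * y i = β j i • (y i * y j))
    (hgen : ∀ S : Submodule F W, 1 ∈ S → (∀ w ∈ S, ∀ i, w * y i ∈ S) → S = ⊤)
    (hlift : ∀ (B : Type u) [Ring B] [Algebra F B] (z : Fin N → B),
      (∀ i, P i → z i * z i = 0) → (∀ i j, z j * z i = β j i • (z i * z j)) →
      ∃ f : W →ₐ[F] B, ∀ i, f (y i) = z i) :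
    ∃ b : Module.Basis (Exponent P) F W, ∀ e, b e = monomial y e.1 := by
  let V := Exponent P →₀ F
  -- Right multiplications compose in reverse order, hence the opposite ring.
  obtain ⟨f, hf⟩ := hlift (Module.End F V)ᵐᵒᵖ (fun i => MulOpposite.op (fockOp β P i))
    (fun i hi => by rw [← MulOpposite.op_mul, fockOp_sq β i hi, MulOpposite.op_zero])
    (fun i j => by rw [← MulOpposite.op_mul, fockOp_comm hβ hβP i j, MulOpposite.op_smul,
      MulOpposite.op_mul])
  let e₀ : Exponent P := ⟨0, fun _ _ => by simp⟩
  -- `Ψ w` is `w` acting on the empty monomial. `Ψ` and the map `Φ` below both intertwine right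
  -- multiplication by `y i` with `fockOp β P i`, which makes them inverse to each other.
  let Ψ : W →ₗ[F] V := (LinearMap.applyₗ (Finsupp.single e₀ 1 : V)) ∘ₗ
    (MulOpposite.opLinearEquiv F).symm.toLinearMap ∘ₗ f.toLinearMap
  have hΨ1 : Ψ 1 = Finsupp.single e₀ 1 := by simp [Ψ]
  have hΨ : ∀ w i, Ψ (w * y i) = fockOp β P i (Ψ w) := by
    intro w i
    simp [Ψ, hf]
  let Φ : V →ₗ[F] W := Finsupp.linearCombination F fun e : Exponent P => monomial y e.1
  have hΦs : ∀ e c, Φ (Finsupp.single e c) = c • monomial y e.1 :=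
    fun e c => Finsupp.linearCombination_single F c e
  have hΦ1 : Φ (Finsupp.single e₀ 1) = 1 := by
    rw [hΦs, one_smul]
    exact List.prod_eq_one (by simp [e₀])
  have hΦ : ∀ i v, Φ (fockOp β P i v) = Φ v * y i := by
    intro i v
    have : Φ ∘ₗ fockOp β P i = LinearMap.mulRight F (y i) ∘ₗ Φ := by
      refine Finsupp.lhom_ext' fun e => LinearMap.ext_ring ?_
      simp only [LinearMap.comp_apply, Finsupp.lsingle_apply, LinearMap.mulRight_apply]
      by_cases h : P i → e.1 i = 0
      · rw [fockOp_single β i e h, hΦs, hΦs, one_smul, monomial_mul β y hcomm]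
        rfl
      · rw [fockOp_single_zero β i e h]
        push Not at h
        rw [hΦs, one_smul, map_zero, monomial_single hβ hcomm (hsq i h.1) h.2]
    exact LinearMap.congr_fun this v
  have hΦΨ : ∀ w, Φ (Ψ w) = w := by
    have hS := hgen (LinearMap.eqLocus (Φ ∘ₗ Ψ) LinearMap.id)
      (by simp [LinearMap.mem_eqLocus, hΨ1, hΦ1])
      (fun w hw i => by
        simp only [LinearMap.mem_eqLocus, LinearMap.comp_apply, LinearMap.id_apply] at hw ⊢
        rw [hΨ, hΦ, hw])
    intro w
    have hw : w ∈ LinearMap.eqLocus (Φ ∘ₗ Ψ) LinearMap.id := hS ▸ Submodule.mem_top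
    exact hw
  have hΨΦ : ∀ e : Exponent P, Ψ (monomial y e.1) = Finsupp.single e 1 := by
    -- Induction on the degree: remove one generator that occurs in `e`, and cancel the nonzero swap
    -- coefficient.
    have key : ∀ (k : ℕ) (e : Exponent P), ∑ i, e.1 i = k →
        Ψ (monomial y e.1) = Finsupp.single e 1 := by
      intro k
      induction k with
      | zero =>
        intro e he
        have : e = e₀ := Subtype.ext (funext fun i => by
          exact Finset.sum_eq_zero_iff.1 he i (Finset.mem_univ i))
        rw [this, ← hΨ1]
        congr 1
        exact List.prod_eq_one (by simp [e₀])
      | succ k ih =>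
        intro e he
        obtain ⟨i, -, hi⟩ := Finset.exists_ne_zero_of_sum_ne_zero (by rw [he]; omega)
        let e' : Exponent P := ⟨e.1 - Pi.single i 1, fun j hj =>
          (Nat.sub_le _ _).trans (e.2 j hj)⟩
        have hee : e.1 = e'.1 + Pi.single i 1 := by
          funext j
          by_cases hj : j = i
          · subst hj
            simp [e']
            omega
          · simp [e', hj]
        have h' : P i → e'.1 i = 0 := fun hP => by
          have := e.2 i hP
          simp [e']
          omega
        have hinc : e'.inc i h' = e := Subtype.ext hee.symm
        have hk : ∑ i, e'.1 i = k := by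
          rw [hee] at he
          simp only [Pi.add_apply, Finset.sum_add_distrib] at he
          rw [Finset.sum_pi_single'] at he
          simpa using he
        have h1 := monomial_mul β y hcomm e'.1 i
        rw [← hee] at h1
        have h2 := hΨ (monomial y e'.1) i
        rw [h1, ih e' hk, fockOp_single β i e' h', hinc, map_smul, single_eq_smul e] at h2
        exact smul_right_injective _ (swapCoeff_ne_zero hβ _ _) h2
    exact fun e => key _ e rfl
  let E : W ≃ₗ[F] V := LinearEquiv.ofLinearMap Ψ Φ
    (Finsupp.lhom_ext' fun e => LinearMap.ext_ring (by
      rw [LinearMap.comp_apply, LinearMap.comp_apply, Finsupp.lsingle_apply, hΦs, one_smul, hΨΦ]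
      rfl))
    (LinearMap.ext hΦΨ)
  refine ⟨Module.Basis.ofRepr E, fun e => ?_⟩
  change Φ (Finsupp.single e 1) = _
  rw [hΦs, one_smul]

/-- A product of distinct generators is a nonzero multiple of a monomial. -/
theorem exists_list_prod_eq_smul_monomial {W : Type*} [Ring W] [Algebra F W]
    {β : Fin N → Fin N → F} (hβ : ∀ i j, β i j * β j i = 1) {y : Fin N → W}
    (hcomm : ∀ i j, y j * y i = β j i • (y i * y j)) (l : List (Fin N)) :
    ∃ c : F, c ≠ 0 ∧ (l.map y).prod = c • monomial y fun i => l.count i := by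
  induction l using List.reverseRecOn with
  | nil => exact ⟨1, one_ne_zero, by simp [monomial, List.prod_eq_one]⟩
  | append_singleton l i ih =>
    obtain ⟨c, hc, h⟩ := ih
    refine ⟨c * swapCoeff β (fun i => l.count i) i,
      mul_ne_zero hc (swapCoeff_ne_zero hβ _ _), ?_⟩
    rw [List.map_append, List.prod_append, h, List.map_singleton, List.prod_singleton,
      smul_mul_assoc, monomial_mul β y hcomm, smul_smul]
    congr 2
    funext j
    by_cases hj : j = i
    · subst hj
      simp
    · simp [hj, Ne.symm hj]

end Color

/-! ## The monomial bases of the quantum symmetric and exterior superalgebras -/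

section Bases

variable {F : Type u} [Field F] (q : Fˣ) (m n : ℕ)

/-- The universal property of the quantum exterior superalgebra. -/
noncomputable def extLift {B : Type*} [Ring B] [Algebra F B] (z : Fin (m + n) → B)
    (hsq : ∀ i, pty m n i = 0 → z i * z i = 0)
    (hcomm : ∀ k l, z k * z l =
      (qe q l k * sgn F ((pty m n k + 1) * (pty m n l + 1))) • (z l * z k)) :
    QExt q m n →ₐ[F] B :=
  RingQuot.liftAlgHom F ⟨FreeAlgebra.lift F z, by
    rintro _ _ (⟨i, hi⟩ | ⟨k, l⟩)
    · rw [map_mul, FreeAlgebra.lift_ι_apply, map_zero, hsq i hi]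
    · rw [map_smul, map_mul, map_mul, FreeAlgebra.lift_ι_apply, FreeAlgebra.lift_ι_apply, hcomm]⟩

theorem extLift_ψ {B : Type*} [Ring B] [Algebra F B] (z : Fin (m + n) → B)
    (hsq : ∀ i, pty m n i = 0 → z i * z i = 0)
    (hcomm : ∀ k l, z k * z l =
      (qe q l k * sgn F ((pty m n k + 1) * (pty m n l + 1))) • (z l * z k)) (i : Fin (m + n)) :
    extLift q m n z hsq hcomm (ψ q m n i) = z i := by
  refine (RingQuot.liftAlgHom_mkAlgHom_apply F _ _ _).trans ?_
  rw [FreeAlgebra.lift_ι_apply]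

/-- The universal property of the quantum symmetric superalgebra. -/
noncomputable def symLift {B : Type*} [Ring B] [Algebra F B] (z : Fin (m + n) → B)
    (hsq : ∀ i, pty m n i = 1 → z i * z i = 0)
    (hcomm : ∀ i j, z j * z i =
      (qe q j i * sgn F (pty m n i * pty m n j)) • (z i * z j)) :
    QSym q m n →ₐ[F] B :=
  RingQuot.liftAlgHom F ⟨FreeAlgebra.lift F z, by
    rintro _ _ (⟨i, hi⟩ | ⟨k, l⟩)
    · rw [map_mul, FreeAlgebra.lift_ι_apply, map_zero, hsq i hi]
    · rw [map_smul, map_mul, map_mul, FreeAlgebra.lift_ι_apply, FreeAlgebra.lift_ι_apply, hcomm]⟩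

theorem symLift_x {B : Type*} [Ring B] [Algebra F B] (z : Fin (m + n) → B)
    (hsq : ∀ i, pty m n i = 1 → z i * z i = 0)
    (hcomm : ∀ i j, z j * z i =
      (qe q j i * sgn F (pty m n i * pty m n j)) • (z i * z j)) (i : Fin (m + n)) :
    symLift q m n z hsq hcomm (x q m n i) = z i := by
  refine (RingQuot.liftAlgHom_mkAlgHom_apply F _ _ _).trans ?_
  rw [FreeAlgebra.lift_ι_apply]

/-- The generation hypothesis of `exists_monomial_basis`: stability under right multiplication
passes from the generators to all elements of the free algebra, and is then applied to 1. -/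
theorem eq_top_of_mul_gen_mem {X : Type} {r : FreeAlgebra F X → FreeAlgebra F X → Prop}
    (S : Submodule F (RingQuot r)) (h1 : (1 : RingQuot r) ∈ S)
    (h : ∀ w ∈ S, ∀ i, w * RingQuot.mkAlgHom F r (FreeAlgebra.ι F i) ∈ S) : S = ⊤ := by
  have key : ∀ a : FreeAlgebra F X, ∀ w ∈ S, w * RingQuot.mkAlgHom F r a ∈ S := by
    intro a
    induction a using FreeAlgebra.induction with
    | grade0 c =>
      intro w hw
      rw [AlgHom.commutes, ← Algebra.commutes, ← Algebra.smul_def]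
      exact S.smul_mem c hw
    | grade1 i => exact fun w hw => h w hw i
    | mul a b ha hb =>
      intro w hw
      rw [map_mul, ← mul_assoc]
      exact hb _ (ha _ hw)
    | add a b ha hb =>
      intro w hw
      rw [map_add, mul_add]
      exact S.add_mem (ha _ hw) (hb _ hw)
  refine eq_top_iff.2 fun w _ => ?_
  obtain ⟨a, rfl⟩ := RingQuot.mkAlgHom_surjective F r w
  simpa using key a 1 h1

theorem ext_swap_mul_swap (i j : Fin (m + n)) :
    (qe q j i * sgn F ((pty m n i + 1) * (pty m n j + 1))) *
      (qe q i j * sgn F ((pty m n j + 1) * (pty m n i + 1))) = 1 := by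
  rw [mul_comm (pty m n j + 1), mul_mul_mul_comm, qe_mul_swap, sgn_sq, one_mul]

theorem sym_swap_mul_swap (i j : Fin (m + n)) :
    (qe q i j * sgn F (pty m n j * pty m n i)) *
      (qe q j i * sgn F (pty m n i * pty m n j)) = 1 := by
  rw [mul_comm (pty m n j), mul_mul_mul_comm, qe_mul_swap, sgn_sq, one_mul]

theorem exists_ext_basis : ∃ b : Module.Basis (Exponent fun i => pty m n i = 0) F (QExt q m n),
    ∀ e, b e = monomial (ψ q m n) e.1 := by
  refine exists_monomial_basis
    (β := fun k l => qe q l k * sgn F ((pty m n k + 1) * (pty m n l + 1)))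
    (ext_swap_mul_swap q m n) (fun i hi => ?_) (ψ q m n) (fun i hi => ψ_sq q m n hi)
    (fun i j => ψ_comm q m n j i) (fun S h1 h => eq_top_of_mul_gen_mem S h1 h)
    (fun B _ _ z hsq hcomm => ⟨extLift q m n z hsq fun k l => hcomm l k,
      extLift_ψ q m n z hsq fun k l => hcomm l k⟩)
  -- For odd `i` the exponent of the sign is (1 + 1)(1 + 1) = 0, so the relation of `ψ i` with
  -- itself is void and its powers survive.
  rw [(zmod2_cases _).resolve_left hi, qe_self]
  simp [show (1 : ZMod 2) + 1 = 0 by decide, sgn_zero]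

theorem exists_sym_basis : ∃ b : Module.Basis (Exponent fun i => pty m n i = 1) F (QSym q m n),
    ∀ e, b e = monomial (x q m n) e.1 := by
  refine exists_monomial_basis
    (β := fun j i => qe q j i * sgn F (pty m n i * pty m n j))
    (sym_swap_mul_swap q m n) (fun i hi => ?_) (x q m n) (fun i hi => x_sq q m n hi)
    (fun i j => x_comm q m n i j) (fun S h1 h => eq_top_of_mul_gen_mem S h1 h)
    (fun B _ _ z hsq hcomm => ⟨symLift q m n z hsq hcomm, symLift_x q m n z hsq hcomm⟩)
  rw [(zmod2_cases _).resolve_right hi, qe_self]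
  simp [sgn_zero]

/-- The endomorphism of the quantum exterior superalgebra that kills the `ψ_i` with `i` odd. -/
noncomputable def extEven : QExt q m n →ₐ[F] QExt q m n :=
  extLift q m n (fun i => if pty m n i = 0 then ψ q m n i else 0)
    (fun i hi => by simp [hi, ψ_sq q m n hi])
    (fun k l => by
      split_ifs
      · exact ψ_comm q m n k l
      all_goals simp)

theorem extEven_ψ (i : Fin (m + n)) :
    extEven q m n (ψ q m n i) = if pty m n i = 0 then ψ q m n i else 0 :=
  extLift_ψ q m n _ _ _ i

/-- The endomorphism of the quantum symmetric superalgebra that kills the `x_i` with `i` even. -/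
noncomputable def symOdd : QSym q m n →ₐ[F] QSym q m n :=
  symLift q m n (fun i => if pty m n i = 1 then x q m n i else 0)
    (fun i hi => by simp [hi, x_sq q m n hi])
    (fun k l => by
      split_ifs
      · exact x_comm q m n k l
      all_goals simp)

theorem symOdd_x (i : Fin (m + n)) :
    symOdd q m n (x q m n i) = if pty m n i = 1 then x q m n i else 0 :=
  symLift_x q m n _ _ _ i

theorem map_monomial_eq {N : ℕ} {W : Type*} [Ring W] [Algebra F W] (y : Fin N → W)
    (f : W →ₐ[F] W) (p : Fin N → Prop) [DecidablePred p]
    (hf : ∀ i, f (y i) = if p i then y i else 0)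
    (e : Fin N → ℕ) (he : ∀ i, ¬ p i → e i = 0) : f (monomial y e) = monomial y e := by
  rw [monomial, map_list_prod, List.map_map]
  congr 1
  refine List.map_congr_left fun j _ => ?_
  rw [Function.comp_apply, map_pow, hf]
  split_ifs with h
  · rfl
  · rw [he j h, pow_zero, pow_zero]

theorem map_monomial_eq_zero {N : ℕ} {W : Type*} [Ring W] [Algebra F W] (y : Fin N → W)
    (f : W →ₐ[F] W) (p : Fin N → Prop) [DecidablePred p]
    (hf : ∀ i, f (y i) = if p i then y i else 0)
    (e : Fin N → ℕ) (i : Fin N) (hi : ¬ p i) (he : e i ≠ 0) : f (monomial y e) = 0 := by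
  rw [monomial, map_list_prod, List.map_map]
  refine List.prod_eq_zero (List.mem_map.2 ⟨i, List.mem_finRange i, ?_⟩)
  rw [Function.comp_apply, map_pow, hf, if_neg hi, zero_pow he]

/-- The coordinate at a monomial in generators preserved by a projection `f`, normalized. -/
theorem exists_coordinate {N : ℕ} {W : Type*} [Ring W] [Algebra F W] {P : Fin N → Prop}
    (y : Fin N → W) (b : Module.Basis (Exponent P) F W) (hb : ∀ e, b e = monomial y e.1)
    (f : W →ₐ[F] W) (p : Fin N → Prop) [DecidablePred p]
    (hf : ∀ i, f (y i) = if p i then y i else 0)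
    (e₀ : Exponent P) (he₀ : ∀ i, ¬ p i → e₀.1 i = 0) (t : W) (c : F) (hc : c ≠ 0)
    (ht : t = c • monomial y e₀.1) :
    ∃ T : W →ₗ[F] F, T t = 1 ∧ (∀ w, T (f w) = T w) ∧
      T (b e₀) • t = b e₀ ∧ ∀ e, e ≠ e₀ → T (b e) = 0 := by
  refine ⟨c⁻¹ • b.coord e₀, ?_, ?_, ?_, ?_⟩
  · rw [ht, ← hb, LinearMap.smul_apply, map_smul, Module.Basis.coord_apply,
      Module.Basis.repr_self, Finsupp.single_eq_same]
    simp [hc]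
  · intro w
    have : (c⁻¹ • b.coord e₀) ∘ₗ f.toLinearMap = c⁻¹ • b.coord e₀ := by
      refine b.ext fun e => ?_
      rw [LinearMap.comp_apply, AlgHom.toLinearMap_apply]
      by_cases h : ∀ i, ¬ p i → e.1 i = 0
      · rw [hb, map_monomial_eq y f p hf e.1 h]
      · push Not at h
        obtain ⟨i, hi, he⟩ := h
        have hne : e ≠ e₀ := by
          rintro rfl
          exact he (he₀ i hi)
        nth_rewrite 1 [hb]
        rw [map_monomial_eq_zero y f p hf e.1 i hi he, map_zero, LinearMap.smul_apply,
          Module.Basis.coord_apply, Module.Basis.repr_self, Finsupp.single_eq_of_ne hne.symm,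
          smul_zero]
    exact LinearMap.congr_fun this w
  · rw [ht, ← hb, LinearMap.smul_apply, Module.Basis.coord_apply,
      Module.Basis.repr_self, Finsupp.single_eq_same, smul_smul]
    simp [hc]
  · intro e he
    rw [LinearMap.smul_apply, Module.Basis.coord_apply,
      Module.Basis.repr_self, Finsupp.single_eq_of_ne he.symm, smul_zero]

theorem pty_castAdd (i : Fin m) : pty m n (Fin.castAdd n i) = 0 := by simp [pty]

theorem pty_natAdd (j : Fin n) : pty m n (Fin.natAdd m j) = 1 := by simp [pty]

/-- The exponent of `ψ_1 ⋯ ψ_m`. -/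
def extTop : Exponent fun i => pty m n i = 0 :=
  ⟨fun i => if pty m n i = 0 then 1 else 0, fun i _ => by dsimp only; split_ifs <;> simp⟩

/-- The exponent of `x_{m+1} ⋯ x_{m+n}`. -/
def symTop : Exponent fun i => pty m n i = 1 :=
  ⟨fun i => if pty m n i = 1 then 1 else 0, fun i _ => by dsimp only; split_ifs <;> simp⟩

theorem exists_prod_ψ_eq : ∃ c : F, c ≠ 0 ∧
    (List.ofFn fun i : Fin m => ψ q m n (Fin.castAdd n i)).prod =
      c • monomial (ψ q m n) (extTop m n).1 := by
  obtain ⟨c, hc, h⟩ := exists_list_prod_eq_smul_monomial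
    (β := fun k l => qe q l k * sgn F ((pty m n k + 1) * (pty m n l + 1)))
    (ext_swap_mul_swap q m n)
    (fun i j => ψ_comm q m n j i) (List.ofFn fun i : Fin m => Fin.castAdd n i)
  refine ⟨c, hc, ?_⟩
  rw [List.map_ofFn] at h
  refine h.trans ?_
  congr 2
  funext i
  have hnd : (List.ofFn fun i : Fin m => Fin.castAdd n i).Nodup :=
    List.nodup_ofFn.2 (Fin.castAdd_injective m n)
  rw [hnd.count]
  congr 1
  rw [List.mem_ofFn]
  refine Fin.addCases (fun j => ?_) (fun j => ?_) i
  · simp [pty_castAdd]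
  · simp only [pty_natAdd, one_ne_zero, eq_iff_iff, iff_false]
    rintro ⟨a, ha⟩
    have := congrArg Fin.val ha
    simp at this
    omega

theorem exists_prod_x_eq : ∃ c : F, c ≠ 0 ∧
    (List.ofFn fun j : Fin n => x q m n (Fin.natAdd m j)).reverse.prod =
      c • monomial (x q m n) (symTop m n).1 := by
  obtain ⟨c, hc, h⟩ := exists_list_prod_eq_smul_monomial
    (β := fun j i => qe q j i * sgn F (pty m n i * pty m n j))
    (sym_swap_mul_swap q m n)
    (fun i j => x_comm q m n i j) (List.ofFn fun j : Fin n => Fin.natAdd m j).reverse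
  refine ⟨c, hc, ?_⟩
  rw [List.map_reverse, List.map_ofFn] at h
  refine h.trans ?_
  congr 2
  funext i
  have hnd : (List.ofFn fun j : Fin n => Fin.natAdd m j).Nodup :=
    List.nodup_ofFn.2 (Fin.natAdd_injective n m)
  rw [(List.nodup_reverse.2 hnd).count]
  congr 1
  rw [List.mem_reverse, List.mem_ofFn]
  refine Fin.addCases (fun j => ?_) (fun j => ?_) i
  · simp only [pty_castAdd, zero_ne_one, eq_iff_iff, iff_false]
    rintro ⟨a, ha⟩
    have := congrArg Fin.val ha
    simp at this
    omega
  · simp [pty_natAdd]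

theorem list_prod_mem_grading {A : Type*} [Ring A] [Algebra F A] [SuperAlgebra F A] (l : List A)
    (h : ∀ a ∈ l, ∃ z, a ∈ grading F A z) : ∃ z, l.prod ∈ grading F A z := by
  induction l with
  | nil => exact ⟨0, by rw [List.prod_nil, mem_grading, map_one, sgn_zero, one_smul]⟩
  | cons a l ih =>
    obtain ⟨y, hy⟩ := h a List.mem_cons_self
    obtain ⟨z, hz⟩ := ih fun a ha => h a (List.mem_cons_of_mem _ ha)
    exact ⟨y + z, by rw [List.prod_cons]; exact mul_mem_grading hy hz⟩

/-- Homogeneity gives each basis vector of `K` one definite sign in `diffPart_apply`. -/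
theorem exists_monomial_x_mem (e : Fin (m + n) → ℕ) :
    ∃ z, monomial (x q m n) e ∈ grading F (QSym q m n) z := by
  refine list_prod_mem_grading _ fun a ha => ?_
  obtain ⟨j, -, rfl⟩ := List.mem_map.1 ha
  obtain ⟨z, hz⟩ := list_prod_mem_grading (F := F) (List.replicate (e j) (x q m n j))
    fun a ha => ⟨_, List.eq_of_mem_replicate ha ▸ x_mem q m n j⟩
  exact ⟨z, by rwa [List.prod_replicate] at hz⟩

end Bases

/-! ### The cohomology of the complex K -/

section Acyclic

variable {F : Type u} [Field F] [CharZero F] (q : Fˣ) (m n : ℕ)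

section GradedTensor

variable {A B : Type u} [Ring A] [Algebra F A] [SuperAlgebra F A] [Ring B] [Algebra F B]
  [SuperAlgebra F B]

theorem add_gtmul (a a' : A) (b : B) :
    ((a + a') ᵍ⊗ₜ[F] b : STensor F A B) = a ᵍ⊗ₜ[F] b + a' ᵍ⊗ₜ[F] b :=
  (congrArg _ (TensorProduct.add_tmul ..)).trans (map_add ..)

theorem gtmul_add (a : A) (b b' : B) :
    (a ᵍ⊗ₜ[F] (b + b') : STensor F A B) = a ᵍ⊗ₜ[F] b + a ᵍ⊗ₜ[F] b' :=
  (congrArg _ (TensorProduct.tmul_add ..)).trans (map_add ..)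

theorem zero_gtmul (b : B) : ((0 : A) ᵍ⊗ₜ[F] b : STensor F A B) = 0 :=
  (congrArg _ (TensorProduct.zero_tmul ..)).trans (map_zero _)

theorem gtmul_zero (a : A) : (a ᵍ⊗ₜ[F] (0 : B) : STensor F A B) = 0 :=
  (congrArg _ (TensorProduct.tmul_zero ..)).trans (map_zero _)

theorem gtmul_smul (c : F) (a : A) (b : B) :
    (a ᵍ⊗ₜ[F] (c • b) : STensor F A B) = c • (a ᵍ⊗ₜ[F] b) :=
  (congrArg _ (TensorProduct.tmul_smul ..)).trans (map_smul ..)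

end GradedTensor

/-- Reduces to homogeneous pure tensors, for which the product rule of the super tensor product has
a single sign. -/
theorem stensor_induction {A B : Type u} [Ring A] [Algebra F A] [SuperAlgebra F A] [Ring B]
    [Algebra F B] [SuperAlgebra F B] {p : STensor F A B → Prop}
    (hadd : ∀ s t, p s → p t → p (s + t))
    (htmul : ∀ (y z : ZMod 2) (a : A) (b : B), a ∈ grading F A y → b ∈ grading F B z →
      p (a ᵍ⊗ₜ[F] b)) (t : STensor F A B) : p t := by
  obtain ⟨t, rfl⟩ := (GradedTensorProduct.of F (grading F A) (grading F B)).surjective t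
  induction t using TensorProduct.induction_on with
  | zero =>
    have h := htmul 0 0 0 0 (Submodule.zero_mem _) (Submodule.zero_mem _)
    rwa [zero_gtmul] at h
  | tmul a b =>
    have h : a ᵍ⊗ₜ[F] b = (evenPart F a ᵍ⊗ₜ[F] evenPart F b + oddPart F a ᵍ⊗ₜ[F] evenPart F b +
        (evenPart F a ᵍ⊗ₜ[F] oddPart F b + oddPart F a ᵍ⊗ₜ[F] oddPart F b) : STensor F A B) := by
      conv_lhs => rw [← even_add_odd (F := F) a, ← even_add_odd (F := F) b]
      rw [gtmul_add, add_gtmul, add_gtmul]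
    refine (congrArg p h).mpr ?_
    exact hadd _ _ (hadd _ _ (htmul _ _ _ _ (even_mem a) (even_mem b))
      (htmul _ _ _ _ (odd_mem a) (even_mem b)))
      (hadd _ _ (htmul _ _ _ _ (even_mem a) (odd_mem b))
      (htmul _ _ _ _ (odd_mem a) (odd_mem b)))
  | add s t hs ht =>
    rw [map_add]
    exact hadd _ _ hs ht

/-- A functional on `K` that is a tensor product of functionals. -/
noncomputable def tensorFunctional (T : QExt q m n →ₗ[F] F) (T' : QSym q m n →ₗ[F] F) :
    KAlg q m n →ₗ[F] F :=
  LinearMap.mul' F F ∘ₗ TensorProduct.map T T' ∘ₗ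
    (GradedTensorProduct.of F (grading F (QExt q m n)) (grading F (QSym q m n))).symm.toLinearMap

theorem tensorFunctional_tmul (T : QExt q m n →ₗ[F] F) (T' : QSym q m n →ₗ[F] F)
    (a : QExt q m n) (b : QSym q m n) :
    tensorFunctional q m n T T' (a ᵍ⊗ₜ[F] b) = T a * T' b := by
  simp [tensorFunctional]

/-- Right multiplication by `ψ_i ⊗ x_i`. -/
noncomputable def diffPart (i : Fin (m + n)) : Module.End F (KAlg q m n) :=
  LinearMap.mulRight F (ψ q m n i ᵍ⊗ₜ[F] x q m n i)

theorem sum_diffPart : ∑ i, diffPart q m n i = diff q m n := by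
  refine LinearMap.ext fun k => ?_
  simp only [LinearMap.sum_apply, diffPart, diff, LinearMap.mulRight_apply, cElt, Finset.mul_sum]

theorem diffPart_apply (i : Fin (m + n)) (a : QExt q m n) {z : ZMod 2} {b : QSym q m n}
    (hb : b ∈ grading F (QSym q m n) z) : diffPart q m n i (a ᵍ⊗ₜ[F] b) =
      sgn F (z * (1 + pty m n i)) • ((a * ψ q m n i) ᵍ⊗ₜ[F] (b * x q m n i)) :=
  tmul_mul_tmul a hb (ψ_mem q m n i) _

/-- The element ψ_i ⊗ x_i is odd for either parity of `i`. The powers of `q` from exchanging the ψ's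
and from exchanging the x's are inverse to each other, and the remaining signs multiply to -1. -/
theorem diffPart_anticomm (i j : Fin (m + n)) :
    diffPart q m n i * diffPart q m n j = -(diffPart q m n j * diffPart q m n i) := by
  refine LinearMap.ext fun k => ?_
  rw [Module.End.mul_apply, LinearMap.neg_apply, Module.End.mul_apply]
  simp only [diffPart, LinearMap.mulRight_apply]
  rw [mul_assoc, mul_assoc, ← mul_neg]
  congr 1
  have e1 := tmul_mul_tmul (ψ q m n j) (x_mem q m n j) (ψ_mem q m n i) (x q m n i)
  have e2 := tmul_mul_tmul (ψ q m n i) (x_mem q m n i) (ψ_mem q m n j) (x q m n j)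
  refine e1.trans (Eq.trans ?_ (congrArg Neg.neg e2).symm)
  rw [ψ_comm q m n j i, x_comm q m n i j]
  have h1 := qe_mul_swap q i j
  have h2 : (1 : ZMod 2) + 1 = 0 := by decide
  change _ • (GradedTensorProduct.of F _ _) (_ ⊗ₜ _) = -(_ • (GradedTensorProduct.of F _ _) (_ ⊗ₜ _))
  rw [TensorProduct.smul_tmul_smul, map_smul, smul_smul, ← neg_smul]
  congr 1
  rcases zmod2_cases (pty m n i) with hk | hk <;> rcases zmod2_cases (pty m n j) with hl | hl <;>
  simp only [hk, hl, h2, mul_zero, mul_one, add_zero, zero_add, sgn_zero,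
    sgn_one] <;> first | linear_combination (-1 : F) * h1 | linear_combination h1

/-- The i-th part of `d` introduces x_i, killed by `symOdd` when `i` is even, and ψ_i, killed by
`extEven` when `i` is odd. -/
theorem tensorFunctional_diff {T : QExt q m n →ₗ[F] F} {T' : QSym q m n →ₗ[F] F}
    (hT : ∀ w, T (extEven q m n w) = T w) (hT' : ∀ w, T' (symOdd q m n w) = T' w)
    (k : KAlg q m n) : tensorFunctional q m n T T' (diff q m n k) = 0 := by
  induction k using stensor_induction with
  | hadd k k' h h' => rw [map_add, map_add, h, h', add_zero]
  | htmul _ z a b _ hb =>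
    rw [← sum_diffPart, LinearMap.sum_apply, map_sum]
    refine Finset.sum_eq_zero fun i _ => ?_
    rw [diffPart_apply q m n i a hb, map_smul, tensorFunctional_tmul]
    rcases zmod2_cases (pty m n i) with hi | hi
    · rw [← hT' (b * _), map_mul (symOdd q m n), symOdd_x, hi, if_neg zero_ne_one, mul_zero,
        map_zero, mul_zero, smul_zero]
    · rw [← hT (a * _), map_mul (extEven q m n), extEven_ψ, hi, if_neg one_ne_zero, mul_zero,
        map_zero, zero_mul, smul_zero]

theorem exists_exponent_inc_iff {N : ℕ} {P : Fin N → Prop} (i : Fin N) (e : Exponent P) :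
    (∃ t : Exponent P, t.1 = e.1 + Pi.single i 1) ↔ (P i → e.1 i = 0) := by
  refine ⟨fun ⟨t, ht⟩ hi => ?_, fun h => ⟨e.inc i h, rfl⟩⟩
  have h1 := t.2 i hi
  rw [ht] at h1
  simpa using h1

theorem exists_exponent_dec_iff {N : ℕ} {P : Fin N → Prop} (i : Fin N) (e : Exponent P) :
    (∃ t : Exponent P, e.1 = t.1 + Pi.single i 1) ↔ 1 ≤ e.1 i := by
  refine ⟨fun ⟨t, ht⟩ => by rw [ht]; simp, fun h => ⟨⟨e.1 - Pi.single i 1, fun j hj =>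
    (Nat.sub_le _ _).trans (e.2 j hj)⟩, ?_⟩⟩
  funext j
  by_cases hj : j = i
  · subst hj
    simp
    omega
  · simp [hj]

/-- The complex `K` is contracted to the line spanned by `ψ_1 ⋯ ψ_m x_{m+n} ⋯ x_{m+1}`. -/
theorem exists_contraction : ∃ (H : Module.End F (KAlg q m n)) (T : QExt q m n →ₗ[F] F)
    (T' : QSym q m n →ₗ[F] F),
    T (List.ofFn fun i : Fin m => ψ q m n (Fin.castAdd n i)).prod = 1 ∧
    T' (List.ofFn fun j : Fin n => x q m n (Fin.natAdd m j)).reverse.prod = 1 ∧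
    (∀ w, T (extEven q m n w) = T w) ∧ (∀ w, T' (symOdd q m n w) = T' w) ∧
    ∀ k, diff q m n (H k) + H (diff q m n k) =
      k - tensorFunctional q m n T T' k • top q m n := by
  obtain ⟨b, hb⟩ := exists_ext_basis q m n
  obtain ⟨b', hb'⟩ := exists_sym_basis q m n
  obtain ⟨c, hc, hc'⟩ := exists_prod_ψ_eq q m n
  obtain ⟨T, hT1, hT2, hT3, hT4⟩ := exists_coordinate (ψ q m n) b hb (extEven q m n)
    (fun i => pty m n i = 0) (extEven_ψ q m n) (extTop m n) (fun i hi => if_neg hi) _ c hc hc'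
  obtain ⟨c, hc, hc'⟩ := exists_prod_x_eq q m n
  obtain ⟨T', hT1', hT2', hT3', hT4'⟩ := exists_coordinate (x q m n) b' hb' (symOdd q m n)
    (fun i => pty m n i = 1) (symOdd_x q m n) (symTop m n) (fun i hi => if_neg hi) _ c hc hc'
  choose z hz using exists_monomial_x_mem q m n
  let B := (b.tensorProduct b').map
    (GradedTensorProduct.of F (grading F (QExt q m n)) (grading F (QSym q m n)))
  have hB : ∀ s, B s = monomial (ψ q m n) s.1.1 ᵍ⊗ₜ[F] monomial (x q m n) s.2.1 := by
    rintro ⟨e, e'⟩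
    simp only [B, Module.Basis.map_apply, Module.Basis.tensorProduct_apply, hb, hb']
  set β : Fin (m + n) → Fin (m + n) → F :=
    fun k l => qe q l k * sgn F ((pty m n k + 1) * (pty m n l + 1))
  set β' : Fin (m + n) → Fin (m + n) → F :=
    fun j i => qe q j i * sgn F (pty m n i * pty m n j)
  have hβ : ∀ i j, β i j * β j i = 1 := ext_swap_mul_swap q m n
  have hβ' : ∀ i j, β' i j * β' j i = 1 := sym_swap_mul_swap q m n
  have hup : ∀ i (s : Exponent (fun i => pty m n i = 0) × Exponent (fun i => pty m n i = 1)),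
      (∃ t : Exponent (fun i => pty m n i = 0) × Exponent (fun i => pty m n i = 1),
        t.1.1 = s.1.1 + Pi.single i 1 ∧ t.2.1 = s.2.1 + Pi.single i 1) ↔
      (pty m n i = 0 → s.1.1 i = 0) ∧ (pty m n i = 1 → s.2.1 i = 0) := by
    intro i s
    rw [← exists_exponent_inc_iff i s.1, ← exists_exponent_inc_iff i s.2]
    exact ⟨fun ⟨t, h1, h2⟩ => ⟨⟨t.1, h1⟩, ⟨t.2, h2⟩⟩, fun ⟨⟨t, h1⟩, ⟨t', h2⟩⟩ => ⟨(t, t'), h1, h2⟩⟩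
  have hdown : ∀ i (s : Exponent (fun i => pty m n i = 0) × Exponent (fun i => pty m n i = 1)),
      (∃ t : Exponent (fun i => pty m n i = 0) × Exponent (fun i => pty m n i = 1),
        s.1.1 = t.1.1 + Pi.single i 1 ∧ s.2.1 = t.2.1 + Pi.single i 1) ↔
      1 ≤ s.1.1 i ∧ 1 ≤ s.2.1 i := by
    intro i s
    rw [← exists_exponent_dec_iff i s.1, ← exists_exponent_dec_iff i s.2]
    exact ⟨fun ⟨t, h1, h2⟩ => ⟨⟨t.1, h1⟩, ⟨t.2, h2⟩⟩, fun ⟨⟨t, h1⟩, ⟨t', h2⟩⟩ => ⟨(t, t'), h1, h2⟩⟩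
  have hshift : ∀ {i j : Fin (m + n)} {e e' : Fin (m + n) → ℕ}, i ≠ j →
      e' = e + Pi.single j 1 → e' i = e i := by
    rintro i j e _ hij rfl
    simp [hij]
  -- The i-th shift raises the exponents of ψ_i and x_i together. Its weight is the sign of moving
  -- ψ_i past the monomial in the x's, times the two swap coefficients.
  obtain ⟨H, Q, hH, hQ⟩ := exists_shift_homotopy B (diffPart q m n)
    (fun i s t => t.1.1 = s.1.1 + Pi.single i 1 ∧ t.2.1 = s.2.1 + Pi.single i 1)
    (fun i s => sgn F (z s.2.1 * (1 + pty m n i)) * (swapCoeff β s.1.1 i * swapCoeff β' s.2.1 i))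
    (fun i s => mul_ne_zero (left_ne_zero_of_mul_eq_one (sgn_sq _))
      (mul_ne_zero (swapCoeff_ne_zero hβ _ _) (swapCoeff_ne_zero hβ' _ _)))
    (fun i s t hst => by
      rw [hB, diffPart_apply q m n i _ (hz s.2.1), monomial_mul β _ (fun i j => ψ_comm q m n j i),
        monomial_mul β' _ (fun i j => x_comm q m n i j), hB, hst.1, hst.2,
        mul_smul]
      exact congrArg _ ((congrArg _ (TensorProduct.smul_tmul_smul ..)).trans (map_smul ..)))
    (fun i s hs => by
      rw [hup, not_and_or] at hs
      push Not at hs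
      rw [hB, diffPart_apply q m n i _ (hz s.2.1)]
      change _ • (GradedTensorProduct.of F _ _) (_ ⊗ₜ _) = _
      rcases hs with hs | hs
      · rw [monomial_single hβ (fun i j => ψ_comm q m n j i) (ψ_sq q m n hs.1) hs.2,
          TensorProduct.zero_tmul, map_zero, smul_zero]
      · rw [monomial_single hβ' (fun i j => x_comm q m n i j) (x_sq q m n hs.1) hs.2,
          TensorProduct.tmul_zero, map_zero, smul_zero])
    (fun i s s' t h h' => Prod.ext (Subtype.ext (add_right_cancel (h.1.symm.trans h'.1)))
      (Subtype.ext (add_right_cancel (h.2.symm.trans h'.2))))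
    (diffPart_anticomm q m n)
    -- After one shift both exponents at `i` are positive, and one of ψ_i, x_i has square zero, so a
    -- second shift is impossible.
    (fun i s t t' h h' => by
      have h1 := (hup i t).1 ⟨t', h'⟩
      have h2 := (hdown i t).1 ⟨s, h⟩
      rcases zmod2_cases (pty m n i) with hi | hi
      · have := h1.1 hi
        omega
      · have := h1.2 hi
        omega)
    (fun i j s s' hij h => by rw [hup, hup, hshift hij h.1, hshift hij h.2])
    (fun i j s s' hij h => by rw [hdown, hdown, hshift hij h.1, hshift hij h.2])
  refine ⟨H, T, T', hT1, hT1', hT2, hT2', fun k => ?_⟩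
  rw [sum_diffPart] at hH
  have hQ' : Q = (tensorFunctional q m n T T').smulRight (top q m n) := by
    refine B.ext fun s => ?_
    have hTB : tensorFunctional q m n T T' (B s) = T (b s.1) * T' (b' s.2) := by
      rw [hB, tensorFunctional_tmul, hb, hb']
    rw [LinearMap.smulRight_apply, hTB]
    by_cases hs : s = (extTop m n, symTop m n)
    · subst hs
      have hz0 : (0 : ZMod 2) ≠ 1 := by decide
      rw [(hQ _).1 fun i => ⟨fun h => ?_, fun h => ?_⟩, hB, ← hb, ← hb']
      -- The values of `T` and `T'` at the ordered top monomials are the scalars relating these to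
      -- the products in `top`.
      · conv_lhs => rw [← hT3, ← hT3']
        exact (congrArg _ (TensorProduct.smul_tmul_smul ..)).trans (map_smul ..)
      · have h1 := (hup i _).1 h
        rcases zmod2_cases (pty m n i) with hi | hi
        · simpa [extTop, hi] using h1.1 hi
        · simpa [symTop, hi] using h1.2 hi
      · have h1 := (hdown i _).1 h
        rcases zmod2_cases (pty m n i) with hi | hi
        · simpa [symTop, hi, hz0] using h1.2
        · simpa [extTop, hi] using h1.1
    · have h0 : T (b s.1) * T' (b' s.2) = 0 := by
        by_cases h1 : s.1 = extTop m n
        · rw [hT4' _ fun h2 => hs (Prod.ext h1 h2), mul_zero]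
        · rw [hT4 _ h1, zero_mul]
      rw [h0, zero_smul]
      refine (hQ s).2 ?_
      by_contra hcon
      rw [not_exists] at hcon
      -- If the i-th shift neither moves `s` nor leads to it, the exponents of (ψ_i, x_i) are (1, 0)
      -- for even `i` and (0, 1) for odd `i`, as in the top monomial.
      refine hs (Prod.ext (Subtype.ext (funext fun i => ?_)) (Subtype.ext (funext fun i => ?_)))
      all_goals
        have h1 := fun h => hcon i (Or.inl ((hup i s).2 h))
        have h2 := fun h => hcon i (Or.inr ((hdown i s).2 h))
        have h3 := s.1.2 i
        have h4 := s.2.2 i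
        rcases zmod2_cases (pty m n i) with hi | hi <;>
          simp [extTop, symTop, hi] at h1 h2 h3 h4 ⊢ <;> omega
  have h := LinearMap.congr_fun hH k
  rw [hQ'] at h
  exact h

end Acyclic

/-! ## Existence and uniqueness of the quantum Berezinian -/

section Relations

variable {F : Type u} [Field F] (q : Fˣ) (m n d : ℕ)

theorem genM_mul_genMInv : genM q m n d * genMInv q m n d = 1 := by
  ext i j
  have h := RingQuot.mkAlgHom_rel F (HopfRel.mul_inv (q := q) (d := d) 0 i j)
  simp only [Function.iterate_zero, id_eq, Matrix.mul_apply, map_sum, map_mul] at h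
  rw [Matrix.mul_apply]
  refine Eq.trans h ?_
  rw [Matrix.one_apply, Matrix.one_apply]
  split_ifs
  · exact map_one _
  · exact map_zero _

theorem genMInv_mul_genM : genMInv q m n d * genM q m n d = 1 := by
  ext i j
  have h := RingQuot.mkAlgHom_rel F (HopfRel.inv_mul (q := q) (d := d) 0 i j)
  simp only [Function.iterate_zero, id_eq, Matrix.mul_apply, map_sum, map_mul] at h
  rw [Matrix.mul_apply]
  refine Eq.trans h ?_
  rw [Matrix.one_apply, Matrix.one_apply]
  split_ifs
  · exact map_one _
  · exact map_zero _

theorem prod_ψ_mul_ψ {i : Fin (m + n)} (hi : pty m n i = 0) :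
    (List.ofFn fun i : Fin m => ψ q m n (Fin.castAdd n i)).prod * ψ q m n i = 0 := by
  obtain ⟨c, -, h⟩ := exists_prod_ψ_eq q m n
  rw [h, smul_mul_assoc, monomial_single (ext_swap_mul_swap q m n) (fun i j => ψ_comm q m n j i)
    (ψ_sq q m n hi) (by simp [extTop, hi]), smul_zero]

theorem prod_x_mul_x {i : Fin (m + n)} (hi : pty m n i = 1) :
    (List.ofFn fun j : Fin n => x q m n (Fin.natAdd m j)).reverse.prod * x q m n i = 0 := by
  obtain ⟨c, -, h⟩ := exists_prod_x_eq q m n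
  rw [h, smul_mul_assoc, monomial_single (sym_swap_mul_swap q m n) (fun i j => x_comm q m n i j)
    (x_sq q m n hi) (by simp [symTop, hi]), smul_zero]

theorem prod_x_eq_map : (List.ofFn fun j : Fin n => x q m n (Fin.natAdd m j)).reverse.prod =
    ((List.ofFn fun j : Fin n => Fin.natAdd m j).reverse.map (x q m n)).prod := by
  rw [List.map_reverse, List.map_ofFn]
  rfl

end Relations

/-! ### Compatibility of the coaction with the differential -/

section Coaction

variable {F : Type u} [Field F] [CharZero F] (q : Fˣ) (m n d : ℕ)

/-- The product of `ω' ⊗ a` and `s' ⊗ b` in `K ⊗ M̃`. -/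
noncomputable def mergeK : STensor F (QExt q m n) (Mtilde q m n d) →ₗ[F]
    STensor F (QSym q m n) (SuperOp F (Mtilde q m n d)) →ₗ[F] KAlg q m n ⊗[F] Mtilde q m n d :=
  ((TensorProduct.mk F _ _).compl₁₂
    (GradedTensorProduct.of F (grading F (QExt q m n))
      (grading F (Mtilde q m n d))).symm.toLinearMap
    (LinearMap.lTensor (QSym q m n) (toOp F (Mtilde q m n d)).symm.toLinearMap ∘ₗ
      (GradedTensorProduct.of F (grading F (QSym q m n))
        (grading F (SuperOp F (Mtilde q m n d)))).symm.toLinearMap)).compr₂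
    (LinearMap.rTensor (Mtilde q m n d)
      (GradedTensorProduct.of F (grading F (QExt q m n)) (grading F (QSym q m n))).toLinearMap ∘ₗ
    merge F (QExt q m n) (QSym q m n) (Mtilde q m n d))

theorem deltaK_tmul (a : QExt q m n) (b : QSym q m n) :
    deltaK q m n d (a ᵍ⊗ₜ[F] b) = mergeK q m n d (deltaExt q m n d a) (deltaSym q m n d b) :=
  rfl

theorem mergeK_tmul {y z : ZMod 2} (a : QExt q m n) {c : Mtilde q m n d}
    (hc : c ∈ grading F (Mtilde q m n d) y) {b : QSym q m n}
    (hb : b ∈ grading F (QSym q m n) z) (c' : Mtilde q m n d) :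
    mergeK q m n d (a ᵍ⊗ₜ[F] c) (b ᵍ⊗ₜ[F] toOp F _ c') =
      sgn F (y * z) • ((a ᵍ⊗ₜ[F] b : KAlg q m n) ⊗ₜ[F] (c * c')) :=
  (congrArg (LinearMap.rTensor (Mtilde q m n d)
    (GradedTensorProduct.of F (grading F (QExt q m n)) (grading F (QSym q m n))).toLinearMap)
    (merge_tmul a hc hb c')).trans (map_smul ..)

/-- The span of the `a ⊗ b` of total parity `z`. -/
noncomputable def homSpan (F : Type u) [Field F] [CharZero F] (A B : Type u) [Ring A] [Algebra F A]
    [SuperAlgebra F A] [Ring B] [Algebra F B] [SuperAlgebra F B] (z : ZMod 2) :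
    Submodule F (STensor F A B) :=
  Submodule.span F {t | ∃ y a b, a ∈ grading F A y ∧ b ∈ grading F B (y + z) ∧ t = a ᵍ⊗ₜ[F] b}

theorem tmul_mul_phi (w : QExt q m n) {y : ZMod 2} {a : Mtilde q m n d}
    (ha : a ∈ grading F (Mtilde q m n d) y) (i : Fin (m + n)) :
    (w ᵍ⊗ₜ[F] a : STensor F (QExt q m n) (Mtilde q m n d)) * phi q m n d i =
      ∑ j, sgn F (y * (1 + pty m n j)) • ((w * ψ q m n j) ᵍ⊗ₜ[F] (a * genM q m n d j i)) := by
  rw [phi, Finset.mul_sum]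
  exact Finset.sum_congr rfl fun j _ => tmul_mul_tmul w ha (ψ_mem q m n j) _

/-- The opposite product places the new entry of M⁻¹ to the left of `b`, next to where the new entry
of M appears. The signs of the tensor product, the opposite product and the supertranspose combine
into the one stated. -/
theorem tmul_mul_upsilon (s : QSym q m n) {y : ZMod 2} {b : Mtilde q m n d}
    (hb : b ∈ grading F (Mtilde q m n d) y) (i : Fin (m + n)) :
    (s ᵍ⊗ₜ[F] toOp F _ b : STensor F (QSym q m n) (SuperOp F (Mtilde q m n d))) *
      upsilon q m n d i =
      ∑ k, sgn F (y * pty m n i + pty m n k * (pty m n k + pty m n i)) •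
        ((s * x q m n k) ᵍ⊗ₜ[F] toOp F _ (genMInv q m n d i k * b)) := by
  rw [upsilon, Finset.mul_sum]
  refine Finset.sum_congr rfl fun k _ => ?_
  refine (tmul_mul_tmul s (toOp_mem hb) (x_mem q m n k) _).trans ?_
  rw [toOp_mul hb (st_mem q m n d k i), supertranspose, Matrix.of_apply, smul_mul_assoc, map_smul,
    smul_smul, gtmul_smul, smul_smul, ← sgn_add, ← sgn_add]
  congr 2
  have key : ∀ y i k : ZMod 2, y * k + (y * (i + k) + k * (k + i)) = y * i + k * (k + i) := by
    decide
  exact key _ _ _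

/-- The coaction commutes with the differential, up to parity. -/
theorem sum_mergeK_mul (z : ZMod 2) (X : STensor F (QExt q m n) (Mtilde q m n d))
    (Y : STensor F (QSym q m n) (SuperOp F (Mtilde q m n d)))
    (hY : Y ∈ homSpan F (QSym q m n) (SuperOp F (Mtilde q m n d)) z) :
    ∑ i, sgn F ((1 + pty m n i) * z) •
        mergeK q m n d (X * phi q m n d i) (Y * upsilon q m n d i) =
      TensorProduct.map (diff q m n) (par F : Mtilde q m n d →ₐ[F] Mtilde q m n d).toLinearMap
        (mergeK q m n d X Y) := by
  -- `key₁` frees the sign from `i`, so that the sum over `i` becomes a matrix product; `key₂` and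
  -- `key₃` match the diagonal terms `k = j` with the signs of `d` and of the parity map.
  have key₁ : ∀ z u y i j k : ZMod 2,
      (1 + i) * z + ((u + z) * i + k * (k + i)) + y * (1 + j) + (y + (j + i)) * (u + k) =
        z + y * (1 + j) + k + (y + j) * (u + k) := by decide
  have key₂ : ∀ z u y j : ZMod 2,
      z + y * (1 + j) + j + (y + j) * (u + j) = z + y + y * u + u * j := by decide
  have key₃ : ∀ z u y j : ZMod 2,
      z + y + y * u + u * j = y * u + (u * (1 + j) + (y + (u + z))) := by decide
  induction hY using Submodule.span_induction with
  | zero => simp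
  | add Y Y' _ _ h h' =>
    rw [map_add, map_add, ← h, ← h', ← Finset.sum_add_distrib]
    refine Finset.sum_congr rfl fun i _ => ?_
    rw [add_mul Y, map_add, smul_add]
  | smul c Y _ h =>
    rw [map_smul, map_smul, ← h, Finset.smul_sum]
    refine Finset.sum_congr rfl fun i _ => ?_
    rw [smul_mul_assoc, map_smul, smul_comm]
  | mem Y hY =>
    obtain ⟨u, s, b, hs, hb, rfl⟩ := hY
    obtain ⟨b, rfl⟩ := (toOp F _).surjective b
    replace hb : b ∈ grading F (Mtilde q m n d) (u + z) := hb
    induction X using stensor_induction with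
    | hadd X X' h h' =>
      rw [map_add, LinearMap.add_apply, map_add, ← h, ← h', ← Finset.sum_add_distrib]
      refine Finset.sum_congr rfl fun i _ => ?_
      rw [add_mul X, map_add, LinearMap.add_apply, smul_add]
    | htmul _ y w a _ ha =>
      have hL : ∀ i, sgn F ((1 + pty m n i) * z) •
          mergeK q m n d ((w ᵍ⊗ₜ[F] a : STensor F (QExt q m n) (Mtilde q m n d)) * phi q m n d i)
            ((s ᵍ⊗ₜ[F] toOp F _ b : STensor F (QSym q m n) (SuperOp F (Mtilde q m n d))) *
              upsilon q m n d i) =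
          ∑ j, ∑ k, sgn F (z + y * (1 + pty m n j) + pty m n k +
              (y + pty m n j) * (u + pty m n k)) •
            (((w * ψ q m n j) ᵍ⊗ₜ[F] (s * x q m n k) : KAlg q m n) ⊗ₜ[F]
              (a * (genM q m n d j i * genMInv q m n d i k) * b)) := by
        intro i
        rw [tmul_mul_phi q m n d w ha, tmul_mul_upsilon q m n d s hb]
        simp only [map_sum, LinearMap.sum_apply, Finset.smul_sum]
        rw [Finset.sum_comm]
        refine Finset.sum_congr rfl fun j _ => Finset.sum_congr rfl fun k _ => ?_
        rw [map_smul, map_smul, LinearMap.smul_apply,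
          mergeK_tmul q m n d _ (mul_mem_grading ha (Mbar_mem q m n d 0 j i))
            (mul_mem_grading hs (x_mem q m n k)), smul_smul, smul_smul, smul_smul,
          ← sgn_add, ← sgn_add, ← sgn_add]
        congr 2
        · exact key₁ _ _ _ _ _ _
        · noncomm_ring
      simp only [hL]
      rw [Finset.sum_comm]
      -- The sum over `i` is the entry (j, k) of M M⁻¹ = 1.
      have hR : ∀ j, ∑ i, ∑ k, sgn F (z + y * (1 + pty m n j) + pty m n k +
              (y + pty m n j) * (u + pty m n k)) •
            (((w * ψ q m n j) ᵍ⊗ₜ[F] (s * x q m n k) : KAlg q m n) ⊗ₜ[F]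
              (a * (genM q m n d j i * genMInv q m n d i k) * b)) =
          sgn F (z + y + y * u + u * pty m n j) •
            (((w * ψ q m n j) ᵍ⊗ₜ[F] (s * x q m n j) : KAlg q m n) ⊗ₜ[F] (a * b)) := by
        intro j
        rw [Finset.sum_comm]
        simp only [← Finset.smul_sum, ← TensorProduct.tmul_sum, ← Finset.sum_mul,
          ← Finset.mul_sum, ← Matrix.mul_apply, genM_mul_genMInv]
        rw [Finset.sum_eq_single j]
        · rw [Matrix.one_apply_eq, mul_one]
          congr 2
          exact key₂ _ _ _ _
        · intro k _ hk
          rw [Matrix.one_apply_ne hk.symm, mul_zero, zero_mul, TensorProduct.tmul_zero, smul_zero]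
        · exact fun h => absurd (Finset.mem_univ j) h
      simp only [hR]
      rw [mergeK_tmul q m n d _ ha hs, map_smul, TensorProduct.map_tmul, ← sum_diffPart,
        LinearMap.sum_apply, TensorProduct.sum_tmul, Finset.smul_sum, AlgHom.toLinearMap_apply,
        mem_grading.1 (mul_mem_grading ha hb)]
      refine Finset.sum_congr rfl fun j _ => ?_
      rw [diffPart_apply q m n j _ hs, TensorProduct.smul_tmul_smul, smul_smul, ← sgn_add,
        ← sgn_add]
      congr 2
      exact key₃ _ _ _ _

/-- Every factor `upsilon q m n d i` has the total parity of x_i. The total parity of δ(s) is what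
the signs in `sum_mergeK_mul` depend on. -/
theorem exists_deltaSym_mem (l : List (Fin (m + n))) :
    ∃ z, deltaSym q m n d (l.map (x q m n)).prod ∈
      homSpan F (QSym q m n) (SuperOp F (Mtilde q m n d)) z := by
  have hone : ∀ {A : Type u} [Ring A] [Algebra F A] [SuperAlgebra F A],
      (1 : A) ∈ grading F A 0 := by
    intro A _ _ _
    rw [mem_grading, map_one, sgn_zero, one_smul]
  induction l using List.reverseRecOn with
  | nil =>
    refine ⟨0, Submodule.subset_span ⟨0, 1, 1, hone, hone, ?_⟩⟩
    rw [List.map_nil, List.prod_nil, map_one]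
    rfl
  | append_singleton l i ih =>
    obtain ⟨z, hz⟩ := ih
    refine ⟨z + pty m n i, ?_⟩
    rw [List.map_append, List.prod_append, List.map_singleton, List.prod_singleton, map_mul,
      deltaSym_x]
    generalize deltaSym q m n d (l.map (x q m n)).prod = Y at hz ⊢
    induction hz using Submodule.span_induction with
    | zero => rw [zero_mul]; exact Submodule.zero_mem _
    | add Y Y' _ _ h h' => rw [add_mul]; exact Submodule.add_mem _ h h'
    | smul c Y _ h => rw [smul_mul_assoc]; exact Submodule.smul_mem _ c h
    | mem Y hY =>
      obtain ⟨y, s, b, hs, hb, rfl⟩ := hY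
      rw [upsilon, Finset.mul_sum]
      refine Submodule.sum_mem _ fun k _ => ?_
      rw [show (s ᵍ⊗ₜ[F] b * x q m n k ᵍ⊗ₜ[F] toOp F _ (supertranspose F (genMInv q m n d) k i) :
        STensor F (QSym q m n) (SuperOp F (Mtilde q m n d))) = _ from
        tmul_mul_tmul s hb (x_mem q m n k) _]
      refine Submodule.smul_mem _ _ (Submodule.subset_span ⟨y + pty m n k, _, _,
        mul_mem_grading hs (x_mem q m n k), ?_, rfl⟩)
      have h := mul_mem_grading hb (toOp_mem (st_mem q m n d k i))
      have e : y + z + (pty m n i + pty m n k) = y + pty m n k + (z + pty m n i) := by ring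
      rwa [e] at h

/-- Multiplication by ψ_i ⊗ x_i repeats a generator of square zero: ψ_i if `i` is even, x_i if `i`
is odd. -/
theorem diff_top : diff q m n (top q m n) = 0 := by
  rw [← sum_diffPart, LinearMap.sum_apply]
  refine Finset.sum_eq_zero fun i _ => ?_
  obtain ⟨z, hz⟩ := list_prod_mem_grading (F := F)
    (List.ofFn fun j : Fin n => x q m n (Fin.natAdd m j)).reverse fun a ha => by
      rw [List.mem_reverse, List.mem_ofFn] at ha
      obtain ⟨j, rfl⟩ := ha
      exact ⟨_, x_mem q m n _⟩
  rw [top, diffPart_apply q m n i _ hz]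
  rcases zmod2_cases (pty m n i) with hi | hi
  · rw [prod_ψ_mul_ψ q m n hi, zero_gtmul, smul_zero]
  · rw [prod_x_mul_x q m n hi, gtmul_zero, smul_zero]

/-- By `sum_mergeK_mul` this is, up to the involutive parity map on coefficients, a sum over `i` in
which one argument is δ of a product that vanishes by a repeated generator. -/
theorem rTensor_diff_deltaK_top :
    LinearMap.rTensor (Mtilde q m n d) (diff q m n) (deltaK q m n d (top q m n)) = 0 := by
  obtain ⟨z, hz⟩ := exists_deltaSym_mem q m n d (List.ofFn fun j : Fin n => Fin.natAdd m j).reverse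
  rw [← prod_x_eq_map] at hz
  have h := sum_mergeK_mul q m n d z
    (deltaExt q m n d (List.ofFn fun i : Fin m => ψ q m n (Fin.castAdd n i)).prod) _ hz
  rw [← deltaK_tmul, Finset.sum_eq_zero] at h
  · have hp : LinearMap.rTensor (Mtilde q m n d) (diff q m n) =
        LinearMap.lTensor _ (par F : Mtilde q m n d →ₐ[F] Mtilde q m n d).toLinearMap ∘ₗ
          TensorProduct.map (diff q m n)
            (par F : Mtilde q m n d →ₐ[F] Mtilde q m n d).toLinearMap := by
      refine TensorProduct.ext' fun k c => ?_
      simp only [LinearMap.rTensor_tmul, LinearMap.comp_apply, TensorProduct.map_tmul,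
        LinearMap.lTensor_tmul, AlgHom.toLinearMap_apply, par_par]
    rw [hp, LinearMap.comp_apply, top, ← h, map_zero]
  · intro i _
    rw [← deltaExt_ψ, ← deltaSym_x, ← map_mul, ← map_mul]
    rcases zmod2_cases (pty m n i) with hi | hi
    · rw [prod_ψ_mul_ψ q m n hi, map_zero, map_zero, LinearMap.zero_apply, smul_zero]
    · rw [prod_x_mul_x q m n hi, map_zero, map_zero, smul_zero]

/-- A contraction of `K` identifies the quantum Berezinian as a coefficient of the coaction. -/
theorem isQuantumBerezinian_iff (H : Module.End F (KAlg q m n)) (T : KAlg q m n →ₗ[F] F)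
    (hT : T (top q m n) = 1) (hTd : ∀ k, T (diff q m n k) = 0)
    (hH : ∀ k, diff q m n (H k) + H (diff q m n k) = k - T k • top q m n)
    (b : Mtilde q m n d) : IsQuantumBerezinian q m n d b ↔
      b = TensorProduct.lid F _ (LinearMap.rTensor _ T (deltaK q m n d (top q m n))) := by
  constructor
  · rintro ⟨-, hb⟩
    -- Uniqueness: `T` descends to K / Im d and takes the value 1 on the class of `top`, so it reads
    -- off `b`.
    let T' : (KAlg q m n ⧸ LinearMap.range (diff q m n)) →ₗ[F] F :=
      (LinearMap.range (diff q m n)).liftQ T (by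
        rintro _ ⟨k, rfl⟩
        exact hTd k)
    have hTT : T = T' ∘ₗ (LinearMap.range (diff q m n)).mkQ := by
      simp [T', Submodule.liftQ_mkQ]
    rw [hTT, LinearMap.rTensor_comp, LinearMap.comp_apply, hb, LinearMap.rTensor_tmul,
      ← LinearMap.comp_apply T', ← hTT, hT, TensorProduct.lid_tmul, one_smul]
  · rintro rfl
    refine ⟨diff_top q m n, ?_⟩
    -- Existence: the contraction, tensored with the coefficients, is applied to the cocycle δ(top);
    -- the term with `d` outside dies modulo Im d.
    have h1 : diff q m n ∘ₗ H + H ∘ₗ diff q m n = LinearMap.id - T.smulRight (top q m n) :=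
      LinearMap.ext hH
    have h2 := congrArg (fun f => LinearMap.rTensor (Mtilde q m n d) f
      (deltaK q m n d (top q m n))) h1
    simp only [LinearMap.rTensor_add, LinearMap.rTensor_sub, LinearMap.rTensor_comp,
      LinearMap.add_apply, LinearMap.sub_apply, LinearMap.comp_apply, rTensor_diff_deltaK_top,
      map_zero, add_zero, LinearMap.rTensor_id, LinearMap.id_apply] at h2
    have h3 : ∀ t : KAlg q m n ⊗[F] Mtilde q m n d,
        LinearMap.rTensor (Mtilde q m n d) (T.smulRight (top q m n)) t =
          top q m n ⊗ₜ TensorProduct.lid F _ (LinearMap.rTensor _ T t) := by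
      intro t
      induction t using TensorProduct.induction_on with
      | zero => simp
      | tmul k c =>
        simp only [LinearMap.rTensor_tmul, LinearMap.smulRight_apply, TensorProduct.lid_tmul,
          TensorProduct.tmul_smul, TensorProduct.smul_tmul']
      | add s t hs ht => simp only [map_add, hs, ht, TensorProduct.tmul_add]
    rw [h3, eq_sub_iff_add_eq] at h2
    have h4 : (LinearMap.range (diff q m n)).mkQ ∘ₗ diff q m n = 0 := by
      ext k
      simp
    have h5 := congrArg (LinearMap.rTensor (Mtilde q m n d) (LinearMap.range (diff q m n)).mkQ) h2
    rw [map_add, LinearMap.rTensor_tmul, ← LinearMap.comp_apply (LinearMap.rTensor _ _),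
      ← LinearMap.rTensor_comp, h4, LinearMap.rTensor_zero, LinearMap.zero_apply, zero_add] at h5
    exact h5.symm

end Coaction

/-! ## Products of anticommuting vectors with noncommutative coefficients -/

section Wedge

variable {F : Type*} [Field F]

section Vanishing

variable {B ι : Type*} [Ring B] [Algebra F B] {η : ι → B} {c : ι → ι → F}

theorem mul_list_prod_eq_zero (hsq : ∀ i, η i * η i = 0)
    (hcomm : ∀ i j, η i * η j = c i j • (η j * η i)) {l : List ι} {i : ι} (hi : i ∈ l) :
    η i * (l.map η).prod = 0 := by
  induction l with
  | nil => simp at hi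
  | cons j l ih =>
    rw [List.map_cons, List.prod_cons, ← mul_assoc]
    rcases List.mem_cons.1 hi with rfl | hi
    · rw [hsq, zero_mul]
    · rw [hcomm, smul_mul_assoc, mul_assoc, ih hi, mul_zero, smul_zero]

theorem list_prod_mul_eq_zero (hsq : ∀ i, η i * η i = 0)
    (hcomm : ∀ i j, η i * η j = c i j • (η j * η i)) {l : List ι} {i : ι} (hi : i ∈ l) :
    (l.map η).prod * η i = 0 := by
  induction l using List.reverseRecOn with
  | nil => simp at hi
  | append_singleton l j ih =>
    rw [List.map_append, List.prod_append, List.map_singleton, List.prod_singleton, mul_assoc]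
    rcases List.mem_append.1 hi with hi | hi
    · rw [hcomm, mul_smul_comm, ← mul_assoc, ih hi, zero_mul, smul_zero]
    · rw [List.mem_singleton.1 hi, hsq, mul_zero]

end Vanishing

theorem mem_of_suffix_finRange {r : ℕ} {i k : Fin r} {l : List (Fin r)}
    (h : i :: l <:+ List.finRange r) (hk : i < k) : k ∈ l := by
  obtain ⟨l₀, h⟩ := h
  have hs := List.pairwise_lt_finRange r
  rw [← h, List.pairwise_append] at hs
  have hm := List.mem_finRange k
  rw [← h, List.mem_append, List.mem_cons] at hm
  rcases hm with hm | rfl | hm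
  · exact absurd (hs.2.2 k hm i List.mem_cons_self) hk.not_gt
  · exact absurd hk (lt_irrefl _)
  · exact hm

theorem mem_of_prefix_finRange {r : ℕ} {i k : Fin r} {l : List (Fin r)}
    (h : l ++ [i] <+: List.finRange r) (hk : k < i) : k ∈ l := by
  obtain ⟨l₁, h⟩ := h
  have hs := List.pairwise_lt_finRange r
  rw [← h, List.append_assoc, List.pairwise_append, List.singleton_append,
    List.pairwise_cons] at hs
  have hm := List.mem_finRange k
  rw [← h, List.append_assoc, List.mem_append, List.singleton_append, List.mem_cons] at hm
  rcases hm with hm | rfl | hm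
  · exact hm
  · exact absurd hk (lt_irrefl _)
  · exact absurd (hs.2.1.1 k hm) hk.not_gt

variable {W A : Type*} [Ring W] [Algebra F W] [Ring A] [Algebra F A] {r : ℕ}

/-- Right elimination: if the columns of `X` anticommute and `X V` is lower triangular for an upper
unitriangular `V`, then the product of the columns is the product of the diagonal of `X V`. -/
theorem prod_columns_eq {ξ : Fin r → W} {c₀ c : Fin r → Fin r → F}
    (hξ : ∀ i, ξ i * ξ i = 0) (hξ' : ∀ i j, ξ i * ξ j = c₀ i j • (ξ j * ξ i))
    (X V : Matrix (Fin r) (Fin r) A) (η : Fin r → W ⊗[F] A)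
    (hη : ∀ k, η k = ∑ a, ξ a ⊗ₜ[F] X a k)
    (hsq : ∀ i, η i * η i = 0) (hcomm : ∀ i j, η i * η j = c i j • (η j * η i))
    (hV : ∀ i, V i i = 1) (hV' : ∀ k i, i < k → V k i = 0)
    (hXV : ∀ a i, a < i → (X * V) a i = 0) :
    ((List.finRange r).map η).prod =
      ((List.finRange r).map ξ).prod ⊗ₜ[F] ((List.finRange r).map fun i => (X * V) i i).prod := by
  set ζ : Fin r → W ⊗[F] A := fun i => ∑ a, ξ a ⊗ₜ[F] (X * V) a i with hζ
  have hζη : ∀ i, ζ i = ∑ k, η k * (1 ⊗ₜ[F] V k i) := by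
    intro i
    simp only [hζ, hη, Finset.sum_mul, Algebra.TensorProduct.tmul_mul_tmul, mul_one]
    rw [Finset.sum_comm]
    refine Finset.sum_congr rfl fun a _ => ?_
    rw [Matrix.mul_apply, TensorProduct.tmul_sum]
  -- The corrections in `ζ i` are multiples of `η k` with `k < i`, which already stand to the left.
  -- Growing prefixes keeps the coefficients at the right end, so none has to be commuted.
  have h1 : ∀ l : List (Fin r), l <+: List.finRange r → (l.map η).prod = (l.map ζ).prod := by
    intro l
    induction l using List.reverseRecOn with
    | nil => simp
    | append_singleton l i ih =>
      intro hl
      have ih := ih ((List.prefix_append l [i]).trans hl)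
      rw [List.map_append, List.prod_append, List.map_append, List.prod_append,
        List.map_singleton, List.prod_singleton, List.map_singleton, List.prod_singleton, ← ih,
        hζη, Finset.mul_sum, Finset.sum_eq_single i]
      · rw [hV, ← Algebra.TensorProduct.one_def, mul_one]
      · intro k _ hk
        rcases lt_or_gt_of_ne hk with h | h
        · rw [← mul_assoc, list_prod_mul_eq_zero hsq hcomm (mem_of_prefix_finRange hl h), zero_mul]
        · rw [hV' k i h, TensorProduct.tmul_zero, mul_zero, mul_zero]
      · exact fun h => absurd (Finset.mem_univ i) h
  -- By triangularity `ζ i` involves only `ξ a` with `a ≥ i`, and those with `a > i` recur further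
  -- right; hence suffixes.
  have h2 : ∀ l : List (Fin r), l <:+ List.finRange r →
      (l.map ζ).prod = (l.map ξ).prod ⊗ₜ[F] (l.map fun i => (X * V) i i).prod := by
    intro l
    induction l with
    | nil => intro _; simp [Algebra.TensorProduct.one_def]
    | cons i l ih =>
      intro hl
      have ih := ih ((List.suffix_cons i l).trans hl)
      rw [List.map_cons, List.prod_cons, ih, hζ, Finset.sum_mul, Finset.sum_eq_single i]
      · rw [Algebra.TensorProduct.tmul_mul_tmul]
        simp
      · intro a _ ha
        rw [Algebra.TensorProduct.tmul_mul_tmul]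
        rcases lt_or_gt_of_ne ha with h | h
        · rw [hXV a i h, zero_mul, TensorProduct.tmul_zero]
        · rw [mul_list_prod_eq_zero hξ hξ' (mem_of_suffix_finRange hl h),
            TensorProduct.zero_tmul]
      · exact fun h => absurd (Finset.mem_univ i) h
  rw [h1 _ (List.prefix_refl _), h2 _ (List.suffix_refl _)]

/-- Left elimination: if the rows of `Y` anticommute and `U Y` is lower triangular for an upper
unitriangular `U`, then the product of the rows is the product of the diagonal of `U Y`. -/
theorem prod_rows_eq {ξ : Fin r → W} {c₀ c : Fin r → Fin r → F}
    (hξ : ∀ i, ξ i * ξ i = 0) (hξ' : ∀ i j, ξ i * ξ j = c₀ i j • (ξ j * ξ i))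
    (Y U : Matrix (Fin r) (Fin r) A) (η : Fin r → W ⊗[F] A)
    (hη : ∀ k, η k = ∑ a, ξ a ⊗ₜ[F] Y k a)
    (hsq : ∀ i, η i * η i = 0) (hcomm : ∀ i j, η i * η j = c i j • (η j * η i))
    (hU : ∀ i, U i i = 1) (hU' : ∀ i k, k < i → U i k = 0)
    (hUY : ∀ i a, i < a → (U * Y) i a = 0) :
    ((List.finRange r).map η).prod =
      ((List.finRange r).map ξ).prod ⊗ₜ[F] ((List.finRange r).map fun i => (U * Y) i i).prod := by
  set ζ : Fin r → W ⊗[F] A := fun i => ∑ a, ξ a ⊗ₜ[F] (U * Y) i a with hζ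
  have hζη : ∀ i, ζ i = ∑ k, (1 ⊗ₜ[F] U i k) * η k := by
    intro i
    simp only [hζ, hη, Finset.mul_sum, Algebra.TensorProduct.tmul_mul_tmul, one_mul]
    rw [Finset.sum_comm]
    refine Finset.sum_congr rfl fun a _ => ?_
    rw [Matrix.mul_apply, TensorProduct.tmul_sum]
  -- Here the coefficients stand on the left, so suffixes and prefixes exchange roles.
  have h1 : ∀ l : List (Fin r), l <:+ List.finRange r → (l.map η).prod = (l.map ζ).prod := by
    intro l
    induction l with
    | nil => simp
    | cons i l ih =>
      intro hl
      have ih := ih ((List.suffix_cons i l).trans hl)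
      rw [List.map_cons, List.prod_cons, List.map_cons, List.prod_cons, ← ih,
        hζη, Finset.sum_mul, Finset.sum_eq_single i]
      · rw [hU, ← Algebra.TensorProduct.one_def, one_mul]
      · intro k _ hk
        rcases lt_or_gt_of_ne hk with h | h
        · rw [hU' i k h, TensorProduct.tmul_zero, zero_mul, zero_mul]
        · rw [mul_assoc, mul_list_prod_eq_zero hsq hcomm (mem_of_suffix_finRange hl h), mul_zero]
      · exact fun h => absurd (Finset.mem_univ i) h
  have h2 : ∀ l : List (Fin r), l <+: List.finRange r →
      (l.map ζ).prod = (l.map ξ).prod ⊗ₜ[F] (l.map fun i => (U * Y) i i).prod := by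
    intro l
    induction l using List.reverseRecOn with
    | nil => intro _; simp [Algebra.TensorProduct.one_def]
    | append_singleton l i ih =>
      intro hl
      have ih := ih ((List.prefix_append l [i]).trans hl)
      rw [List.map_append, List.prod_append, List.map_singleton, List.prod_singleton, ih, hζ,
        Finset.mul_sum, Finset.sum_eq_single i]
      · rw [Algebra.TensorProduct.tmul_mul_tmul]
        simp
      · intro a _ ha
        rw [Algebra.TensorProduct.tmul_mul_tmul]
        rcases lt_or_gt_of_ne ha with h | h
        · rw [list_prod_mul_eq_zero hξ hξ' (mem_of_prefix_finRange hl h), TensorProduct.zero_tmul]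
        · rw [hUY i a h, mul_zero, TensorProduct.tmul_zero]
      · exact fun h => absurd (Finset.mem_univ i) h
  rw [h1 _ (List.suffix_refl _), h2 _ (List.prefix_refl _)]

end Wedge

/-! ## Quasideterminants and triangular factorization -/

section Elimination

variable {A : Type*} [Ring A] {N : ℕ}

theorem sum_dite_lt {M : Type*} [AddCommMonoid M] {k : ℕ} (hk : k ≤ N) (g : Fin k → M) :
    ∑ j : Fin N, (if h : j.val < k then g ⟨j, h⟩ else 0) = ∑ j : Fin k, g j := by
  symm
  refine Fintype.sum_of_injective (Fin.castLE hk) (Fin.castLE_injective hk) _ _ (fun j hj => ?_)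
    (fun j => ?_)
  · rw [dif_neg]
    exact fun h => hj ⟨⟨j, h⟩, rfl⟩
  · rw [dif_pos (by simp)]
    rfl

theorem leadingQuasidet_eq (X : Matrix (Fin N) (Fin N) A) (i : Fin N) :
    leadingQuasidet X i = X i i - ∑ k, ∑ l, X i (Fin.castLE i.isLt.le k) *
      Ring.inverse (leading X i i.isLt.le) k l * X (Fin.castLE i.isLt.le l) i := by
  rw [leadingQuasidet, quasidet]
  simp only [Fin.succAbove_last]
  rfl

/-- The upper unitriangular matrix that makes `X` lower triangular by column operations. -/
noncomputable def columnElimination (X : Matrix (Fin N) (Fin N) A) : Matrix (Fin N) (Fin N) A :=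
  Matrix.of fun k i => if h : k.val < i.val then
    -∑ l, Ring.inverse (leading X i i.isLt.le) ⟨k, h⟩ l * X (Fin.castLE i.isLt.le l) i
    else if k = i then 1 else 0

theorem columnElimination_self (X : Matrix (Fin N) (Fin N) A) (i : Fin N) :
    columnElimination X i i = 1 := by
  simp [columnElimination]

theorem columnElimination_lower (X : Matrix (Fin N) (Fin N) A) {k i : Fin N} (h : i < k) :
    columnElimination X k i = 0 := by
  rw [columnElimination, Matrix.of_apply, dif_neg (by simpa using h.le), if_neg h.ne']

theorem mul_columnElimination (X : Matrix (Fin N) (Fin N) A) (a i : Fin N) :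
    (X * columnElimination X) a i = X a i - ∑ k, ∑ l, X a (Fin.castLE i.isLt.le k) *
      Ring.inverse (leading X i i.isLt.le) k l * X (Fin.castLE i.isLt.le l) i := by
  have h : ∀ k, X a k * columnElimination X k i = (if k = i then X a i else 0) -
      (if h : k.val < i.val then ∑ l, X a (Fin.castLE i.isLt.le ⟨k, h⟩) *
      Ring.inverse (leading X i i.isLt.le) ⟨k, h⟩ l * X (Fin.castLE i.isLt.le l) i else 0) := by
    intro k
    rw [columnElimination, Matrix.of_apply]
    by_cases hk : k.val < i.val
    · rw [dif_pos hk, dif_pos hk, if_neg (by rintro rfl; exact lt_irrefl _ hk), zero_sub, mul_neg,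
        Finset.mul_sum]
      simp only [mul_assoc]
      rfl
    · rw [dif_neg hk, dif_neg hk, sub_zero]
      by_cases hki : k = i
      · subst hki
        simp
      · simp [hki]
  rw [Matrix.mul_apply, Finset.sum_congr rfl fun k _ => h k, Finset.sum_sub_distrib,
    sum_dite_lt i.isLt.le fun k => ∑ l, X a (Fin.castLE i.isLt.le k) *
      Ring.inverse (leading X i i.isLt.le) k l * X (Fin.castLE i.isLt.le l) i]
  simp

theorem mul_columnElimination_self (X : Matrix (Fin N) (Fin N) A) (i : Fin N) :
    (X * columnElimination X) i i = leadingQuasidet X i := by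
  rw [mul_columnElimination, leadingQuasidet_eq]

/-- For `a < i` the first entries of row `a` form a row of the leading block. Multiplied by the
inverse block they give a unit row, so the correction equals `X a i`. -/
theorem mul_columnElimination_upper (X : Matrix (Fin N) (Fin N) A) {a i : Fin N} (h : a < i)
    (hX : IsUnit (leading X i i.isLt.le)) : (X * columnElimination X) a i = 0 := by
  rw [mul_columnElimination, Finset.sum_comm, sub_eq_zero]
  simp only [← Finset.sum_mul]
  have h1 : ∀ l, ∑ k, X a (Fin.castLE i.isLt.le k) * Ring.inverse (leading X i i.isLt.le) k l =
      (1 : Matrix (Fin i) (Fin i) A) ⟨a, h⟩ l := by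
    intro l
    rw [← Ring.mul_inverse_cancel _ hX, Matrix.mul_apply]
    rfl
  simp only [h1, Matrix.one_apply, ite_mul, one_mul, zero_mul, Finset.sum_ite_eq,
    Finset.mem_univ, if_true]
  rfl

/-- The rows are the last rows of the inverses of the leading principal submatrices. -/
noncomputable def rowElimination (X : Matrix (Fin N) (Fin N) A) : Matrix (Fin N) (Fin N) A :=
  Matrix.of fun i a => if h : a.val < i.val + 1 then
    Ring.inverse (leading X (i.val + 1) i.isLt) (Fin.last i.val) ⟨a, h⟩ else 0

theorem rowElimination_upper (X : Matrix (Fin N) (Fin N) A) {i a : Fin N} (h : i < a) :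
    rowElimination X i a = 0 := by
  rw [rowElimination, Matrix.of_apply, dif_neg]
  have : i.val < a.val := h
  omega

theorem rowElimination_mul (X : Matrix (Fin N) (Fin N) A) (i : Fin N) {k : Fin N} (hk : k ≤ i)
    (hX : IsUnit (leading X (i.val + 1) i.isLt)) :
    (rowElimination X * X) i k = (1 : Matrix (Fin N) (Fin N) A) i k := by
  have hk' : k.val < i.val + 1 := Nat.lt_succ_of_le hk
  have h : ∀ a, rowElimination X i a * X a k = if h : a.val < i.val + 1 then
      Ring.inverse (leading X (i.val + 1) i.isLt) (Fin.last i.val) ⟨a, h⟩ *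
        leading X (i.val + 1) i.isLt ⟨a, h⟩ ⟨k, hk'⟩ else 0 := by
    intro a
    rw [rowElimination, Matrix.of_apply]
    split_ifs
    · rfl
    · rw [zero_mul]
  rw [Matrix.mul_apply, Finset.sum_congr rfl fun a _ => h a, sum_dite_lt i.isLt fun a =>
    Ring.inverse (leading X (i.val + 1) i.isLt) (Fin.last i.val) a *
        leading X (i.val + 1) i.isLt a ⟨k, hk'⟩, ← Matrix.mul_apply, Ring.inverse_mul_cancel _ hX,
    Matrix.one_apply, Matrix.one_apply]
  congr 1
  rw [Fin.ext_iff, Fin.ext_iff]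
  rfl

/-- With L and V the row and column eliminations, the entry (i, i) of L X V is computed in two ways:
(L X) V has only the term 1, since V is upper unitriangular, while L (X V) has only the diagonal
term. -/
theorem rowElimination_self_mul (X : Matrix (Fin N) (Fin N) A) (i : Fin N)
    (hX : IsUnit (leading X i i.isLt.le)) (hX' : IsUnit (leading X (i.val + 1) i.isLt)) :
    rowElimination X i i * leadingQuasidet X i = 1 := by
  have h1 : (rowElimination X * X * columnElimination X) i i = 1 := by
    rw [Matrix.mul_apply, Finset.sum_eq_single i]
    · rw [rowElimination_mul X i le_rfl hX', columnElimination_self, Matrix.one_apply_eq, mul_one]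
    · intro k _ hk
      rcases lt_or_gt_of_ne hk with h | h
      · rw [rowElimination_mul X i h.le hX', Matrix.one_apply_ne hk.symm, zero_mul]
      · rw [columnElimination_lower X h, mul_zero]
    · exact fun h => absurd (Finset.mem_univ i) h
  rw [← h1, Matrix.mul_assoc, Matrix.mul_apply, Finset.sum_eq_single i]
  · rw [mul_columnElimination_self]
  · intro k _ hk
    rcases lt_or_gt_of_ne hk with h | h
    · rw [mul_columnElimination_upper X h hX, mul_zero]
    · rw [rowElimination_upper X h, zero_mul]
  · exact fun h => absurd (Finset.mem_univ i) h

/-- Over a noncommutative ring the other one-sided inverse needs its own argument, by solving for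
the last column of the inverse block. -/
theorem leadingQuasidet_mul_rowElimination (X : Matrix (Fin N) (Fin N) A) (i : Fin N)
    (hX : IsUnit (leading X i i.isLt.le)) (hX' : IsUnit (leading X (i.val + 1) i.isLt)) :
    leadingQuasidet X i * rowElimination X i i = 1 := by
  set B := leading X (i.val + 1) i.isLt with hB
  set P := leading X i i.isLt.le with hP
  set C := Ring.inverse B with hC
  have hl : rowElimination X i i = C (Fin.last _) (Fin.last _) := by
    rw [rowElimination, Matrix.of_apply, dif_pos (Nat.lt_succ_self _)]
    rfl
  let t : Fin i → A := fun k => ∑ l, Ring.inverse P k l * X (Fin.castLE i.isLt.le l) i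
  -- Block elimination predicts that the upper part of the last column of `C` is `-t` times the
  -- corner entry. The deviation `y` is annihilated by the invertible `P`, so it is zero, and the
  -- last row then gives the claim.
  let y : Fin i → A := fun k => C k.castSucc (Fin.last _) + t k * C (Fin.last _) (Fin.last _)
  have hXV : ∀ a, (X * columnElimination X) a i =
      X a i - ∑ k, X a (Fin.castLE i.isLt.le k) * t k := by
    intro a
    rw [mul_columnElimination]
    simp only [t, Finset.mul_sum, mul_assoc]
    rfl
  have hy : ∀ a, ∑ k : Fin i, B a k.castSucc * y k =
      (1 : Matrix (Fin (i.val + 1)) (Fin (i.val + 1)) A) a (Fin.last _) -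
        (X * columnElimination X) (Fin.castLE i.isLt a) i * C (Fin.last _) (Fin.last _) := by
    intro a
    rw [← Ring.mul_inverse_cancel B hX', Matrix.mul_apply, Fin.sum_univ_castSucc, ← hC, hXV,
      sub_mul, Finset.sum_mul]
    simp only [y, mul_add, Finset.sum_add_distrib, ← mul_assoc]
    have e : B a (Fin.last _) = X (Fin.castLE i.isLt a) i := rfl
    rw [e]
    change _ + ∑ k, X (Fin.castLE i.isLt a) (Fin.castLE i.isLt.le k) * t k * _ = _
    abel
  have hPy : P.mulVec y = 0 := by
    funext a
    have h := hy a.castSucc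
    rw [mul_columnElimination_upper X (show Fin.castLE i.isLt a.castSucc < i from a.isLt) hX,
      zero_mul, sub_zero, Matrix.one_apply_ne (Fin.castSucc_lt_last a).ne] at h
    exact h
  have hy0 : y = 0 := by
    rw [← Matrix.one_mulVec y, ← Ring.inverse_mul_cancel P hX, ← Matrix.mulVec_mulVec, hPy,
      Matrix.mulVec_zero]
  have h := hy (Fin.last _)
  simp only [hy0, Pi.zero_apply, mul_zero, Finset.sum_const_zero, Matrix.one_apply_eq] at h
  rw [hl, ← mul_columnElimination_self X i]
  exact (sub_eq_zero.1 h.symm).symm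

end Elimination

/-! ## The coefficients of the coaction -/

section Coefficients

variable {F : Type u} [Field F] [CharZero F] (q : Fˣ) (m n d : ℕ)

/-- Apply a functional to the exterior factor. -/
noncomputable def extCoeff (T : QExt q m n →ₗ[F] F) :
    STensor F (QExt q m n) (Mtilde q m n d) →ₗ[F] Mtilde q m n d :=
  (TensorProduct.lid F _).toLinearMap ∘ₗ LinearMap.rTensor _ T ∘ₗ
    (GradedTensorProduct.of F (grading F (QExt q m n))
      (grading F (Mtilde q m n d))).symm.toLinearMap

theorem extCoeff_tmul (T : QExt q m n →ₗ[F] F) (w : QExt q m n) (a : Mtilde q m n d) :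
    extCoeff q m n d T (w ᵍ⊗ₜ[F] a) = T w • a := by
  simp [extCoeff]

/-- Apply a functional to the symmetric factor. -/
noncomputable def symCoeff (T : QSym q m n →ₗ[F] F) :
    STensor F (QSym q m n) (SuperOp F (Mtilde q m n d)) →ₗ[F] Mtilde q m n d :=
  (TensorProduct.lid F _).toLinearMap ∘ₗ
    TensorProduct.map T (toOp F (Mtilde q m n d)).symm.toLinearMap ∘ₗ
    (GradedTensorProduct.of F (grading F (QSym q m n))
      (grading F (SuperOp F (Mtilde q m n d)))).symm.toLinearMap

theorem symCoeff_tmul (T : QSym q m n →ₗ[F] F) (s : QSym q m n) (b : Mtilde q m n d) :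
    symCoeff q m n d T (s ᵍ⊗ₜ[F] toOp F _ b) = T s • b := by
  simp [symCoeff]

/-- The merging sign amounts to applying the parity map to the exterior coefficient when `s` is odd,
which does nothing to an even coefficient. -/
theorem lid_rTensor_mergeK (T : QExt q m n →ₗ[F] F) (T' : QSym q m n →ₗ[F] F)
    (X : STensor F (QExt q m n) (Mtilde q m n d))
    (hX : par F (extCoeff q m n d T X) = extCoeff q m n d T X)
    (Y : STensor F (QSym q m n) (SuperOp F (Mtilde q m n d))) :
    TensorProduct.lid F _ (LinearMap.rTensor _ (tensorFunctional q m n T T')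
      (mergeK q m n d X Y)) = extCoeff q m n d T X * symCoeff q m n d T' Y := by
  induction Y using stensor_induction with
  | hadd Y Y' h h' => simp only [map_add, h, h', mul_add]
  | htmul z _ s b hs _ =>
    obtain ⟨b, rfl⟩ := (toOp F _).surjective b
    let p : Mtilde q m n d →ₗ[F] Mtilde q m n d :=
      if z = 0 then LinearMap.id else (par F : Mtilde q m n d →ₐ[F] Mtilde q m n d).toLinearMap
    have hp : ∀ {y : ZMod 2} {a : Mtilde q m n d}, a ∈ grading F (Mtilde q m n d) y →
        p a = sgn F (y * z) • a := by
      intro y a ha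
      rcases zmod2_cases z with rfl | rfl
      · simp [p, sgn_zero]
      · rw [mul_one, ← mem_grading.1 ha]
        simp [p]
    have key : ∀ X, TensorProduct.lid F _ (LinearMap.rTensor _ (tensorFunctional q m n T T')
        (mergeK q m n d X (s ᵍ⊗ₜ[F] toOp F _ b))) = p (extCoeff q m n d T X) * T' s • b := by
      intro X
      induction X using stensor_induction with
      | hadd X X' h h' => simp only [map_add, LinearMap.add_apply, h, h', add_mul]
      | htmul y _ w a _ ha =>
        rw [mergeK_tmul q m n d w ha hs, map_smul, LinearMap.rTensor_tmul, map_smul,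
          TensorProduct.lid_tmul, tensorFunctional_tmul, extCoeff_tmul, map_smul, hp ha,
          smul_mul_assoc, smul_mul_assoc, mul_smul_comm, smul_smul, smul_smul, smul_smul]
        congr 1
        ring
    rw [key, symCoeff_tmul]
    congr 1
    by_cases hz : z = 0
    · simp [p, hz]
    · simpa [p, hz] using hX

/-! ### Evaluation of the two coefficients in an algebra -/

variable {A : Type*} [Ring A] [Algebra F A] (f : Mtilde q m n d →ₐ[F] A)

/-- Kill the odd `ψ_i` and map the coefficients to `A`. -/
noncomputable def extEval : STensor F (QExt q m n) (Mtilde q m n d) →ₗ[F] QExt q m n ⊗[F] A :=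
  TensorProduct.map (extEven q m n).toLinearMap f.toLinearMap ∘ₗ
    (GradedTensorProduct.of F (grading F (QExt q m n))
      (grading F (Mtilde q m n d))).symm.toLinearMap

theorem extEval_tmul (w : QExt q m n) (a : Mtilde q m n d) :
    extEval q m n d f (w ᵍ⊗ₜ[F] a) = extEven q m n w ⊗ₜ f a := by
  simp [extEval]

/-- The even part of the image of `φ_i`. -/
noncomputable def extVec (i : Fin m) : QExt q m n ⊗[F] A :=
  ∑ a : Fin m, ψ q m n (Fin.castAdd n a) ⊗ₜ[F]
    f (genM q m n d (Fin.castAdd n a) (Fin.castAdd n i))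

/-- The surviving entries of M have two even indices, so they are even and no sign arises; this
replaces the super tensor product by the ordinary one. -/
theorem extEval_phi_mul (i : Fin m) (X : STensor F (QExt q m n) (Mtilde q m n d)) :
    extEval q m n d f (phi q m n d (Fin.castAdd n i) * X) =
      extVec q m n d f i * extEval q m n d f X := by
  induction X using stensor_induction with
  | hadd X X' h h' => rw [mul_add, map_add, map_add, h, h', mul_add]
  | htmul y _ w a hw _ =>
    rw [phi, Finset.sum_mul, map_sum, Fin.sum_univ_add, extVec, Finset.sum_mul]
    have e : ∀ j, extEval q m n d f ((ψ q m n j ᵍ⊗ₜ[F] genM q m n d j (Fin.castAdd n i) :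
        STensor F (QExt q m n) (Mtilde q m n d)) * w ᵍ⊗ₜ[F] a) =
        sgn F ((pty m n j + pty m n (Fin.castAdd n i)) * y) •
          ((extEven q m n (ψ q m n j) * extEven q m n w) ⊗ₜ[F]
            (f (genM q m n d j (Fin.castAdd n i)) * f a)) := by
      intro j
      refine (congrArg (extEval q m n d f) (tmul_mul_tmul _ (Mbar_mem q m n d 0 j _) hw _)).trans ?_
      rw [map_smul, extEval_tmul, map_mul, map_mul]
    rw [Finset.sum_eq_zero (s := (Finset.univ : Finset (Fin n))), add_zero]
    · refine Finset.sum_congr rfl fun j _ => ?_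
      refine (e _).trans ?_
      rw [extEven_ψ, pty_castAdd, pty_castAdd, if_pos rfl, extEval_tmul,
        Algebra.TensorProduct.tmul_mul_tmul, add_zero, zero_mul, sgn_zero, one_smul]
    · intro j _
      refine (e _).trans ?_
      rw [extEven_ψ, pty_natAdd, if_neg one_ne_zero, zero_mul, TensorProduct.zero_tmul, smul_zero]

theorem extEval_one : extEval q m n d f 1 = 1 := by
  refine (extEval_tmul q m n d f 1 1).trans ?_
  rw [map_one, map_one, Algebra.TensorProduct.one_def]

theorem extEval_prod_phi (l : List (Fin m)) :
    extEval q m n d f (l.map fun i => phi q m n d (Fin.castAdd n i)).prod =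
      (l.map (extVec q m n d f)).prod := by
  induction l with
  | nil => exact extEval_one q m n d f
  | cons i l ih => rw [List.map_cons, List.prod_cons, extEval_phi_mul, ih, List.map_cons,
      List.prod_cons]

theorem extVec_mul (i j : Fin m) : extVec q m n d f i * extVec q m n d f j =
    extEval q m n d f (phi q m n d (Fin.castAdd n i) * phi q m n d (Fin.castAdd n j)) := by
  have h := extEval_phi_mul q m n d f j 1
  rw [mul_one, extEval_one, mul_one] at h
  rw [extEval_phi_mul, h]

theorem extVec_sq (i : Fin m) : extVec q m n d f i * extVec q m n d f i = 0 := by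
  rw [extVec_mul, phi_sq q m n d (pty_castAdd m n i), map_zero]

theorem extVec_comm (i j : Fin m) : extVec q m n d f i * extVec q m n d f j =
    (qe q (Fin.castAdd n j) (Fin.castAdd n i) * sgn F ((pty m n (Fin.castAdd n i) + 1) *
      (pty m n (Fin.castAdd n j) + 1))) • (extVec q m n d f j * extVec q m n d f i) := by
  rw [extVec_mul, extVec_mul, phi_comm, map_smul]

theorem map_extCoeff {T : QExt q m n →ₗ[F] F} (hT : ∀ w, T (extEven q m n w) = T w)
    (X : STensor F (QExt q m n) (Mtilde q m n d)) :
    f (extCoeff q m n d T X) =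
      TensorProduct.lid F A (LinearMap.rTensor A T (extEval q m n d f X)) := by
  induction X using stensor_induction with
  | hadd X X' h h' => simp only [map_add, h, h']
  | htmul y _ w a _ _ =>
    rw [extCoeff_tmul, extEval_tmul, map_smul, LinearMap.rTensor_tmul, hT, TensorProduct.lid_tmul]

theorem deltaExt_prod : deltaExt q m n d (List.ofFn fun i : Fin m => ψ q m n (Fin.castAdd n i)).prod =
    ((List.finRange m).map fun i => phi q m n d (Fin.castAdd n i)).prod := by
  rw [List.ofFn_eq_map, map_list_prod, List.map_map]
  congr 2
  funext i
  exact deltaExt_ψ q m n d _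

/-- The coefficient of `ψ_1 ⋯ ψ_m` in the coaction on it is even. -/
theorem par_extCoeff {T : QExt q m n →ₗ[F] F} (hT : ∀ w, T (extEven q m n w) = T w) :
    par F (extCoeff q m n d T (deltaExt q m n d
        (List.ofFn fun i : Fin m => ψ q m n (Fin.castAdd n i)).prod)) =
      extCoeff q m n d T (deltaExt q m n d
        (List.ofFn fun i : Fin m => ψ q m n (Fin.castAdd n i)).prod) := by
  -- The coefficient is computed from the entries of M with two even indices, so evaluating it
  -- through the parity map and through the identity gives the same result.
  have h1 := map_extCoeff q m n d (par F : Mtilde q m n d →ₐ[F] Mtilde q m n d) hT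
    (deltaExt q m n d (List.ofFn fun i : Fin m => ψ q m n (Fin.castAdd n i)).prod)
  have h2 := map_extCoeff q m n d (AlgHom.id F (Mtilde q m n d)) hT
    (deltaExt q m n d (List.ofFn fun i : Fin m => ψ q m n (Fin.castAdd n i)).prod)
  rw [deltaExt_prod, extEval_prod_phi, ← deltaExt_prod] at h1 h2
  refine h1.trans (Eq.trans ?_ h2.symm)
  have : extVec q m n d (par F : Mtilde q m n d →ₐ[F] Mtilde q m n d) =
      extVec q m n d (AlgHom.id F (Mtilde q m n d)) := by
    funext i
    refine Finset.sum_congr rfl fun a _ => ?_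
    rw [mem_grading.1 (Mbar_mem q m n d 0 _ _), pty_castAdd, pty_castAdd, add_zero, sgn_zero,
      one_smul]
    rfl
  rw [this]

/-- The coefficient of `ψ_1 ⋯ ψ_m` is the product of the leading quasideterminants. -/
theorem map_extCoeff_deltaExt {T : QExt q m n →ₗ[F] F} (hT : ∀ w, T (extEven q m n w) = T w)
    (hT1 : T (List.ofFn fun i : Fin m => ψ q m n (Fin.castAdd n i)).prod = 1)
    (hM : ∀ (k : ℕ) (hk : k ≤ m + n), IsUnit (leading ((genM q m n d).map f) k hk)) :
    f (extCoeff q m n d T (deltaExt q m n d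
        (List.ofFn fun i : Fin m => ψ q m n (Fin.castAdd n i)).prod)) =
      (List.ofFn fun i : Fin m =>
        leadingQuasidet ((genM q m n d).map f) (Fin.castAdd n i)).prod := by
  -- The leading submatrices and quasideterminants of this block are definitionally those of the
  -- whole matrix.
  set X : Matrix (Fin m) (Fin m) A :=
    ((genM q m n d).map f).submatrix (Fin.castAdd n) (Fin.castAdd n) with hX
  have h := prod_columns_eq (ξ := fun i => ψ q m n (Fin.castAdd n i))
    (fun i => ψ_sq q m n (pty_castAdd m n i)) (fun i j => ψ_comm q m n _ _)
    X (columnElimination X) (extVec q m n d f) (fun k => rfl)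
    (extVec_sq q m n d f) (extVec_comm q m n d f) (columnElimination_self X)
    (fun k i h => columnElimination_lower X h)
    (fun a i h => mul_columnElimination_upper X h (hM i (i.isLt.le.trans (Nat.le_add_right m n))))
  rw [map_extCoeff q m n d f hT, deltaExt_prod, extEval_prod_phi, h, LinearMap.rTensor_tmul,
    ← List.ofFn_eq_map, hT1, TensorProduct.lid_tmul, one_smul, List.ofFn_eq_map]
  congr 2
  funext i
  exact mul_columnElimination_self X i

/-- Kill the even `x_i` and map the coefficients to `A`. -/
noncomputable def symEval : STensor F (QSym q m n) (SuperOp F (Mtilde q m n d)) →ₗ[F]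
    (QSym q m n)ᵐᵒᵖ ⊗[F] A :=
  TensorProduct.map ((MulOpposite.opLinearEquiv F).toLinearMap ∘ₗ (symOdd q m n).toLinearMap)
    (f.toLinearMap ∘ₗ (toOp F (Mtilde q m n d)).symm.toLinearMap) ∘ₗ
    (GradedTensorProduct.of F (grading F (QSym q m n))
      (grading F (SuperOp F (Mtilde q m n d)))).symm.toLinearMap

theorem symEval_tmul (s : QSym q m n) (b : Mtilde q m n d) :
    symEval q m n d f (s ᵍ⊗ₜ[F] toOp F _ b) = MulOpposite.op (symOdd q m n s) ⊗ₜ f b := by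
  simp [symEval]

/-- The odd part of the image of `∑_k x_k ⊗ ι((M^{st})_{ki})`. -/
noncomputable def symVec (i : Fin n) : (QSym q m n)ᵐᵒᵖ ⊗[F] A :=
  ∑ a : Fin n, MulOpposite.op (x q m n (Fin.natAdd m a)) ⊗ₜ[F]
    f (genMInv q m n d (Fin.natAdd m i) (Fin.natAdd m a))

/-- For two odd indices the entry of M⁻¹ is even and the supertranspose sign is 1. The order is
reversed in both factors, by `MulOpposite` on the x's and by `SuperOp` on the coefficients, so left
multiplication becomes right multiplication. -/
theorem symEval_upsilon_mul (i : Fin n)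
    (X : STensor F (QSym q m n) (SuperOp F (Mtilde q m n d))) :
    symEval q m n d f (upsilon q m n d (Fin.natAdd m i) * X) =
      symEval q m n d f X * symVec q m n d f i := by
  induction X using stensor_induction with
  | hadd X X' h h' => rw [mul_add, map_add, map_add, h, h', add_mul]
  | htmul y z s b hs hb =>
    obtain ⟨b, rfl⟩ := (toOp F _).surjective b
    replace hb : b ∈ grading F (Mtilde q m n d) z := hb
    rw [upsilon, Finset.sum_mul, map_sum, Fin.sum_univ_add, symVec, Finset.mul_sum]
    have e : ∀ k, symEval q m n d f ((x q m n k ᵍ⊗ₜ[F] toOp F _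
          (supertranspose F (genMInv q m n d) k (Fin.natAdd m i)) :
        STensor F (QSym q m n) (SuperOp F (Mtilde q m n d))) * s ᵍ⊗ₜ[F] toOp F _ b) =
        (sgn F ((pty m n (Fin.natAdd m i) + pty m n k) * y) *
          (sgn F ((pty m n (Fin.natAdd m i) + pty m n k) * z) *
            sgn F (pty m n k * (pty m n k + pty m n (Fin.natAdd m i))))) •
          ((MulOpposite.op (symOdd q m n (x q m n k) * symOdd q m n s)) ⊗ₜ[F]
            (f b * f (genMInv q m n d (Fin.natAdd m i) k))) := by
      intro k
      refine (congrArg (symEval q m n d f)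
        (tmul_mul_tmul _ (toOp_mem (st_mem q m n d k _)) hs _)).trans ?_
      rw [toOp_mul (st_mem q m n d k _) hb, supertranspose, Matrix.of_apply, mul_smul_comm,
        map_smul (toOp F _), smul_smul, gtmul_smul, smul_smul, map_smul, symEval_tmul, map_mul,
        map_mul]
    rw [Finset.sum_eq_zero (s := (Finset.univ : Finset (Fin m))), zero_add]
    · refine Finset.sum_congr rfl fun k _ => ?_
      refine (e _).trans ?_
      have h2 : (1 : ZMod 2) + 1 = 0 := by decide
      rw [symOdd_x, pty_natAdd, pty_natAdd, if_pos rfl, symEval_tmul,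
        Algebra.TensorProduct.tmul_mul_tmul, h2, zero_mul, zero_mul, mul_zero, sgn_zero, one_mul,
        one_mul, one_smul, MulOpposite.op_mul]
    · intro k _
      refine (e _).trans ?_
      rw [symOdd_x, pty_castAdd, if_neg zero_ne_one, zero_mul (symOdd q m n s), MulOpposite.op_zero,
        TensorProduct.zero_tmul, smul_zero]

theorem symEval_one : symEval q m n d f 1 = 1 := by
  refine (symEval_tmul q m n d f 1 1).trans ?_
  rw [map_one, map_one, Algebra.TensorProduct.one_def, MulOpposite.op_one]

theorem symEval_prod_upsilon (l : List (Fin n)) :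
    symEval q m n d f (l.map fun i => upsilon q m n d (Fin.natAdd m i)).prod =
      (l.reverse.map (symVec q m n d f)).prod := by
  induction l with
  | nil => exact symEval_one q m n d f
  | cons i l ih => rw [List.map_cons, List.prod_cons, symEval_upsilon_mul, ih, List.reverse_cons,
      List.map_append, List.prod_append, List.map_singleton, List.prod_singleton]

theorem symVec_mul (i j : Fin n) : symVec q m n d f i * symVec q m n d f j =
    symEval q m n d f (upsilon q m n d (Fin.natAdd m j) * upsilon q m n d (Fin.natAdd m i)) := by
  have h := symEval_upsilon_mul q m n d f i 1
  rw [mul_one, symEval_one, one_mul] at h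
  rw [symEval_upsilon_mul, h]

theorem symVec_sq (i : Fin n) : symVec q m n d f i * symVec q m n d f i = 0 := by
  rw [symVec_mul, upsilon_sq q m n d (pty_natAdd m n i), map_zero]

theorem symVec_comm (i j : Fin n) : symVec q m n d f i * symVec q m n d f j =
    (qe q (Fin.natAdd m j) (Fin.natAdd m i) * sgn F (pty m n (Fin.natAdd m i) *
      pty m n (Fin.natAdd m j))) • (symVec q m n d f j * symVec q m n d f i) := by
  rw [symVec_mul, symVec_mul, upsilon_comm, map_smul]

theorem map_symCoeff {T : QSym q m n →ₗ[F] F} (hT : ∀ w, T (symOdd q m n w) = T w)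
    (X : STensor F (QSym q m n) (SuperOp F (Mtilde q m n d))) :
    f (symCoeff q m n d T X) = TensorProduct.lid F A (LinearMap.rTensor A
      (T ∘ₗ (MulOpposite.opLinearEquiv F).symm.toLinearMap) (symEval q m n d f X)) := by
  induction X using stensor_induction with
  | hadd X X' h h' => simp only [map_add, h, h']
  | htmul y _ w a _ _ =>
    obtain ⟨a, rfl⟩ := (toOp F _).surjective a
    rw [symCoeff_tmul, symEval_tmul, map_smul, LinearMap.rTensor_tmul, TensorProduct.lid_tmul,
      LinearMap.comp_apply]
    congr 1
    exact (hT w).symm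

theorem deltaSym_prod :
    deltaSym q m n d (List.ofFn fun j : Fin n => x q m n (Fin.natAdd m j)).reverse.prod =
    ((List.finRange n).reverse.map fun i => upsilon q m n d (Fin.natAdd m i)).prod := by
  rw [List.ofFn_eq_map, ← List.map_reverse, map_list_prod, List.map_map]
  congr 2
  funext i
  exact deltaSym_x q m n d _

/-- The coefficient of `x_{m+n} ⋯ x_{m+1}` is the product of the inverses of the leading
quasideterminants. -/
theorem map_symCoeff_deltaSym {T : QSym q m n →ₗ[F] F} (hT : ∀ w, T (symOdd q m n w) = T w)
    (hT1 : T (List.ofFn fun j : Fin n => x q m n (Fin.natAdd m j)).reverse.prod = 1)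
    (hM : ∀ (k : ℕ) (hk : k ≤ m + n), IsUnit (leading ((genM q m n d).map f) k hk)) :
    f (symCoeff q m n d T (deltaSym q m n d
        (List.ofFn fun j : Fin n => x q m n (Fin.natAdd m j)).reverse.prod)) =
      (List.ofFn fun j : Fin n =>
        rowElimination ((genM q m n d).map f) (Fin.natAdd m j) (Fin.natAdd m j)).prod := by
  set X := (genM q m n d).map f with hX
  set R := (genMInv q m n d).map f with hR
  have hXR : X * R = 1 := by
    rw [hX, hR, ← Matrix.map_mul, genM_mul_genMInv, Matrix.map_one _ (map_zero f) (map_one f)]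
  set L := rowElimination X with hL
  have hLX : ∀ i k, k ≤ i → (L * X) i k = (1 : Matrix _ _ A) i k := fun i k hk =>
    rowElimination_mul X i hk (hM _ _)
  -- L = (L X) R, and L X vanishes at odd rows and even columns, so the identity restricts to the
  -- odd-odd blocks.
  have hUY : ∀ i a : Fin n, ((L * X).submatrix (Fin.natAdd m) (Fin.natAdd m) *
      R.submatrix (Fin.natAdd m) (Fin.natAdd m)) i a = L (Fin.natAdd m i) (Fin.natAdd m a) := by
    intro i a
    have h : L = L * X * R := by rw [Matrix.mul_assoc, hXR, Matrix.mul_one]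
    conv_rhs => rw [h, Matrix.mul_apply, Fin.sum_univ_add]
    rw [Finset.sum_eq_zero, zero_add, Matrix.mul_apply]
    · rfl
    · intro k _
      have hk : Fin.castAdd n k < Fin.natAdd m i := by
        rw [Fin.lt_def, Fin.val_castAdd, Fin.val_natAdd]
        omega
      rw [hLX _ _ hk.le, Matrix.one_apply_ne hk.ne', zero_mul]
  have h := prod_rows_eq (ξ := fun i => MulOpposite.op (x q m n (Fin.natAdd m i)))
    (c₀ := fun i j => qe q (Fin.natAdd m j) (Fin.natAdd m i) * sgn F (pty m n (Fin.natAdd m i) *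
      pty m n (Fin.natAdd m j)))
    (fun i => by rw [← MulOpposite.op_mul, x_sq q m n (pty_natAdd m n i), MulOpposite.op_zero])
    (fun i j => by rw [← MulOpposite.op_mul, ← MulOpposite.op_mul, ← MulOpposite.op_smul, x_comm])
    (R.submatrix (Fin.natAdd m) (Fin.natAdd m)) ((L * X).submatrix (Fin.natAdd m) (Fin.natAdd m))
    (symVec q m n d f) (fun k => rfl) (symVec_sq q m n d f) (symVec_comm q m n d f)
    (fun i => by rw [Matrix.submatrix_apply, hLX _ _ le_rfl, Matrix.one_apply_eq])
    (fun i k hk => by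
      have hk' : Fin.natAdd m k < Fin.natAdd m i := by simpa using hk
      rw [Matrix.submatrix_apply, hLX _ _ hk'.le, Matrix.one_apply_ne hk'.ne'])
    (fun i a ha => by
      rw [hUY]
      exact rowElimination_upper X (by simpa using ha))
  rw [map_symCoeff q m n d f hT, deltaSym_prod, symEval_prod_upsilon, List.reverse_reverse, h,
    LinearMap.rTensor_tmul]
  have hT2 : (T ∘ₗ (MulOpposite.opLinearEquiv F).symm.toLinearMap)
      ((List.finRange n).map fun i => MulOpposite.op (x q m n (Fin.natAdd m i))).prod = 1 := by
    rw [← hT1, List.ofFn_eq_map, ← List.map_reverse, LinearMap.comp_apply]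
    congr 1
    change MulOpposite.unop (List.prod _) = _
    rw [MulOpposite.unop_list_prod, List.map_map, List.map_reverse]
    rfl
  rw [hT2, TensorProduct.lid_tmul, one_smul, List.ofFn_eq_map]
  congr 2
  funext i
  exact hUY i i

end Coefficients

/-- The largest leading submatrix is M itself, whose inverse exists already in `Mtilde`. -/
theorem isUnit_leading_genM_map {F : Type u} [Field F] (q : Fˣ) (m n d : ℕ) {A : Type*} [Ring A]
    [Algebra F A] (f : Mtilde q m n d →ₐ[F] A)
    (hM : ∀ (k : ℕ) (hk : k < m + n), IsUnit (leading ((genM q m n d).map f) k hk.le))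
    (k : ℕ) (hk : k ≤ m + n) : IsUnit (leading ((genM q m n d).map f) k hk) := by
  rcases hk.lt_or_eq with h | rfl
  · exact hM k h
  · refine ⟨⟨(genM q m n d).map f, (genMInv q m n d).map f, ?_, ?_⟩, rfl⟩
    · rw [← Matrix.map_mul, genM_mul_genMInv, Matrix.map_one _ (map_zero f) (map_one f)]
    · rw [← Matrix.map_mul, genMInv_mul_genM, Matrix.map_one _ (map_zero f) (map_one f)]

end QBer

theorem theorem4p1 {F : Type*} [Field F] [CharZero F] (q : Fˣ) (m n d : ℕ) :
    ∃ Ber : QBer.Mtilde q m n d,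
      (∀ b : QBer.Mtilde q m n d, QBer.IsQuantumBerezinian q m n d b ↔ b = Ber) ∧
      ∀ (A : Type*) [Ring A] [Algebra F A] (f : QBer.Mtilde q m n d →ₐ[F] A),
        (∀ (k : ℕ) (hk : k < m + n),
          IsUnit (QBer.leading ((QBer.genM q m n d).map f) k hk.le)) →
        (∀ j : Fin n, IsUnit
          (QBer.leadingQuasidet ((QBer.genM q m n d).map f) (Fin.natAdd m j))) ∧
        f Ber =
          (List.ofFn fun i : Fin m =>
            QBer.leadingQuasidet ((QBer.genM q m n d).map f) (Fin.castAdd n i)).prod *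
          (List.ofFn fun j : Fin n => Ring.inverse
            (QBer.leadingQuasidet ((QBer.genM q m n d).map f) (Fin.natAdd m j))).prod := by
  obtain ⟨H, T, T', hT1, hT1', hT, hT', hH⟩ := QBer.exists_contraction q m n
  have htop : QBer.tensorFunctional q m n T T' (QBer.top q m n) = 1 := by
    rw [QBer.top, QBer.tensorFunctional_tmul, hT1, hT1', mul_one]
  have hd : ∀ k, QBer.tensorFunctional q m n T T' (QBer.diff q m n k) = 0 :=
    QBer.tensorFunctional_diff q m n hT hT'
  refine ⟨_, QBer.isQuantumBerezinian_iff q m n d H _ htop hd hH, fun A _ _ f hM => ?_⟩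
  have hM' := QBer.isUnit_leading_genM_map q m n d f hM
  -- The diagonal entries of `rowElimination` are two-sided inverses, so `Ring.inverse` in the
  -- formula is a genuine inverse and not its default value 0.
  have hu : ∀ j : Fin n, ∃ u : Aˣ,
      (u : A) = QBer.leadingQuasidet ((QBer.genM q m n d).map f) (Fin.natAdd m j) ∧
      ((u⁻¹ : Aˣ) : A) = QBer.rowElimination ((QBer.genM q m n d).map f)
        (Fin.natAdd m j) (Fin.natAdd m j) := fun j =>
    ⟨⟨_, _, QBer.leadingQuasidet_mul_rowElimination _ _ (hM' _ _) (hM' _ _),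
      QBer.rowElimination_self_mul _ _ (hM' _ _) (hM' _ _)⟩, rfl, rfl⟩
  refine ⟨fun j => ?_, ?_⟩
  · obtain ⟨u, hu, -⟩ := hu j
    exact ⟨u, hu⟩
  · rw [QBer.top, QBer.deltaK_tmul, QBer.lid_rTensor_mergeK q m n d T T' _
      (QBer.par_extCoeff q m n d hT), map_mul, QBer.map_extCoeff_deltaExt q m n d f hT hT1 hM',
      QBer.map_symCoeff_deltaSym q m n d f hT' hT1' hM']
    congr 3
    funext j
    obtain ⟨u, hu, hu'⟩ := hu j
    rw [← hu, Ring.inverse_unit, hu']
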